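/- Let $p>3$ be a prime and let $K$ be a finite extension of the maximal unramified extension $\mathbb{Q}_p^{\mathrm{nr}}$ of $\mathbb{Q}_p$, with algebraic closure $\overline K$. Let $\nu$ be the valuation of $K$ normalised by $\nu(K^\times)=\mathbb{Z}$, extended to $\overline K$. A *Ciani subgroup* of a smooth plane quartic $Y$ over $\overline K$ is a subgroup $V\simeq C_2\times C_2$ of $\mathrm{Aut}_{\overline K}(Y)\subset \mathrm{PGL}_3(\overline K)$ such that $Y/V$ has genus $0$; a quartic that has such a subgroup is *non-special* if it has only one. For a smooth plane quartic $Y_0$ over $K$, $\mathrm{Twist}(Y_0/K)$ is the set of smooth plane quartics over $K$ that are isomorphic to $Y_0$ over $\overline K$, up to isomorphism over $K$. Let $\underline I=(I_3,I_3',I_3'',I_6)\in K^4$ with $\Delta(\underline I)=2^{20}I_3 (I_3'')^4I_6^2\neq 0$. Put $P=8I_3+I_3'-I_3''$ and let $\mathcal A,\mathcal B,\mathcal C\in\overline K$ be the roots, with multiplicity, of $$\mathcal P(T)=T^3-S_1T^2+S_2T-S_3,\quad S_1=I_3'+12I_3,\quad S_2=\tfrac14\bigl(P^2+16I_3(P+I_3'')-I_6\bigr),\quad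 S_3=I_3P^2 .$$ Let $L\subset\overline K$ be the splitting field of $\mathcal P$ over $K$. Order the roots such that $\mathcal A=0$ if $P=0$, also $\mathcal B=0$ if $P=S_2=0$, and $\mathcal A\in K$ if $[L:K]=2$. Let $Y_1(\underline I)$ be the quartic over $\overline K$ with equation * $\mathcal A x^4+\mathcal B y^4+\mathcal C z^4+P(x^2y^2+y^2z^2+z^2x^2)=0$ if $P\ne0$; * $I_3S_2x^4+\mathcal B y^4+\mathcal C z^4+S_2x^2(y^2+z^2)=0$ if $P=0$ and $S_2\neq0$; * $I_3(x^4+y^4+z^4)+r\,x^2y^2=0$, with $r^2=I_3S_1$, if $P=S_2=0$. Assume that $Y_1(\underline I)$ is non-special. Let $\varphi$ be, respectively for $[L:K]=1,2,3$, the matrix $$\begin{pmatrix}1&0&0\\0&1&0\\0&0&1\end{pmatrix},\qquad \begin{pmatrix}1&0&0\\0&1&\mathcal B\\0&1&\mathcal C\end{pmatrix},\qquad \begin{pmatrix}1&\mathcal A&\mathcal A^2\\1&\mathcal B&\mathcal B^2\\1&\mathcal C&\mathcal C^2\end{pmatrix},$$ except that $\varphi=\mathrm{diag}(\sqrt r,1,1)$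 if $P=S_2=0$ and $r\ne0$. Then $[L:K]\in\{1,2,3\}$, the isomorphism $\varphi: Y_0(\underline I)\to Y_1(\underline I)$ defines a smooth plane quartic $Y_0(\underline I)$ over $K$ (its equation is obtained from the equation of $Y_1(\underline I)$ by the substitution $\varphi$), and $$\#\mathrm{Twist}(Y_0(\underline I)/K)=\begin{cases}4&\text{if }[L:K]=1,\\2&\text{if }[L:K]=2,\\1&\text{if }[L:K]=3.\end{cases}$$ In addition: (a) If $[L:K]=1$ and $\pi\in\overline K$ satisfies $\nu(\pi)=1/2$ and $\pi^2\in K$, then the quartics $Y_0'$ given by the four isomorphisms $$\mathrm{diag}(1,1,1),\ \mathrm{diag}(\pi,1,1),\ \mathrm{diag}(1,\pi,1),\ \mathrm{diag}(1,1,\pi):\ Y_0'\to Y_0(\underline I)$$ are defined over $K$, and every element of $\mathrm{Twist}(Y_0(\underline I)/K)$ is represented by exactly one of them. (b) If $[L:K]=2$, $\pi_1\in\overline K$ satisfies $\nu(\pi_1)=1/4$ and $\pi_1^4\in K$, and $\zeta_4\in\overline K$ is a primitive fourth root of unity, then the quartics $Y_0'$ given by the two isomorphisms $$\begin{pmatrix}1&0&0\\0&1&\mathcal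 B\\0&1&\mathcal C\end{pmatrix},\ \begin{pmatrix}\pi_1&0&0\\0&1&\mathcal B\\0&\zeta_4&\zeta_4\mathcal C\end{pmatrix}:\ Y_0'\to Y_1(\underline I)$$ are defined over $K$, and every element of $\mathrm{Twist}(Y_0(\underline I)/K)$ is represented by exactly one of them. -/

import Mathlib

namespace Ciani

open MvPolynomial

noncomputable section

/-! ### Plane curves, linear isomorphisms and models -/

/-- The form `F(M x)` obtained from the ternary form `F` by the linear substitution `x ↦ M x`. -/
def subst {k : Type*} [CommRing k] (M : Matrix (Fin 3) (Fin 3) k) (F : MvPolynomial (Fin 3) k) :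
    MvPolynomial (Fin 3) k :=
  bind₁ (fun i => ∑ j, C (M i j) * X j) F

/-- `x ↦ M x` is an isomorphism from the plane curve `F = 0` to the plane curve `G = 0`. -/
def IsIso {k : Type*} [Field k] (M : GL (Fin 3) k) (F G : MvPolynomial (Fin 3) k) : Prop :=
  ∃ c : kˣ, subst (M : Matrix (Fin 3) (Fin 3) k) G = (c : k) • F

/-- The plane curves `F = 0` and `G = 0` are isomorphic over `k` (as plane quartics are canonically
embedded, isomorphisms between them are the linear ones). -/
def Isomorphic {k : Type*} [Field k] (F G : MvPolynomial (Fin 3) k) : Prop :=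
  ∃ M : GL (Fin 3) k, IsIso M F G

/-- A smooth plane quartic over `k`, given by a quartic form over `k` with no singular zero over the
algebraically closed extension `Ω` of `k`. -/
structure SmoothQuartic (k Ω : Type*) [Field k] [Field Ω] [Algebra k Ω] where
  form : MvPolynomial (Fin 3) k
  homogeneous : form.IsHomogeneous 4
  smooth : ∀ v : Fin 3 → Ω, v ≠ 0 → aeval v form = 0 → ∃ i, aeval v (pderiv i form) ≠ 0

/-- The form over `Ω` that defines the base change to `Ω`. -/
def SmoothQuartic.baseChange {k Ω : Type*} [Field k] [Field Ω] [Algebra k Ω]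
    (Y : SmoothQuartic k Ω) : MvPolynomial (Fin 3) Ω :=
  map (algebraMap k Ω) Y.form

/-- A `k`-model of `Y₀ ⊗ Ω`: a smooth plane quartic over `k` that becomes isomorphic to `Y₀` over
the algebraic closure `Ω` of `k`. -/
def Model {k Ω : Type*} [Field k] [Field Ω] [Algebra k Ω] (Y₀ : SmoothQuartic k Ω) : Type _ :=
  {Y : SmoothQuartic k Ω // Isomorphic Y.baseChange Y₀.baseChange}

theorem subst_one {k : Type*} [CommRing k] (F : MvPolynomial (Fin 3) k) : subst 1 F = F := by
  have h : (fun i => ∑ j, C ((1 : Matrix (Fin 3) (Fin 3) k) i j) * X j) =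
      (X : Fin 3 → MvPolynomial (Fin 3) k) := by
    funext i
    simp [Matrix.one_apply]
  rw [subst, h, bind₁_X_left]
  rfl

theorem subst_subst {k : Type*} [CommRing k] (M N : Matrix (Fin 3) (Fin 3) k)
    (F : MvPolynomial (Fin 3) k) : subst N (subst M F) = subst (M * N) F := by
  unfold subst
  rw [bind₁_bind₁]
  congr 2
  funext i
  simp [Matrix.mul_apply, Fin.sum_univ_three]
  ring

theorem subst_smul {k : Type*} [CommRing k] (M : Matrix (Fin 3) (Fin 3) k) (c : k)
    (F : MvPolynomial (Fin 3) k) : subst M (c • F) = c • subst M F := by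
  simp [subst]

theorem isomorphic_equivalence (k : Type*) [Field k] :
    Equivalence (Isomorphic : MvPolynomial (Fin 3) k → MvPolynomial (Fin 3) k → Prop) where
  refl F := ⟨1, 1, by simp [subst_one]⟩
  symm := by
    rintro F G ⟨M, c, h⟩
    refine ⟨M⁻¹, c⁻¹, ?_⟩
    have h2 : F = ((c⁻¹ : kˣ) : k) • subst (M : Matrix (Fin 3) (Fin 3) k) G := by
      rw [h, smul_smul]
      simp
    rw [h2, subst_smul, subst_subst, ← Units.val_mul, mul_inv_cancel, Units.val_one, subst_one]
  trans := by
    rintro F G H ⟨M, c, h⟩ ⟨N, d, h'⟩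
    refine ⟨N * M, d * c, ?_⟩
    rw [Units.val_mul, ← subst_subst, h', subst_smul, h, smul_smul, Units.val_mul]

/-- Isomorphism over `k` of two `k`-models. -/
instance modelSetoid {k Ω : Type*} [Field k] [Field Ω] [Algebra k Ω] (Y₀ : SmoothQuartic k Ω) :
    Setoid (Model Y₀) where
  r Y Y' := Isomorphic Y.1.form Y'.1.form
  iseqv := ⟨fun Y => (isomorphic_equivalence k).refl Y.1.form,
    fun h => (isomorphic_equivalence k).symm h,
    fun h h' => (isomorphic_equivalence k).trans h h'⟩

/-- `Twist(Y₀/k)`: the `k`-models of `Y₀ ⊗ Ω` up to isomorphism over `k`. -/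
def Twist {k Ω : Type*} [Field k] [Field Ω] [Algebra k Ω] (Y₀ : SmoothQuartic k Ω) : Type _ :=
  Quotient (modelSetoid Y₀)

/-- The class of a `k`-model in `Twist(Y₀/k)`. -/
def Twist.mk {k Ω : Type*} [Field k] [Field Ω] [Algebra k Ω] {Y₀ : SmoothQuartic k Ω}
    (Y : Model Y₀) : Twist Y₀ :=
  Quotient.mk (modelSetoid Y₀) Y

/-! ### Ciani subgroups -/

/-- The group `PGL₃(Ω)`. -/
abbrev PGL3 (Ω : Type*) [Field Ω] : Type _ :=
  GL (Fin 3) Ω ⧸ Subgroup.center (GL (Fin 3) Ω)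

/-- The class in `PGL₃(Ω)` of an invertible matrix. -/
def PGL3.mk {Ω : Type*} [Field Ω] (M : GL (Fin 3) Ω) : PGL3 Ω :=
  QuotientGroup.mk' (Subgroup.center (GL (Fin 3) Ω)) M

/-- For the smooth plane quartic `Y : F = 0` over an algebraically closed field `Ω` of characteristic
zero and a finite group `V` of automorphisms of `Y`: the quotient `Y / V` is a curve of genus `0`,
i.e. it is birational to the projective line. In other words there is a rational map `(G : H)` from
`Y` to the projective line whose fibres, on the dense open subset `D ≠ 0` of `Y`, are the orbits
of `V`. -/
def QuotientHasGenusZero {Ω : Type*} [Field Ω] (F : MvPolynomial (Fin 3) Ω)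
    (V : Subgroup (PGL3 Ω)) : Prop :=
  ∃ (d e : ℕ) (G H D : MvPolynomial (Fin 3) Ω),
    G.IsHomogeneous d ∧ H.IsHomogeneous d ∧ D.IsHomogeneous e ∧
    (∃ v : Fin 3 → Ω, v ≠ 0 ∧ eval v F = 0 ∧ eval v D ≠ 0) ∧
    (∀ v : Fin 3 → Ω, v ≠ 0 → eval v F = 0 → eval v D ≠ 0 → (eval v G ≠ 0 ∨ eval v H ≠ 0)) ∧
    ∀ v w : Fin 3 → Ω, v ≠ 0 → w ≠ 0 → eval v F = 0 → eval w F = 0 →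
      eval v D ≠ 0 → eval w D ≠ 0 →
      (eval v G * eval w H = eval w G * eval v H ↔
        ∃ M : GL (Fin 3) Ω, PGL3.mk M ∈ V ∧ w = (M : Matrix (Fin 3) (Fin 3) Ω).mulVec v)

/-- `V` is a Ciani subgroup of the smooth plane quartic `F = 0`: a subgroup of its automorphism group,
isomorphic to `C₂ × C₂`, with a quotient of genus `0`. -/
structure IsCianiSubgroup {Ω : Type*} [Field Ω] (F : MvPolynomial (Fin 3) Ω)
    (V : Subgroup (PGL3 Ω)) : Prop where
  le_aut : ∀ M : GL (Fin 3) Ω, PGL3.mk M ∈ V → IsIso M F F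
  klein : IsKleinFour V
  genus : QuotientHasGenusZero F V

/-- The Ciani quartic `F = 0` is non-special: it has a unique Ciani subgroup. -/
def NonSpecial {Ω : Type*} [Field Ω] (F : MvPolynomial (Fin 3) Ω) : Prop :=
  ∃! V : Subgroup (PGL3 Ω), IsCianiSubgroup F V

/-! ### Reconstruction of a Ciani quartic from its invariants -/

/-- A tuple `(I₃, I₃', I₃'', I₆)` of Ciani invariants. -/
structure Invariants (K : Type*) where
  I3 : K
  I3' : K
  I3'' : K
  I6 : K

namespace Invariants

variable {K : Type*} [Field K]

/-- The discriminant `Δ`. -/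
def disc (I : Invariants K) : K := 2 ^ 20 * I.I3 * I.I3'' ^ 4 * I.I6 ^ 2

def P (I : Invariants K) : K := 8 * I.I3 + I.I3' - I.I3''

def S1 (I : Invariants K) : K := I.I3' + 12 * I.I3

def S2 (I : Invariants K) : K :=
  1 / 4 * (I.P ^ 2 + 16 * I.I3 * (I.P + I.I3'') - I.I6)

def S3 (I : Invariants K) : K := I.I3 * I.P ^ 2

/-- The cubic `T³ - S₁ T² + S₂ T - S₃`. -/
def cubic (I : Invariants K) : Polynomial K :=
  Polynomial.X ^ 3 - Polynomial.C I.S1 * Polynomial.X ^ 2 + Polynomial.C I.S2 * Polynomial.X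
    - Polynomial.C I.S3

/-- The splitting field of the cubic over `K`, inside `Ω`. -/
def L (I : Invariants K) (Ω : Type*) [Field Ω] [Algebra K Ω] : IntermediateField K Ω :=
  IntermediateField.adjoin K (I.cubic.rootSet Ω)

/-- The degree `[L : K]`. -/
def degL (I : Invariants K) (Ω : Type*) [Field Ω] [Algebra K Ω] : ℕ :=
  Module.finrank K (I.L Ω)

end Invariants

/-- The standard form `A x⁴ + B y⁴ + C z⁴ + a y²z² + b x²z² + c x²y²`. -/
def standardForm {Ω : Type*} [CommRing Ω] (A B C a b c : Ω) : MvPolynomial (Fin 3) Ω :=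
  MvPolynomial.C A * X 0 ^ 4 + MvPolynomial.C B * X 1 ^ 4 + MvPolynomial.C C * X 2 ^ 4 +
    MvPolynomial.C a * (X 1 ^ 2 * X 2 ^ 2) + MvPolynomial.C b * (X 0 ^ 2 * X 2 ^ 2) +
    MvPolynomial.C c * (X 0 ^ 2 * X 1 ^ 2)

/-- The choices made in the construction of `Y₁` and `Y₀`: an ordering `A, B, C` of the roots (with
multiplicity) of the cubic and square roots `r` of `I₃ S₁` and `s` of `r`. The roots are ordered
such that `A = 0` if `0` is a root with `P = 0`, also `B = 0` if moreover `0` is a multiple root,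
and `A` is the rational root if `[L : K] = 2`. -/
structure Choice {K : Type*} [Field K] (I : Invariants K) (Ω : Type*) [Field Ω] [Algebra K Ω] where
  A : Ω
  B : Ω
  C : Ω
  r : Ω
  s : Ω
  roots : I.cubic.map (algebraMap K Ω) =
    (Polynomial.X - Polynomial.C A) * (Polynomial.X - Polynomial.C B) *
      (Polynomial.X - Polynomial.C C)
  r_sq : r ^ 2 = algebraMap K Ω (I.I3 * I.S1)
  s_sq : s ^ 2 = r
  A_eq_zero : I.P = 0 → A = 0
  B_eq_zero : I.P = 0 → I.S2 = 0 → B = 0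
  A_rational : I.degL Ω = 2 → A ∈ (algebraMap K Ω).range

namespace Choice

variable {K : Type*} [Field K] {I : Invariants K} {Ω : Type*} [Field Ω] [Algebra K Ω]

open Classical in
/-- The equation of the standard model `Y₁` with the given invariants. The three cases are: `P ≠ 0`;
`P = 0` and `0` is a simple root of the cubic; `P = 0` and `0` is a multiple root. -/
def Y1 (ch : Choice I Ω) : MvPolynomial (Fin 3) Ω :=
  let ι := algebraMap K Ω
  if I.P ≠ 0 then standardForm ch.A ch.B ch.C (ι I.P) (ι I.P) (ι I.P)
  else if I.S2 ≠ 0 then standardForm (ι (I.I3 * I.S2)) ch.B ch.C 0 (ι I.S2) (ι I.S2)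
  else standardForm (ι I.I3) (ι I.I3) (ι I.I3) 0 0 ch.r

open Classical in
/-- The matrix of the isomorphism `φ : Y₀ → Y₁`. -/
def phi (ch : Choice I Ω) : Matrix (Fin 3) (Fin 3) Ω :=
  if I.degL Ω = 1 then
    if I.P = 0 ∧ I.S2 = 0 ∧ ch.r ≠ 0 then !![ch.s, 0, 0; 0, 1, 0; 0, 0, 1] else 1
  else if I.degL Ω = 2 then !![1, 0, 0; 0, 1, ch.B; 0, 1, ch.C]
  else !![1, ch.A, ch.A ^ 2; 1, ch.B, ch.B ^ 2; 1, ch.C, ch.C ^ 2]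

end Choice

/-! ### Finite extensions of the maximal unramified extension of `ℚ_p` -/

/-- The maximal unramified extension of `ℚ_p` inside the algebraic closure of `ℚ_p`: it is generated by
the roots of unity of order prime to `p`. -/
def Qpnr (p : ℕ) [Fact p.Prime] : IntermediateField ℚ_[p] (PadicAlgCl p) :=
  IntermediateField.adjoin ℚ_[p] {z | ∃ n : ℕ, 0 < n ∧ n.Coprime p ∧ z ^ n = 1}

/-- `ϖ` is a uniformizer of `K`, for the valuation given by the `p`-adic absolute value. -/
def IsUniformizer {p : ℕ} [Fact p.Prime] (K : IntermediateField (Qpnr p) (PadicAlgCl p))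
    (ϖ : PadicAlgCl p) : Prop :=
  ϖ ∈ K ∧ ϖ ≠ 0 ∧ ‖ϖ‖ < 1 ∧ ∀ x ∈ K, ‖x‖ < 1 → ‖x‖ ≤ ‖ϖ‖

/-- `ν(x) = 1/n`, where `ν` extends the valuation of `K` normalised by `ν(Kˣ) = ℤ`. -/
def HasValuationOneDiv {p : ℕ} [Fact p.Prime] (K : IntermediateField (Qpnr p) (PadicAlgCl p))
    (x : PadicAlgCl p) (n : ℕ) : Prop :=
  ∃ ϖ, IsUniformizer K ϖ ∧ ‖x‖ ^ n = ‖ϖ‖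

end

end Ciani

namespace Ciani

open MvPolynomial

/-! ### Linear substitution in ternary forms, and when a standard form is nonsingular. -/

section Forms

variable {k : Type*} [Field k]

/-! In cohomological terms, twists are classified by `H¹` of the Galois group of `K` with values in
the automorphism group. For a non-special quartic in standard form that group is the Klein group `V`
of sign changes, and Galois permutes the three involutions as it permutes the roots of the cubic.
Since the residue field of `K` is algebraically closed, `p > 3` and `V` has order 4, only the
procyclic tame quotient matters. Hence `H¹` is the group of coinvariants of `V` under one generator,
which has order 4, 2 or 1 according as the generator acts trivially, by a transposition or by a
three-cycle. For the same reason the Galois group of the cubic cannot be all of `S₃`, so `[L : K] ≤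
3`.

The proof replaces cohomology by matrices. A model comes with a matrix `D` that carries it to the
rigid form `F = Y₁`. By rigidity, conjugating `D` by a Galois element changes it by a sign change,
up to a scalar and the permutation that `F` undergoes. The task is to factor `D = E * Dᵢ * N`, with
`E` a sign change up to a scalar, `Dᵢ` one of the listed representatives and `N` over `K`;
`exists_models_bijective` turns such factorisations into the list of twists.

Three ingredients carry this. (1) Rigidity, `isSign_of_isIso`: uniqueness of the Ciani subgroup
forces automorphisms to normalise the sign group, hence to be monomial, and the pairwise distinct
quantities `A a²`, `B b²`, `C c²` (`NonSpecial.injective`) exclude nontrivial permutations. (2)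
Tameness, `algEquiv_eq_self_of_pow`: an automorphism over `Qpnr p` that fixes the `n`-th power of an
element of norm 1, with `n` prime to `p`, fixes the element. The input is that units are congruent
to roots of unity of order prime to `p`. (3) Discreteness of the value group of `K`,
`IsUniformizer.exists_norm_eq`: it allows an entry of `D` to be scaled to norm 1 by a power of a
root of a uniformizer. The three degrees are then treated in `exists_factor_split`,
`exists_factor_swap` and `exists_factor_cycle`. -/

theorem eval_subst {k : Type*} [CommRing k] (M : Matrix (Fin 3) (Fin 3) k)
    (F : MvPolynomial (Fin 3) k) (v : Fin 3 → k) :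
    eval v (subst M F) = eval (M.mulVec v) F := by
  have h : eval v (subst M F) = eval (fun i => eval v (∑ j, C (M i j) * X j)) F :=
    eval₂Hom_bind₁ _ _ _ _
  rw [h]
  congr 2
  funext i
  simp [Matrix.mulVec, dotProduct]

theorem map_subst {k l : Type*} [CommRing k] [CommRing l] (f : k →+* l)
    (M : Matrix (Fin 3) (Fin 3) k) (F : MvPolynomial (Fin 3) k) :
    map f (subst M F) = subst (M.map f) (map f F) := by
  rw [subst, subst, map_bind₁]
  congr 2
  funext i
  simp

theorem map_smul_form {k l : Type*} [CommRing k] [CommRing l] (f : k →+* l) (c : k)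
    (F : MvPolynomial (Fin 3) k) : map f (c • F) = f c • map f F := by
  simp [smul_eq_C_mul]

theorem isHomogeneous_subst {k : Type*} [CommRing k] (M : Matrix (Fin 3) (Fin 3) k)
    {F : MvPolynomial (Fin 3) k} {n : ℕ} (hF : F.IsHomogeneous n) :
    (subst M F).IsHomogeneous n := by
  have h := hF.aeval (fun i => ∑ j, C (M i j) * X j) (n := 1)
    (fun i => IsHomogeneous.sum _ _ _ fun j _ => isHomogeneous_C_mul_X _ _)
  rwa [one_mul] at h

theorem eval_smul_of_isHomogeneous {k : Type*} [CommRing k] {F : MvPolynomial (Fin 3) k} {n : ℕ}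
    (hF : F.IsHomogeneous n) (c : k) (v : Fin 3 → k) : eval (c • v) F = c ^ n * eval v F := by
  rw [eval_eq, eval_eq, Finset.mul_sum]
  refine Finset.sum_congr rfl fun d hd => ?_
  have h : d.degree = n := by
    by_contra h
    exact (mem_support_iff.1 hd) (hF.coeff_eq_zero h)
  have h2 : ∏ i ∈ d.support, c ^ d i = c ^ n := by
    rw [Finset.prod_pow_eq_pow_sum, ← h]; rfl
  simp only [Pi.smul_apply, smul_eq_mul, mul_pow, Finset.prod_mul_distrib, h2]
  ring

theorem subst_smul_matrix [Infinite k] {F : MvPolynomial (Fin 3) k} {n : ℕ}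
    (hF : F.IsHomogeneous n) (c : k) (M : Matrix (Fin 3) (Fin 3) k) :
    subst (c • M) F = c ^ n • subst M F := by
  refine MvPolynomial.funext fun v => ?_
  rw [eval_subst, smul_eval, eval_subst, Matrix.smul_mulVec, eval_smul_of_isHomogeneous hF]

theorem pderiv_subst {k : Type*} [CommRing k] (M : Matrix (Fin 3) (Fin 3) k)
    (F : MvPolynomial (Fin 3) k) (i : Fin 3) :
    pderiv i (subst M F) = ∑ j, C (M j i) * subst M (pderiv j F) := by
  unfold subst
  induction F using MvPolynomial.induction_on with
  | C a => simp
  | add F G hF hG => simp only [map_add, hF, hG, mul_add, Finset.sum_add_distrib]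
  | mul_X F n hF =>
    simp only [map_mul, pderiv_mul, hF, bind₁_X_right, map_add, mul_add, Finset.sum_add_distrib,
      Finset.sum_mul, map_sum, pderiv_C, zero_mul, zero_add, pderiv_X]
    congr 1
    · exact Finset.sum_congr rfl fun j _ => by ring
    · fin_cases n <;> fin_cases i <;> simp [Fin.sum_univ_three, Pi.single_apply] <;> ring

/-- A ternary form without singular zeros. -/
def Nonsingular (F : MvPolynomial (Fin 3) k) : Prop :=
  ∀ v : Fin 3 → k, v ≠ 0 → eval v F = 0 → ∃ i, eval v (pderiv i F) ≠ 0

/-- By the chain rule the gradient of `F ∘ M` at `v` is the gradient of `F` at `M v` multiplied by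
`M`, and an invertible `M` kills no nonzero row vector. -/
theorem Nonsingular.subst {F : MvPolynomial (Fin 3) k} (hF : Nonsingular F)
    {M : Matrix (Fin 3) (Fin 3) k} (hM : IsUnit M.det) : Nonsingular (subst M F) := by
  intro v hv h
  by_contra! hc
  have hM' : IsUnit M := (Matrix.isUnit_iff_isUnit_det M).2 hM
  have hinj := Matrix.mulVec_injective_iff_isUnit.2 hM'
  have hw : M.mulVec v ≠ 0 := fun h0 => hv (hinj (by simpa using h0))
  rw [eval_subst] at h
  obtain ⟨i, hi⟩ := hF _ hw h
  have hvec : Matrix.vecMul (fun j => eval (M.mulVec v) (pderiv j F)) M = 0 := by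
    funext j
    have := hc j
    rw [pderiv_subst] at this
    simp only [map_sum, map_mul, eval_C, eval_subst] at this
    simp only [Matrix.vecMul, dotProduct, Pi.zero_apply, ← this]
    exact Finset.sum_congr rfl fun _ _ => mul_comm _ _
  have := (Matrix.vecMul_injective_iff_isUnit.2 hM') (hvec.trans (Matrix.zero_vecMul M).symm)
  exact hi (congrFun this i)

theorem IsIso.symm_form {M : GL (Fin 3) k} {F G : MvPolynomial (Fin 3) k} (h : IsIso M F G) :
    IsIso M⁻¹ G F := by
  obtain ⟨c, h⟩ := h
  refine ⟨c⁻¹, ?_⟩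
  have h2 : F = ((c⁻¹ : kˣ) : k) • Ciani.subst (M : Matrix (Fin 3) (Fin 3) k) G := by
    rw [h, smul_smul]; simp
  rw [h2, subst_smul, subst_subst, ← Units.val_mul, mul_inv_cancel, Units.val_one, subst_one]

theorem IsIso.comp {M N : GL (Fin 3) k} {F G H : MvPolynomial (Fin 3) k} (h : IsIso M F G)
    (h' : IsIso N G H) : IsIso (N * M) F H := by
  obtain ⟨c, h⟩ := h
  obtain ⟨d, h'⟩ := h'
  refine ⟨d * c, ?_⟩
  rw [Units.val_mul, ← subst_subst, h', subst_smul, h, smul_smul, Units.val_mul]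

theorem IsIso.eval_mulVec_eq_zero_iff {M : GL (Fin 3) k} {F G : MvPolynomial (Fin 3) k}
    (h : IsIso M F G) (v : Fin 3 → k) :
    eval ((M : Matrix (Fin 3) (Fin 3) k).mulVec v) G = 0 ↔ eval v F = 0 := by
  obtain ⟨c, h⟩ := h
  rw [← eval_subst, h, smul_eval]
  simp

/-! ### Standard forms -/

theorem eval_standardForm {k : Type*} [CommRing k] (A B C a b c : k) (v : Fin 3 → k) :
    eval v (standardForm A B C a b c) = A * v 0 ^ 4 + B * v 1 ^ 4 + C * v 2 ^ 4 +
      a * (v 1 ^ 2 * v 2 ^ 2) + b * (v 0 ^ 2 * v 2 ^ 2) + c * (v 0 ^ 2 * v 1 ^ 2) := by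
  simp [standardForm]

theorem map_standardForm {k l : Type*} [CommRing k] [CommRing l] (f : k →+* l) (A B C a b c : k) :
    map f (standardForm A B C a b c) = standardForm (f A) (f B) (f C) (f a) (f b) (f c) := by
  simp [standardForm]

theorem isHomogeneous_standardForm {k : Type*} [CommRing k] (A B C a b c : k) :
    (standardForm A B C a b c).IsHomogeneous 4 := by
  have h (r : k) (i j : Fin 3) :
      (MvPolynomial.C r * (X i ^ 2 * X j ^ 2) : MvPolynomial (Fin 3) k).IsHomogeneous 4 :=
    (((isHomogeneous_X_pow i 2).mul (isHomogeneous_X_pow j 2)).C_mul r)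
  exact (((((isHomogeneous_C_mul_X_pow A 0 4).add (isHomogeneous_C_mul_X_pow B 1 4)).add
    (isHomogeneous_C_mul_X_pow C 2 4)).add (h a 1 2)).add (h b 0 2)).add (h c 0 1)

/-- The conditions on the coefficients under which a standard form is nonsingular. -/
structure IsSmoothStandard (A B C a b c : k) : Prop where
  hA : A ≠ 0
  hB : B ≠ 0
  hC : C ≠ 0
  ha : a ^ 2 - 4 * B * C ≠ 0
  hb : b ^ 2 - 4 * A * C ≠ 0
  hc : c ^ 2 - 4 * A * B ≠ 0
  hdet : -4 * A * B * C + A * a ^ 2 + B * b ^ 2 + C * c ^ 2 - a * b * c ≠ 0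

theorem eval_pderiv_standardForm {k : Type*} [CommRing k] (A B C a b c : k) (v : Fin 3 → k) :
    eval v (pderiv 0 (standardForm A B C a b c)) =
      2 * v 0 * (2 * A * v 0 ^ 2 + c * v 1 ^ 2 + b * v 2 ^ 2) ∧
    eval v (pderiv 1 (standardForm A B C a b c)) =
      2 * v 1 * (c * v 0 ^ 2 + 2 * B * v 1 ^ 2 + a * v 2 ^ 2) ∧
    eval v (pderiv 2 (standardForm A B C a b c)) =
      2 * v 2 * (b * v 0 ^ 2 + a * v 1 ^ 2 + 2 * C * v 2 ^ 2) := by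
  refine ⟨?_, ?_, ?_⟩ <;> simp [standardForm, pderiv_X] <;> ring

/-- A standard form is a quadratic form `q` in the squares of the coordinates, and its `i`-th
derivative is `2 vᵢ` times a linear form in those squares. At a singular point the squares of the
nonzero coordinates therefore lie in the kernel of a principal submatrix of the matrix of `q`. The
seven conditions say that all principal minors are nonzero. -/
theorem IsSmoothStandard.nonsingular [CharZero k] {A B C a b c : k}
    (h : IsSmoothStandard A B C a b c) : Nonsingular (standardForm A B C a b c) := by
  obtain ⟨hA, hB, hC, ha, hb, hc, hdet⟩ := h
  intro v hv _
  by_contra! hcon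
  obtain ⟨e0, e1, e2⟩ := eval_pderiv_standardForm A B C a b c v
  rw [hcon] at e0 e1 e2
  have key : v 0 = 0 ∧ v 1 = 0 ∧ v 2 = 0 := by
    generalize v 0 = x at *
    generalize v 1 = y at *
    generalize v 2 = z at *
    have f0 : x = 0 ∨ 2 * A * x ^ 2 + c * y ^ 2 + b * z ^ 2 = 0 := by simpa using e0
    have f1 : y = 0 ∨ c * x ^ 2 + 2 * B * y ^ 2 + a * z ^ 2 = 0 := by simpa using e1
    have f2 : z = 0 ∨ b * x ^ 2 + a * y ^ 2 + 2 * C * z ^ 2 = 0 := by simpa using e2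
    have sq (t d : k) (hd : d ≠ 0) (ht : d * t ^ 2 = 0) : t = 0 := by
      simpa [hd] using ht
    rcases f0 with rfl | f0 <;> rcases f1 with rfl | f1 <;> rcases f2 with rfl | f2
    · simp
    · exact ⟨rfl, rfl, sq z (2 * C) (by simpa using hC) (by linear_combination f2)⟩
    · exact ⟨rfl, sq y (2 * B) (by simpa using hB) (by linear_combination f1), rfl⟩
    · exact ⟨rfl, sq y _ ha (by linear_combination a * f2 - 2 * C * f1),
        sq z _ ha (by linear_combination a * f1 - 2 * B * f2)⟩
    · exact ⟨sq x (2 * A) (by simpa using hA) (by linear_combination f0), rfl, rfl⟩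
    · exact ⟨sq x _ hb (by linear_combination b * f2 - 2 * C * f0), rfl,
        sq z _ hb (by linear_combination b * f0 - 2 * A * f2)⟩
    · exact ⟨sq x _ hc (by linear_combination c * f1 - 2 * B * f0),
        sq y _ hc (by linear_combination c * f0 - 2 * A * f1), rfl⟩
    · have h2 : (2 : k) ≠ 0 := two_ne_zero
      refine ⟨sq x _ (mul_ne_zero h2 hdet) ?_, sq y _ (mul_ne_zero h2 hdet) ?_,
        sq z _ (mul_ne_zero h2 hdet) ?_⟩
      -- The coefficients here and in the next two goals are, up to sign, the cofactors of the
      -- symmetric matrix of the quadratic form.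
      · linear_combination (a ^ 2 - 4 * B * C) * f0 + (2 * C * c - a * b) * f1 +
          (2 * B * b - a * c) * f2
      · linear_combination (2 * C * c - a * b) * f0 + (b ^ 2 - 4 * A * C) * f1 +
          (2 * A * a - b * c) * f2
      · linear_combination (2 * B * b - a * c) * f0 + (2 * A * a - b * c) * f1 +
          (c ^ 2 - 4 * A * B) * f2
  exact hv (by funext i; fin_cases i <;> simp [key])

end Forms

/-! ### The group of sign changes as a Ciani subgroup, and transport of Ciani subgroups along
isomorphisms. -/

section CianiSubgroups

variable {k : Type*} [Field k]

theorem isKleinFour_of_mulEquiv {G H : Type*} [Group G] [Group H] (e : G ≃* H) (h : IsKleinFour G) :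
    IsKleinFour H where
  card_four := by rw [← Nat.card_congr e.toEquiv, h.card_four]
  exponent_two := by rw [← Monoid.exponent_eq_of_mulEquiv e, h.exponent_two]

theorem isKleinFour_units_int_prod : IsKleinFour (ℤˣ × ℤˣ) where
  card_four := by simp
  exponent_two := by
    rw [Monoid.exponent_prod]
    have h : Monoid.exponent ℤˣ = 2 := by
      refine ((Nat.dvd_prime Nat.prime_two).1
        (Monoid.exponent_dvd_of_forall_pow_eq_one fun x => Int.units_sq x)).resolve_left fun h => ?_
      have := (Monoid.exp_eq_one_iff.1 h).elim (1 : ℤˣ) (-1)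
      exact absurd this (by decide)
    simp [h]

/-- The sign changes of the second and third coordinate. -/
def signHom (k : Type*) [Field k] : ℤˣ × ℤˣ →* GL (Fin 3) k :=
  MonoidHom.toHomUnits
    { toFun := fun x => Matrix.diagonal ![1, ((x.1 : ℤ) : k), ((x.2 : ℤ) : k)]
      map_one' := by
        rw [← Matrix.diagonal_one]
        congr 1
        funext i
        fin_cases i <;> simp
      map_mul' := fun x y => by
        rw [Matrix.diagonal_mul_diagonal]
        congr 1
        funext i
        fin_cases i <;> simp }

theorem coe_signHom (x : ℤˣ × ℤˣ) : (signHom k x : Matrix (Fin 3) (Fin 3) k) =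
    Matrix.diagonal ![1, ((x.1 : ℤ) : k), ((x.2 : ℤ) : k)] := rfl

/-- The group of sign changes of the coordinates, in `PGL₃`. -/
def signSubgroup (k : Type*) [Field k] : Subgroup (PGL3 k) :=
  ((QuotientGroup.mk' (Subgroup.center (GL (Fin 3) k))).comp (signHom k)).range

/-- A matrix that is, up to a scalar, a sign change of the coordinates. -/
def IsSign (M : Matrix (Fin 3) (Fin 3) k) : Prop :=
  ∃ c s t : k, s ^ 2 = 1 ∧ t ^ 2 = 1 ∧ M = c • Matrix.diagonal ![1, s, t]

theorem exists_int_unit_of_sq_eq_one {s : k} (h : s ^ 2 = 1) : ∃ x : ℤˣ, ((x : ℤ) : k) = s := by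
  rcases sq_eq_sq_iff_eq_or_eq_neg.1 (h.trans (one_pow 2).symm) with rfl | rfl
  · exact ⟨1, by simp⟩
  · exact ⟨-1, by simp⟩

theorem int_unit_sq (x : ℤˣ) : ((x : ℤ) : k) ^ 2 = 1 := by
  rcases Int.units_eq_one_or x with rfl | rfl <;> simp

theorem mk_mem_signSubgroup_iff (M : GL (Fin 3) k) :
    PGL3.mk M ∈ signSubgroup k ↔ IsSign (M : Matrix (Fin 3) (Fin 3) k) := by
  constructor
  · rintro ⟨x, hx⟩
    obtain ⟨z, hz, hzx⟩ := (QuotientGroup.mk'_eq_mk' (Subgroup.center (GL (Fin 3) k))).1 hx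
    obtain ⟨c, hc⟩ := Matrix.GeneralLinearGroup.mem_center_iff_val_mem_range_scalar.1 hz
    refine ⟨c, (x.1 : ℤ), (x.2 : ℤ), int_unit_sq _, int_unit_sq _, ?_⟩
    rw [← hzx, Units.val_mul, ← hc, coe_signHom]
    simp [Matrix.diagonal_mul_diagonal, ← Matrix.diagonal_smul, mul_comm, Pi.smul_def]
  · rintro ⟨c, s, t, hs, ht, hM⟩
    obtain ⟨x, rfl⟩ := exists_int_unit_of_sq_eq_one hs
    obtain ⟨y, rfl⟩ := exists_int_unit_of_sq_eq_one ht
    refine ⟨(x, y), ?_⟩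
    refine (QuotientGroup.mk'_eq_mk' (Subgroup.center (GL (Fin 3) k))).2
      ⟨(signHom k (x, y))⁻¹ * M, ?_, mul_inv_cancel_left _ _⟩
    rw [Matrix.GeneralLinearGroup.mem_center_iff_val_mem_range_scalar]
    refine ⟨c, ?_⟩
    have hM' : (M : Matrix (Fin 3) (Fin 3) k) = signHom k (x, y) * Matrix.scalar (Fin 3) c := by
      rw [hM, coe_signHom]
      simp [Matrix.diagonal_mul_diagonal, ← Matrix.diagonal_smul, mul_comm, Pi.smul_def]
    rw [Units.val_mul, hM', ← mul_assoc, ← Units.val_mul, inv_mul_cancel, Units.val_one, one_mul]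

theorem isKleinFour_signSubgroup [CharZero k] : IsKleinFour (signSubgroup k) := by
  refine isKleinFour_of_mulEquiv (MonoidHom.ofInjective (f :=
    (QuotientGroup.mk' (Subgroup.center (GL (Fin 3) k))).comp (signHom k)) ?_)
    isKleinFour_units_int_prod
  rw [injective_iff_map_eq_one]
  rintro ⟨x, y⟩ h
  have h2 := (QuotientGroup.eq_one_iff _).1 h
  obtain ⟨c, hc⟩ := Matrix.GeneralLinearGroup.mem_center_iff_val_mem_range_scalar.1 h2
  rw [coe_signHom] at hc
  have h0 := congrFun₂ hc 0 0
  have h1 := congrFun₂ hc 1 1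
  have h2 := congrFun₂ hc 2 2
  simp only [Matrix.scalar_apply, Matrix.diagonal_apply_eq, Matrix.cons_val] at h0 h1 h2
  subst h0
  have hx : x = 1 := Units.ext (Int.cast_injective (α := k) (by simpa using h1.symm))
  have hy : y = 1 := Units.ext (Int.cast_injective (α := k) (by simpa using h2.symm))
  rw [hx, hy]
  rfl

/-! ### Transport of Ciani subgroups -/

theorem QuotientHasGenusZero.transport {F F' : MvPolynomial (Fin 3) k} {N : GL (Fin 3) k}
    (hN : IsIso N F' F) {V V' : Subgroup (PGL3 k)}
    (hV : ∀ M : GL (Fin 3) k, PGL3.mk M ∈ V' ↔ PGL3.mk (N * M * N⁻¹) ∈ V)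
    (h : QuotientHasGenusZero F V) : QuotientHasGenusZero F' V' := by
  obtain ⟨d, e, G, H, D, hG, hH, hD, ⟨v, hv, hvF, hvD⟩, hbase, hfib⟩ := h
  have hinv (w : Fin 3 → k) : (N : Matrix (Fin 3) (Fin 3) k).mulVec
      (((N⁻¹ : GL (Fin 3) k) : Matrix (Fin 3) (Fin 3) k).mulVec w) = w := by
    rw [Matrix.mulVec_mulVec, ← Units.val_mul, mul_inv_cancel, Units.val_one, Matrix.one_mulVec]
  have hinv' (w : Fin 3 → k) : ((N⁻¹ : GL (Fin 3) k) : Matrix (Fin 3) (Fin 3) k).mulVec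
      ((N : Matrix (Fin 3) (Fin 3) k).mulVec w) = w := by
    rw [Matrix.mulVec_mulVec, ← Units.val_mul, inv_mul_cancel, Units.val_one, Matrix.one_mulVec]
  have hne (w : Fin 3 → k) (hw : w ≠ 0) : (N : Matrix (Fin 3) (Fin 3) k).mulVec w ≠ 0 := by
    intro h
    apply hw
    rw [← hinv' w, h, Matrix.mulVec_zero]
  refine ⟨d, e, subst N G, subst N H, subst N D, isHomogeneous_subst _ hG, isHomogeneous_subst _ hH,
    isHomogeneous_subst _ hD,
    ⟨((N⁻¹ : GL (Fin 3) k) : Matrix (Fin 3) (Fin 3) k).mulVec v, ?_, ?_, ?_⟩, ?_, ?_⟩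
  · intro h
    apply hv
    rw [← hinv v, h, Matrix.mulVec_zero]
  · rwa [← hN.eval_mulVec_eq_zero_iff, hinv]
  · rwa [eval_subst, hinv]
  · intro w hw hwF hwD
    rw [eval_subst] at hwD ⊢
    rw [eval_subst]
    exact hbase _ (hne w hw) ((hN.eval_mulVec_eq_zero_iff w).2 hwF) hwD
  · intro w u hw hu hwF huF hwD huD
    simp only [eval_subst] at hwD huD ⊢
    rw [hfib _ _ (hne w hw) (hne u hu) ((hN.eval_mulVec_eq_zero_iff w).2 hwF)
      ((hN.eval_mulVec_eq_zero_iff u).2 huF) hwD huD]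
    constructor
    · rintro ⟨M, hM, hMu⟩
      refine ⟨N⁻¹ * M * N, (hV _).2 ?_, ?_⟩
      · convert hM using 2
        group
      · rw [Units.val_mul, Units.val_mul, ← Matrix.mulVec_mulVec, ← Matrix.mulVec_mulVec, ← hMu,
          hinv']
    · rintro ⟨M, hM, hMu⟩
      refine ⟨N * M * N⁻¹, (hV _).1 hM, ?_⟩
      rw [Units.val_mul, Units.val_mul, ← Matrix.mulVec_mulVec, ← Matrix.mulVec_mulVec, hinv', hMu]

/-- The conjugate `N⁻¹ V N`. -/
def conjSubgroup (N : GL (Fin 3) k) (V : Subgroup (PGL3 k)) : Subgroup (PGL3 k) :=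
  V.map (MulAut.conj (PGL3.mk N)).symm.toMonoidHom

theorem mk_mem_conjSubgroup_iff (N M : GL (Fin 3) k) (V : Subgroup (PGL3 k)) :
    PGL3.mk M ∈ conjSubgroup N V ↔ PGL3.mk (N * M * N⁻¹) ∈ V := by
  rw [conjSubgroup, Subgroup.mem_map_equiv]
  rfl

theorem IsCianiSubgroup.conj {F F' : MvPolynomial (Fin 3) k} {N : GL (Fin 3) k}
    (hN : IsIso N F' F) {V : Subgroup (PGL3 k)} (hV : IsCianiSubgroup F V) :
    IsCianiSubgroup F' (conjSubgroup N V) where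
  le_aut M hM := by
    have h := hV.le_aut _ ((mk_mem_conjSubgroup_iff N M V).1 hM)
    have h2 := (hN.comp h).comp hN.symm_form
    convert h2 using 1
    group
  klein := isKleinFour_of_mulEquiv ((MulAut.conj (PGL3.mk N)).symm.subgroupMap V) hV.klein
  genus := hV.genus.transport hN fun M => mk_mem_conjSubgroup_iff N M V

theorem NonSpecial.conj {F F' : MvPolynomial (Fin 3) k} {N : GL (Fin 3) k}
    (hN : IsIso N F' F) (h : NonSpecial F) : NonSpecial F' := by
  obtain ⟨V, hV, huniq⟩ := h
  have key : ∀ (W : Subgroup (PGL3 k)), conjSubgroup N (conjSubgroup N⁻¹ W) = W := by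
    intro W
    ext x
    obtain ⟨M, rfl⟩ := QuotientGroup.mk'_surjective (Subgroup.center (GL (Fin 3) k)) x
    refine ((mk_mem_conjSubgroup_iff N M _).trans (mk_mem_conjSubgroup_iff N⁻¹ _ W)).trans ?_
    have : N⁻¹ * (N * M * N⁻¹) * N⁻¹⁻¹ = M := by group
    rw [this]
    rfl
  refine ⟨conjSubgroup N V, hV.conj hN, fun W hW => ?_⟩
  rw [← key W, huniq _ (hW.conj hN.symm_form)]

/-! ### The group of sign changes is a Ciani subgroup of a standard form -/

theorem IsSign.mulVec {M : Matrix (Fin 3) (Fin 3) k} (hM : IsSign M) :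
    ∃ c : k, ∀ v i, (M.mulVec v i) ^ 2 = c * v i ^ 2 := by
  obtain ⟨c, s, t, hs, ht, rfl⟩ := hM
  refine ⟨c ^ 2, fun v i => ?_⟩
  rw [Matrix.smul_mulVec, Pi.smul_apply, Matrix.mulVec_diagonal]
  fin_cases i <;> simp [mul_pow, hs, ht]

theorem isIso_of_isSign [Infinite k] {M : GL (Fin 3) k}
    (hM : IsSign (M : Matrix (Fin 3) (Fin 3) k)) (A B C a b c : k) :
    IsIso M (standardForm A B C a b c) (standardForm A B C a b c) := by
  obtain ⟨μ, hμ⟩ := hM.mulVec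
  have hμ0 : μ ≠ 0 := by
    rintro rfl
    have h1 : (M : Matrix (Fin 3) (Fin 3) k).mulVec (fun _ => 1) = 0 := by
      funext i
      simpa using hμ (fun _ => 1) i
    have h2 := Matrix.mulVec_injective_iff_isUnit.2 M.isUnit
      (h1.trans (Matrix.mulVec_zero _).symm)
    simpa using congrFun h2 0
  refine ⟨Units.mk0 (μ ^ 2) (pow_ne_zero 2 hμ0), MvPolynomial.funext fun v => ?_⟩
  rw [eval_subst, smul_eval, eval_standardForm, eval_standardForm, Units.val_mk0]
  have h4 (i) : (M : Matrix (Fin 3) (Fin 3) k).mulVec v i ^ 4 = μ ^ 2 * v i ^ 4 := by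
    rw [show 4 = 2 * 2 from rfl, pow_mul, hμ]; ring
  rw [h4, h4, h4, hμ, hμ, hμ]
  ring

/-- Squaring the coordinates identifies the quotient with a conic. The point `(0 : y : 1)` lies on
it when `B y² + a y + C = 0`, and projection from that point parametrises the conic. The projection
is given by the pencil of the tangent form `T` and the first coordinate, both of which vanish at the
point. -/
theorem quotientHasGenusZero_signSubgroup [IsAlgClosed k] [CharZero k] (A B C a b c : k)
    (hB : B ≠ 0) (ha : a ^ 2 - 4 * B * C ≠ 0) :
    QuotientHasGenusZero (standardForm A B C a b c) (signSubgroup k) := by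
  obtain ⟨δ, hδ⟩ := IsAlgClosed.exists_pow_nat_eq (a ^ 2 - 4 * B * C) (n := 2) (by norm_num)
  have hδ0 : δ ≠ 0 := by rintro rfl; exact ha (by rw [← hδ]; ring)
  have h2 : (2 : k) ≠ 0 := two_ne_zero
  obtain ⟨y, hy⟩ : ∃ y, 2 * B * y + a = δ := ⟨(δ - a) / (2 * B), by field_simp; ring⟩
  obtain ⟨y', hy'⟩ : ∃ y, 2 * B * y + a = -δ := ⟨(-δ - a) / (2 * B), by field_simp; ring⟩
  have hroot : B * y ^ 2 + a * y + C = 0 := by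
    have : 4 * B * (B * y ^ 2 + a * y + C) = 0 := by
      linear_combination (2 * B * y + a + δ) * hy + hδ
    simpa [hB] using this
  have hroot' : B * y' ^ 2 + a * y' + C = 0 := by
    have : 4 * B * (B * y' ^ 2 + a * y' + C) = 0 := by
      linear_combination (2 * B * y' + a - δ) * hy' + hδ
    simpa [hB] using this
  -- The second point `(0 : y' : 1)` of the conic on the line `X = 0` lies off the tangent because
  -- `δ ≠ 0`; it lifts to the point of the quartic that shows `D ≠ 0` to be nonempty.
  obtain ⟨η, hη⟩ := IsAlgClosed.exists_pow_nat_eq y' (n := 2) (by norm_num)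
  let T : MvPolynomial (Fin 3) k := MvPolynomial.C (c * y + b) * X 0 ^ 2 +
    MvPolynomial.C δ * X 1 ^ 2 + MvPolynomial.C (a * y + 2 * C) * X 2 ^ 2
  have hT : T.IsHomogeneous 2 := ((isHomogeneous_C_mul_X_pow _ 0 2).add
    (isHomogeneous_C_mul_X_pow _ 1 2)).add (isHomogeneous_C_mul_X_pow _ 2 2)
  have hTe (v : Fin 3 → k) : eval v T =
      (c * y + b) * v 0 ^ 2 + δ * v 1 ^ 2 + (a * y + 2 * C) * v 2 ^ 2 := by simp [T]
  refine ⟨2, 2, T, X 0 ^ 2, T, hT, isHomogeneous_X_pow 0 2, hT, ⟨![0, η, 1], ?_, ?_, ?_⟩,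
    fun v _ _ h => Or.inl h, ?_⟩
  · intro h
    simpa using congrFun h 2
  · rw [eval_standardForm]
    simp only [Matrix.cons_val]
    linear_combination hroot' + (B * (η ^ 2 + y') + a) * hη
  · rw [hTe]
    simp only [Matrix.cons_val]
    intro h
    have : (a ^ 2 - 4 * B * C) = 0 := by
      have hh : B * y' = -(B * y) - a := by
        have : 2 * (B * y' - (-(B * y) - a)) = 0 := by linear_combination hy' + hy
        have := (mul_eq_zero.1 this).resolve_left h2
        linear_combination this
      have : 2 * (a ^ 2 - 4 * B * C) = 0 := by
        linear_combination (-2 * B) * h + 2 * B * δ * hη + 2 * δ * hh - (δ - a) * hy - hδ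
      exact (mul_eq_zero.1 this).resolve_left h2
    exact ha this
  · intro v w hv hw hvF hwF hvD hwD
    rw [hTe] at hvD hwD
    simp only [eval_pow, eval_X, hTe]
    rw [eval_standardForm] at hvF hwF
    constructor
    · intro h
      set m := ((c * y + b) * w 0 ^ 2 + δ * w 1 ^ 2 + (a * y + 2 * C) * w 2 ^ 2) /
        ((c * y + b) * v 0 ^ 2 + δ * v 1 ^ 2 + (a * y + 2 * C) * v 2 ^ 2) with hm
      have hm0 : m ≠ 0 := div_ne_zero hwD hvD
      have hmT : (c * y + b) * w 0 ^ 2 + δ * w 1 ^ 2 + (a * y + 2 * C) * w 2 ^ 2 =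
        m * ((c * y + b) * v 0 ^ 2 + δ * v 1 ^ 2 + (a * y + 2 * C) * v 2 ^ 2) := by
        rw [hm, div_mul_cancel₀ _ hvD]
      have h0 : w 0 ^ 2 = m * v 0 ^ 2 := by
        rw [hm, div_mul_eq_mul_div, eq_div_iff hvD]
        linear_combination h
      -- The difference of the vectors of squares, `w² - m v²`, is killed by `T` and by the first
      -- coordinate, so it is a multiple of `(0, y, 1)`.
      have h1 : w 1 ^ 2 - m * v 1 ^ 2 = y * (w 2 ^ 2 - m * v 2 ^ 2) := by
        have : δ * (w 1 ^ 2 - m * v 1 ^ 2 - y * (w 2 ^ 2 - m * v 2 ^ 2)) = 0 := by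
          linear_combination hmT - (c * y + b) * h0 +
            (w 2 ^ 2 - m * v 2 ^ 2) * y * hy - 2 * (w 2 ^ 2 - m * v 2 ^ 2) * hroot
        have := (mul_eq_zero.1 this).resolve_left hδ0
        linear_combination this
      -- A line through a point of the conic meets it in one further point: when the conic equation
      -- is expanded along the line, the multiple times `m T(v)` is zero.
      have h2 : w 2 ^ 2 = m * v 2 ^ 2 := by
        have e1 : w 1 ^ 2 = m * v 1 ^ 2 + y * (w 2 ^ 2 - m * v 2 ^ 2) := by
          linear_combination h1
        have e (i) : w i ^ 4 = (w i ^ 2) ^ 2 := by ring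
        rw [e, e, e, h0, e1] at hwF
        have : (w 2 ^ 2 - m * v 2 ^ 2) *
            (m * ((c * y + b) * v 0 ^ 2 + δ * v 1 ^ 2 + (a * y + 2 * C) * v 2 ^ 2)) = 0 := by
          linear_combination hwF - m ^ 2 * hvF - (w 2 ^ 2 - m * v 2 ^ 2) ^ 2 * hroot -
            (w 2 ^ 2 - m * v 2 ^ 2) * m * v 1 ^ 2 * hy
        have := (mul_eq_zero.1 this).resolve_right (mul_ne_zero hm0 hvD)
        linear_combination this
      have h1' : w 1 ^ 2 = m * v 1 ^ 2 := by rw [h2] at h1; linear_combination h1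
      obtain ⟨s, hs⟩ := IsAlgClosed.exists_pow_nat_eq m (n := 2) (by norm_num)
      have hs0 : s ≠ 0 := by rintro rfl; exact hm0 (by rw [← hs]; ring)
      have hsign (i : Fin 3) (hi : w i ^ 2 = m * v i ^ 2) :
          ∃ ε : k, ε ^ 2 = 1 ∧ w i = s * (ε * v i) := by
        rw [← hs, ← mul_pow] at hi
        rcases sq_eq_sq_iff_eq_or_eq_neg.1 hi with h | h
        · exact ⟨1, by simp, by rw [h]; ring⟩
        · exact ⟨-1, by simp, by rw [h]; ring⟩
      obtain ⟨ε₀, hε₀, e₀⟩ := hsign 0 h0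
      obtain ⟨ε₁, hε₁, e₁⟩ := hsign 1 h1'
      obtain ⟨ε₂, hε₂, e₂⟩ := hsign 2 h2
      have hne (ε : k) (hε : ε ^ 2 = 1) : ε ≠ 0 := by rintro rfl; simp at hε
      let M : GL (Fin 3) k := Matrix.GeneralLinearGroup.mkOfDetNeZero
        ((s * ε₀) • Matrix.diagonal ![1, ε₀ * ε₁, ε₀ * ε₂]) (by
          rw [Matrix.det_smul, Matrix.det_diagonal]
          simp [Fin.prod_univ_three, hs0, hne _ hε₀, hne _ hε₁, hne _ hε₂])
      refine ⟨M, (mk_mem_signSubgroup_iff M).2 ⟨s * ε₀, ε₀ * ε₁, ε₀ * ε₂, ?_, ?_, rfl⟩, ?_⟩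
      · rw [mul_pow, hε₀, hε₁, one_mul]
      · rw [mul_pow, hε₀, hε₂, one_mul]
      · funext i
        change w i = (((s * ε₀) • Matrix.diagonal ![1, ε₀ * ε₁, ε₀ * ε₂]).mulVec v) i
        rw [Matrix.smul_mulVec, Pi.smul_apply, Matrix.mulVec_diagonal, smul_eq_mul]
        fin_cases i
        · simp only [Fin.zero_eta, Matrix.cons_val]; rw [e₀]; ring
        · simp only [Fin.mk_one, Matrix.cons_val]; rw [e₁]; linear_combination -(s * ε₁ * v 1) * hε₀
        · simp only [Fin.reduceFinMk, Matrix.cons_val]; rw [e₂]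
          linear_combination -(s * ε₂ * v 2) * hε₀
    · rintro ⟨M, hM, rfl⟩
      obtain ⟨μ, hμ⟩ := ((mk_mem_signSubgroup_iff M).1 hM).mulVec
      rw [hμ, hμ, hμ]
      ring

theorem isCianiSubgroup_signSubgroup [IsAlgClosed k] [CharZero k] (A B C a b c : k)
    (hB : B ≠ 0) (ha : a ^ 2 - 4 * B * C ≠ 0) :
    IsCianiSubgroup (standardForm A B C a b c) (signSubgroup k) where
  le_aut M hM := isIso_of_isSign ((mk_mem_signSubgroup_iff M).1 hM) A B C a b c
  klein := isKleinFour_signSubgroup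
  genus := quotientHasGenusZero_signSubgroup A B C a b c hB ha

end CianiSubgroups

/-! ### Automorphisms of non-special standard forms. -/

section Automorphisms

variable {k : Type*} [Field k]

theorem subst_swap₀₂ (A B C a b c : k) :
    subst !![0, 0, 1; 0, 1, 0; 1, 0, 0] (standardForm A B C a b c) = standardForm C B A c b a := by
  simp [subst, standardForm, Fin.sum_univ_three]
  ring

theorem subst_swap₁₂ (A B C a b c : k) :
    subst !![1, 0, 0; 0, 0, 1; 0, 1, 0] (standardForm A B C a b c) = standardForm A C B a c b := by
  simp [subst, standardForm, Fin.sum_univ_three]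
  ring

theorem subst_cycle (A B C a b c : k) :
    subst !![0, 0, 1; 1, 0, 0; 0, 1, 0] (standardForm A B C a b c) = standardForm B C A b c a := by
  simp [subst, standardForm, Fin.sum_univ_three]
  ring

theorem isSign_diagonal {d : Fin 3 → k} (hd : ∀ i, d i ^ 2 = 1) : IsSign (Matrix.diagonal d) := by
  refine ⟨d 0, d 0 * d 1, d 0 * d 2, by simp [mul_pow, hd], by simp [mul_pow, hd], ?_⟩
  rw [← Matrix.diagonal_smul]
  congr 1
  funext i
  fin_cases i <;> simp
  · linear_combination -(d 1) * hd 0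
  · linear_combination -(d 2) * hd 0

theorem IsSign.apply_eq_zero {M : Matrix (Fin 3) (Fin 3) k} (h : IsSign M) {i j : Fin 3}
    (hij : i ≠ j) : M i j = 0 := by
  obtain ⟨c, s, t, -, -, rfl⟩ := h
  simp [Matrix.diagonal_apply_ne _ hij]

/-- A matrix that normalises the group of sign changes is monomial. -/
theorem eq_of_ne_zero_of_normalizes [CharZero k] {M : GL (Fin 3) k}
    (h : ∀ D : GL (Fin 3) k, IsSign (D : Matrix (Fin 3) (Fin 3) k) →
      IsSign ((M * D * M⁻¹ : GL (Fin 3) k) : Matrix (Fin 3) (Fin 3) k))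
    {i j j' : Fin 3} (hj : (M : Matrix (Fin 3) (Fin 3) k) i j ≠ 0)
    (hj' : (M : Matrix (Fin 3) (Fin 3) k) i j' ≠ 0) : j = j' := by
  by_contra hne
  -- Conjugating this reflection gives a diagonal `S` with `S M = M D`, so row `i` of `M` is
  -- supported where `d` equals the single value `S i i`; but `d` separates `j` from `j'`.
  set d : Fin 3 → k := fun l => if l = j then -1 else 1 with hd
  have hd2 (l : Fin 3) : d l ^ 2 = 1 := by
    rw [hd]
    dsimp only
    split_ifs <;> simp
  let D : GL (Fin 3) k := Matrix.GeneralLinearGroup.mkOfDetNeZero (Matrix.diagonal d) (by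
    rw [Matrix.det_diagonal, Finset.prod_ne_zero_iff]
    intro l _ h0
    simpa [h0] using hd2 l)
  have hS := h D (isSign_diagonal hd2)
  set S := ((M * D * M⁻¹ : GL (Fin 3) k) : Matrix (Fin 3) (Fin 3) k) with hSdef
  have hmul : S * (M : Matrix (Fin 3) (Fin 3) k) =
      (M : Matrix (Fin 3) (Fin 3) k) * Matrix.diagonal d := by
    rw [hSdef, ← Units.val_mul, inv_mul_cancel_right, Units.val_mul]
    rfl
  have hentry (l : Fin 3) : S i i * (M : Matrix (Fin 3) (Fin 3) k) i l =
      (M : Matrix (Fin 3) (Fin 3) k) i l * d l := by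
    rw [← Matrix.mul_diagonal, ← hmul, Matrix.mul_apply]
    rw [Finset.sum_eq_single i]
    · intro m _ hm
      rw [hS.apply_eq_zero (Ne.symm hm), zero_mul]
    · exact fun h => absurd (Finset.mem_univ _) h
  have h1 : S i i = d j := mul_right_cancel₀ hj ((hentry j).trans (mul_comm _ _))
  have h2 : S i i = d j' := mul_right_cancel₀ hj' ((hentry j').trans (mul_comm _ _))
  have hd1 : d j = -1 := if_pos rfl
  have hd1' : d j' = 1 := if_neg (Ne.symm hne)
  have h3 : (-1 : k) = 1 := by rw [← hd1, ← hd1', ← h1, ← h2]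
  norm_num at h3

theorem isIso_swap₀₂ (A B C a b c : k) :
    ∃ M : GL (Fin 3) k, IsIso M (standardForm C B A c b a) (standardForm A B C a b c) :=
  ⟨Matrix.GeneralLinearGroup.mkOfDetNeZero !![0, 0, 1; 0, 1, 0; 1, 0, 0] (by
      rw [Matrix.det_fin_three]; simp), 1, by
    rw [Units.val_one, one_smul]; exact subst_swap₀₂ A B C a b c⟩

theorem isIso_swap₁₂ (A B C a b c : k) :
    ∃ M : GL (Fin 3) k, IsIso M (standardForm A C B a c b) (standardForm A B C a b c) :=
  ⟨Matrix.GeneralLinearGroup.mkOfDetNeZero !![1, 0, 0; 0, 0, 1; 0, 1, 0] (by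
      rw [Matrix.det_fin_three]; simp), 1, by
    rw [Units.val_one, one_smul]; exact subst_swap₁₂ A B C a b c⟩

theorem eval_single_standardForm {A B C a b c : k} (i : Fin 3) (t : k) :
    eval (Pi.single i t) (standardForm A B C a b c) = ![A, B, C] i * t ^ 4 := by
  rw [eval_standardForm]
  fin_cases i <;> simp

theorem eval_pair_standardForm {A B C a b c : k} (i : Fin 3) (s t : k) :
    eval (Pi.single (i + 1) s + Pi.single (i + 2) t) (standardForm A B C a b c) =
      ![A, B, C] (i + 1) * s ^ 4 + ![A, B, C] (i + 2) * t ^ 4 +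
        ![a, b, c] i * (s ^ 2 * t ^ 2) := by
  rw [eval_standardForm]
  fin_cases i <;> simp <;> ring

theorem perm_fin_three (π : Equiv.Perm (Fin 3)) (i : Fin 3) :
    (π (i + 1) = π i + 1 ∧ π (i + 2) = π i + 2) ∨
      (π (i + 1) = π i + 2 ∧ π (i + 2) = π i + 1) := by
  revert π i
  decide

variable [IsAlgClosed k] [CharZero k]

/-- Isomorphisms between nonspecial quartics in standard form are monomial. -/
theorem eq_of_ne_zero_of_isIso {A B C a b c A' B' C' a' b' c' : k} {M : GL (Fin 3) k}
    (hM : IsIso M (standardForm A B C a b c) (standardForm A' B' C' a' b' c'))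
    (hB : B ≠ 0) (ha : a ^ 2 - 4 * B * C ≠ 0) (hB' : B' ≠ 0) (ha' : a' ^ 2 - 4 * B' * C' ≠ 0)
    (hns : NonSpecial (standardForm A B C a b c)) {i j j' : Fin 3}
    (hj : (M : Matrix (Fin 3) (Fin 3) k) i j ≠ 0)
    (hj' : (M : Matrix (Fin 3) (Fin 3) k) i j' ≠ 0) : j = j' := by
  have h : conjSubgroup M (signSubgroup k) = signSubgroup k :=
    hns.unique ((isCianiSubgroup_signSubgroup A' B' C' a' b' c' hB' ha').conj hM)
      (isCianiSubgroup_signSubgroup A B C a b c hB ha)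
  refine eq_of_ne_zero_of_normalizes (fun D hD => ?_) hj hj'
  rw [← mk_mem_signSubgroup_iff, ← mk_mem_conjSubgroup_iff, h, mk_mem_signSubgroup_iff]
  exact hD

/-- If equality held, rescaling `x` would make the form symmetric in `x` and `y`. In the coordinates
`x ± y` it would again be standard, so there would be a non-monomial isomorphism between standard
forms, against `eq_of_ne_zero_of_isIso`. -/
theorem NonSpecial.ne₀₁ {A B C a b c : k} (h : IsSmoothStandard A B C a b c)
    (hns : NonSpecial (standardForm A B C a b c)) : A * a ^ 2 ≠ B * b ^ 2 := by
  intro hab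
  obtain ⟨hA, hB, hC, ha, hb, hc, hdet⟩ := h
  -- The substitution `x ↦ μ x` turns the coefficients `A` and `b` into `B` and `a`. If `b = 0` then
  -- `a = 0` as well, and only the condition on `μ⁴` remains.
  obtain ⟨μ, hμ, hμ0, hμ4, hμ2⟩ : ∃ μ : k, μ ≠ 0 ∧ μ ≠ 0 ∧ A * μ ^ 4 = B ∧ b * μ ^ 2 = a := by
    by_cases hb0 : b = 0
    · have ha0 : a = 0 := by
        subst hb0
        simpa [hA] using hab
      obtain ⟨μ, hμ⟩ := IsAlgClosed.exists_pow_nat_eq (B / A) (n := 4) (by norm_num)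
      have : μ ≠ 0 := by
        rintro rfl
        have := div_ne_zero hB hA
        exact this (by rw [← hμ]; ring)
      exact ⟨μ, this, this, by rw [hμ]; field_simp, by simp [ha0, hb0]⟩
    · obtain ⟨μ, hμ⟩ := IsAlgClosed.exists_pow_nat_eq (a / b) (n := 2) (by norm_num)
      have ha0 : a ≠ 0 := by
        rintro rfl
        have : B * b ^ 2 = 0 := by rw [← hab]; ring
        simp [hB, hb0] at this
      have : μ ≠ 0 := by
        rintro rfl
        have := div_ne_zero ha0 hb0
        exact this (by rw [← hμ]; ring)
      refine ⟨μ, this, this, ?_, by rw [hμ]; field_simp⟩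
      rw [show 4 = 2 * 2 from rfl, pow_mul, hμ]
      field_simp
      linear_combination hab
  have h2 : (2 : k) ≠ 0 := two_ne_zero
  let N : GL (Fin 3) k := Matrix.GeneralLinearGroup.mkOfDetNeZero
    !![μ, μ, 0; 1, -1, 0; 0, 0, 1] (by
      rw [Matrix.det_fin_three]
      simp only [Matrix.of_apply, Matrix.cons_val]
      intro h
      have : 2 * μ = 0 := by linear_combination -h
      simp [hμ] at this)
  have hN : IsIso N (standardForm (2 * B + c * μ ^ 2) (2 * B + c * μ ^ 2) C (2 * a) (2 * a)
      (12 * B - 2 * c * μ ^ 2)) (standardForm A B C a b c) := by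
    refine ⟨1, MvPolynomial.funext fun v => ?_⟩
    have hv : (N : Matrix (Fin 3) (Fin 3) k).mulVec v =
        ![μ * (v 0 + v 1), v 0 - v 1, v 2] := by
      change Matrix.mulVec !![μ, μ, 0; 1, -1, 0; 0, 0, 1] v = _
      funext i
      fin_cases i <;> simp [Matrix.mulVec, dotProduct, Fin.sum_univ_three] <;> ring
    rw [eval_subst, hv, Units.val_one, one_smul, eval_standardForm, eval_standardForm]
    simp only [Matrix.cons_val]
    linear_combination (v 0 + v 1) ^ 4 * hμ4 + (v 0 + v 1) ^ 2 * v 2 ^ 2 * hμ2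
  have hB' : 2 * B + c * μ ^ 2 ≠ 0 := by
    intro h
    apply hc
    have : (c ^ 2 - 4 * A * B) * μ ^ 4 = 0 := by
      linear_combination (c * μ ^ 2 - 2 * B) * h - 4 * B * hμ4
    simpa [hμ] using this
  have ha' : (2 * a) ^ 2 - 4 * (2 * B + c * μ ^ 2) * C ≠ 0 := by
    intro h
    apply hdet
    have : 4 * μ ^ 4 *
        (-4 * A * B * C + A * a ^ 2 + B * b ^ 2 + C * c ^ 2 - a * b * c) = 0 := by
      linear_combination (2 * B - c * μ ^ 2) * h + (-16 * B * C + 4 * a ^ 2) * hμ4 +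
        4 * B * (b * μ ^ 2 + a) * hμ2 - 4 * a * c * μ ^ 2 * hμ2
    simpa [hμ] using this
  have := eq_of_ne_zero_of_isIso (i := 0) (j := 0) (j' := 1) hN hB' ha' hB ha (hns.conj hN) hμ hμ
  simp at this

theorem NonSpecial.injective {A B C a b c : k} (h : IsSmoothStandard A B C a b c)
    (hns : NonSpecial (standardForm A B C a b c)) :
    Function.Injective (fun i => ![A, B, C] i * ![a, b, c] i ^ 2) := by
  have h01 := hns.ne₀₁ h
  have h02 : A * a ^ 2 ≠ C * c ^ 2 := by
    obtain ⟨M, hM⟩ := isIso_swap₁₂ A B C a b c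
    refine (hns.conj hM).ne₀₁ ⟨h.hA, h.hC, h.hB, ?_, h.hc, h.hb, ?_⟩
    · convert h.ha using 1; ring
    · convert h.hdet using 1; ring
  have h12 : C * c ^ 2 ≠ B * b ^ 2 := by
    obtain ⟨M, hM⟩ := isIso_swap₀₂ A B C a b c
    refine (hns.conj hM).ne₀₁ ⟨h.hC, h.hB, h.hA, ?_, ?_, ?_, ?_⟩
    · convert h.hc using 1; ring
    · convert h.hb using 1; ring
    · convert h.ha using 1; ring
    · convert h.hdet using 1; ring
  intro i j hij
  fin_cases i <;> fin_cases j <;> simp at hij ⊢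
  exacts [h01 hij, h02 hij, h01 hij.symm, h12 hij.symm, h02 hij.symm, h12 hij]

section Aut

variable {A B C a b c : k}

/-- An automorphism is monomial, so it permutes the coordinates. Comparing coefficients shows that
the permutation preserves `αᵢ βᵢ²`, which takes three distinct values. It is therefore a diagonal
matrix, and the nonzero mixed coefficients `b` and `c` force its entries to have equal squares. -/
theorem isSign_of_isIso (h : IsSmoothStandard A B C a b c) (hb : b ≠ 0) (hc : c ≠ 0)
    (hns : NonSpecial (standardForm A B C a b c)) {M : GL (Fin 3) k}
    (hM : IsIso M (standardForm A B C a b c) (standardForm A B C a b c)) :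
    IsSign (M : Matrix (Fin 3) (Fin 3) k) := by
  have hmono := fun i j j' => eq_of_ne_zero_of_isIso (i := i) (j := j) (j' := j') hM
    h.hB h.ha h.hB h.ha hns
  have hinj := hns.injective h
  set α := ![A, B, C] with hα
  set β := ![a, b, c] with hβ
  have hα0 (i : Fin 3) : α i ≠ 0 := by
    fin_cases i
    exacts [h.hA, h.hB, h.hC]
  have hMinj := Matrix.mulVec_injective_iff_isUnit.2 M.isUnit
  have hVinj := Matrix.vecMul_injective_iff_isUnit.2 M.isUnit
  have hex (i : Fin 3) : ∃ j, (M : Matrix (Fin 3) (Fin 3) k) i j ≠ 0 := by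
    by_contra! hcon
    have : Matrix.vecMul (Pi.single i 1) (M : Matrix (Fin 3) (Fin 3) k) =
        Matrix.vecMul 0 (M : Matrix (Fin 3) (Fin 3) k) := by
      rw [Matrix.single_one_vecMul, Matrix.zero_vecMul]
      exact funext hcon
    simpa using congrFun (hVinj this) i
  choose f hf using hex
  have hf0 (i j : Fin 3) (hj : j ≠ f i) : (M : Matrix (Fin 3) (Fin 3) k) i j = 0 := by
    by_contra hcon
    exact hj (hmono i j (f i) hcon (hf i))
  have hsurj : Function.Surjective f := by
    intro j
    by_contra! hcon
    have : (M : Matrix (Fin 3) (Fin 3) k).mulVec (Pi.single j 1) =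
        (M : Matrix (Fin 3) (Fin 3) k).mulVec 0 := by
      rw [Matrix.mulVec_single_one, Matrix.mulVec_zero]
      exact funext fun i => hf0 i j (hcon i).symm
    simpa using congrFun (hMinj this) j
  let π : Equiv.Perm (Fin 3) := Equiv.ofBijective f (Finite.surjective_iff_bijective.1 hsurj)
  have hπ (i : Fin 3) : π i = f i := rfl
  set m : Fin 3 → k := fun i => (M : Matrix (Fin 3) (Fin 3) k) i (f i) with hm
  have hcol (i : Fin 3) : (M : Matrix (Fin 3) (Fin 3) k).mulVec (Pi.single (π i) 1) =
      Pi.single i (m i) := by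
    rw [Matrix.mulVec_single_one]
    funext l
    by_cases hl : l = i
    · subst hl; simp [hm, hπ]
    · rw [Pi.single_eq_of_ne hl]
      exact hf0 l _ fun h => hl (π.injective h.symm)
  obtain ⟨u, hu⟩ := hM
  have hev (v : Fin 3 → k) : eval ((M : Matrix (Fin 3) (Fin 3) k).mulVec v)
      (standardForm A B C a b c) = u * eval v (standardForm A B C a b c) := by
    rw [← eval_subst, hu, smul_eval]
  have hα1 (i : Fin 3) : α i * m i ^ 4 = u * α (π i) := by
    have := hev (Pi.single (π i) 1)
    rwa [hcol, eval_single_standardForm, eval_single_standardForm, one_pow, mul_one] at this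
  -- Evaluating at a sum of two basis vectors isolates one mixed coefficient after the pure fourth
  -- powers are subtracted.
  have hβ1 (i : Fin 3) : β i * (m (i + 1) ^ 2 * m (i + 2) ^ 2) = u * β (π i) := by
    have h1 := hev (Pi.single (π (i + 1)) 1 + Pi.single (π (i + 2)) 1)
    rw [Matrix.mulVec_add, hcol, hcol, eval_pair_standardForm] at h1
    have h2 : eval (Pi.single (π (i + 1)) 1 + Pi.single (π (i + 2)) 1) (standardForm A B C a b c) =
        α (π (i + 1)) + α (π (i + 2)) + β (π i) := by
      have hπi : (π (i + 1) = π i + 1 ∧ π (i + 2) = π i + 2) ∨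
          (π (i + 1) = π i + 2 ∧ π (i + 2) = π i + 1) := perm_fin_three π i
      rcases hπi with ⟨e1, e2⟩ | ⟨e1, e2⟩ <;> rw [e1, e2]
      · rw [eval_pair_standardForm]; ring
      · rw [add_comm (Pi.single _ _), eval_pair_standardForm]; ring
    rw [h2] at h1
    linear_combination h1 - hα1 (i + 1) - hα1 (i + 2)
  have hu0 : (u : k) ≠ 0 := u.ne_zero
  -- The product of the relations `hα1` over all `i`; the permutation disappears from it.
  have hprod : (m 0 * m 1 * m 2) ^ 4 = (u : k) ^ 3 := by
    have e1 : ∏ i, α i * m i ^ 4 = ∏ i, (u : k) * α (π i) := Finset.prod_congr rfl fun i _ => hα1 i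
    rw [Finset.prod_mul_distrib, Finset.prod_mul_distrib, Equiv.prod_comp π α] at e1
    have hne : ∏ i, α i ≠ 0 := Finset.prod_ne_zero_iff.2 fun i _ => hα0 i
    refine mul_left_cancel₀ hne (Eq.trans ?_ (e1.trans (mul_comm _ _) |>.trans ?_))
    · rw [Fin.prod_univ_three (fun i => m i ^ 4)]; ring
    · simp
  have hπ1 (i : Fin 3) : π i = i := by
    refine hinj (mul_left_cancel₀ (pow_ne_zero 3 hu0) ?_)
    change (u : k) ^ 3 * (α (π i) * β (π i) ^ 2) = (u : k) ^ 3 * (α i * β i ^ 2)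
    have hm3 : m 0 * m 1 * m 2 = m i * (m (i + 1) * m (i + 2)) := by
      fin_cases i <;> simp <;> ring
    calc (u : k) ^ 3 * (α (π i) * β (π i) ^ 2)
        = (u * α (π i)) * (u * β (π i)) ^ 2 := by ring
      _ = (m 0 * m 1 * m 2) ^ 4 * (α i * β i ^ 2) := by rw [← hα1, ← hβ1, hm3]; ring
      _ = _ := by rw [hprod]
  have hM' : (M : Matrix (Fin 3) (Fin 3) k) = Matrix.diagonal m := by
    ext i j
    by_cases hij : i = j
    · subst hij
      rw [Matrix.diagonal_apply_eq, hm]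
      dsimp only
      rw [← hπ, hπ1]
    · rw [Matrix.diagonal_apply_ne _ hij]
      exact hf0 i j (by rw [← hπ, hπ1]; exact Ne.symm hij)
  have hm0 : m 0 ≠ 0 := hf 0
  have hu4 : m 0 ^ 4 = u := mul_left_cancel₀ (hα0 0) (by rw [hα1, hπ1, mul_comm])
  have hm1 : m 2 ^ 2 = m 0 ^ 2 := by
    have h1 := hβ1 1
    rw [hπ1] at h1
    have h2 : m 2 ^ 2 * m 0 ^ 2 = u := mul_left_cancel₀ (show β 1 ≠ 0 from hb)
      (h1.trans (mul_comm _ _))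
    refine mul_right_cancel₀ (pow_ne_zero 2 hm0) ?_
    rw [h2, ← hu4]; ring
  have hm2 : m 1 ^ 2 = m 0 ^ 2 := by
    have h1 := hβ1 2
    rw [hπ1] at h1
    have h2 : m 0 ^ 2 * m 1 ^ 2 = u := mul_left_cancel₀ (show β 2 ≠ 0 from hc)
      (h1.trans (mul_comm _ _))
    refine mul_left_cancel₀ (pow_ne_zero 2 hm0) ?_
    rw [h2, ← hu4]; ring
  refine ⟨m 0, m 1 / m 0, m 2 / m 0, ?_, ?_, ?_⟩
  · rw [div_pow, hm2, div_self (pow_ne_zero 2 hm0)]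
  · rw [div_pow, hm1, div_self (pow_ne_zero 2 hm0)]
  · rw [hM', ← Matrix.diagonal_smul]
    congr 1
    funext i
    fin_cases i <;> simp <;> field_simp

end Aut

end Automorphisms

/-! ### Inertia acts trivially on residues, and tamely on roots of order prime to `p`. -/

section Padic

variable {p : ℕ} [Fact p.Prime]

theorem norm_algEquiv_padic (σ : PadicAlgCl p ≃ₐ[ℚ_[p]] PadicAlgCl p) (x : PadicAlgCl p) :
    ‖σ x‖ = ‖x‖ :=
  (spectralNorm_eq_of_equiv σ x).symm

theorem norm_algEquiv (σ : PadicAlgCl p ≃ₐ[Qpnr p] PadicAlgCl p) (x : PadicAlgCl p) :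
    ‖σ x‖ = ‖x‖ :=
  norm_algEquiv_padic (σ.restrictScalars ℚ_[p]) x

theorem norm_natCast_prime : ‖(p : PadicAlgCl p)‖ = (p : ℝ)⁻¹ := by
  rw [← map_natCast (algebraMap ℚ_[p] (PadicAlgCl p)), PadicAlgCl.norm_extends, Padic.norm_p]

theorem norm_natCast_prime_lt_one : ‖(p : PadicAlgCl p)‖ < 1 := by
  rw [norm_natCast_prime]
  exact inv_lt_one_of_one_lt₀ (by exact_mod_cast (Fact.out : p.Prime).one_lt)

theorem norm_natCast_eq_one {n : ℕ} (hn : n.Coprime p) : ‖(n : PadicAlgCl p)‖ = 1 := by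
  rw [← map_natCast (algebraMap ℚ_[p] (PadicAlgCl p)), PadicAlgCl.norm_extends,
    Padic.norm_natCast_eq_one_iff]
  exact hn.symm

theorem norm_sub_le_max' (x y : PadicAlgCl p) : ‖x - y‖ ≤ max ‖x‖ ‖y‖ :=
  by simpa [sub_eq_add_neg] using IsUltrametricDist.norm_add_le_max x (-y)

/-- The ring of integers of `ℚ_p^alg`. -/
def integers (p : ℕ) [Fact p.Prime] : Subring (PadicAlgCl p) where
  carrier := {x | ‖x‖ ≤ 1}
  zero_mem' := by simp
  one_mem' := by simp
  add_mem' {x y} hx hy := (IsUltrametricDist.norm_add_le_max x y).trans (max_le hx hy)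
  neg_mem' {x} hx := by simpa using hx
  mul_mem' {x y} hx hy := by
    change ‖x * y‖ ≤ 1
    rw [norm_mul]
    exact mul_le_one₀ hx (norm_nonneg _) hy

theorem mem_integers {x : PadicAlgCl p} : x ∈ integers p ↔ ‖x‖ ≤ 1 := Iff.rfl

/-- Modulo `p` one has `y ^ p - 1 ≡ (y - 1) ^ p`: Frobenius is injective on the residue field. -/
theorem norm_sub_one_lt_one_of_pow_prime {y : PadicAlgCl p} (hy : ‖y‖ ≤ 1)
    (h : ‖y ^ p - 1‖ < 1) : ‖y - 1‖ < 1 := by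
  have hp : p.Prime := Fact.out
  let Y : integers p := ⟨y, hy⟩
  obtain ⟨r, hr⟩ := exists_add_pow_prime_eq hp (Y - 1) 1
  have hr' : y ^ p = (y - 1) ^ p + 1 ^ p + p * (y - 1) * 1 * r := by
    have := congrArg (Subtype.val) hr
    simpa [Y] using this
  have h1 : (y - 1) ^ p = (y ^ p - 1) - p * ((y - 1) * r) := by
    linear_combination -hr' - one_pow (M := PadicAlgCl p) p
  have h2 : ‖(y - 1) ^ p‖ < 1 := by
    rw [h1]
    refine (norm_sub_le_max' _ _).trans_lt (max_lt h ?_)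
    rw [norm_mul]
    exact mul_lt_one_of_nonneg_of_lt_one_left (norm_nonneg _) norm_natCast_prime_lt_one
      ((integers p).mul_mem ((integers p).sub_mem hy (integers p).one_mem) r.2)
  rw [norm_pow] at h2
  exact (pow_lt_one_iff_of_nonneg (norm_nonneg _) hp.ne_zero).1 h2

/-- The powers of `x` lie in the unit ball of `ℚ_p(x)`, which is compact by finite dimensionality,
so a subsequence is Cauchy. This replaces finiteness of the residue field. -/
theorem exists_pow_sub_pow_lt_one {x : PadicAlgCl p} (hx : ‖x‖ ≤ 1) :
    ∃ i j : ℕ, i < j ∧ ‖x ^ i - x ^ j‖ < 1 := by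
  let E := Subalgebra.toSubmodule (IntermediateField.adjoin ℚ_[p] {x}).toSubalgebra
  have : FiniteDimensional ℚ_[p] E :=
    IntermediateField.adjoin.finiteDimensional (Algebra.IsIntegral.isIntegral x)
  have : ProperSpace E := FiniteDimensional.proper ℚ_[p] E
  have hxE : x ∈ IntermediateField.adjoin ℚ_[p] {x} :=
    IntermediateField.mem_adjoin_simple_self _ x
  let u : ℕ → E := fun n => ⟨x ^ n, pow_mem hxE n⟩
  have hu (n) : u n ∈ Metric.closedBall (0 : E) 1 := by
    rw [mem_closedBall_zero_iff]
    change ‖x ^ n‖ ≤ 1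
    rw [norm_pow]
    exact pow_le_one₀ (norm_nonneg _) hx
  obtain ⟨a, -, φ, hφ, hlim⟩ := (isCompact_closedBall (0 : E) 1).tendsto_subseq hu
  obtain ⟨N, hN⟩ := (Metric.cauchySeq_iff'.1 hlim.cauchySeq) 1 one_pos
  refine ⟨φ N, φ (N + 1), hφ (Nat.lt_succ_self N), ?_⟩
  have := hN (N + 1) (Nat.le_succ N)
  rw [dist_comm, dist_eq_norm] at this
  exact this

/-- A Teichmüller representative, found without Hensel's lemma. Some power satisfies `‖x ^ n - 1‖ <
1` with `n` prime to `p`; since `x ^ n - 1` is the product of the `x - ζ`, some factor has norm less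
than 1. -/
theorem exists_root_of_unity_near {x : PadicAlgCl p} (hx : ‖x‖ = 1) :
    ∃ (n : ℕ) (ζ : PadicAlgCl p), 0 < n ∧ n.Coprime p ∧ ζ ^ n = 1 ∧ ‖x - ζ‖ < 1 := by
  have hp : p.Prime := Fact.out
  obtain ⟨i, j, hij, h⟩ := exists_pow_sub_pow_lt_one hx.le
  obtain ⟨N, hN, h1⟩ : ∃ N, 0 < N ∧ ‖x ^ N - 1‖ < 1 := by
    refine ⟨j - i, by omega, ?_⟩
    have : x ^ i - x ^ j = x ^ i * -(x ^ (j - i) - 1) := by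
      rw [mul_neg, mul_sub, ← pow_add, show i + (j - i) = j by omega]; ring
    rwa [this, norm_mul, norm_pow, hx, one_pow, one_mul, norm_neg] at h
  -- The `p`-part of the exponent is removed one factor at a time by injectivity of Frobenius.
  obtain ⟨n, hn, hnp, hxn⟩ : ∃ n, 0 < n ∧ n.Coprime p ∧ ‖x ^ n - 1‖ < 1 := by
    obtain ⟨e, n, hpn, rfl⟩ := Nat.exists_eq_pow_mul_and_not_dvd hN.ne' p hp.ne_one
    refine ⟨n, Nat.pos_of_ne_zero fun h0 => hpn (h0 ▸ dvd_zero p),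
      ((Nat.Prime.coprime_iff_not_dvd hp).2 hpn).symm, ?_⟩
    clear hN
    induction e with
    | zero => simpa using h1
    | succ e ih =>
      refine ih (norm_sub_one_lt_one_of_pow_prime ?_ ?_)
      · rw [norm_pow, hx, one_pow]
      · rwa [← pow_mul, show p ^ e * n * p = p ^ (e + 1) * n by ring]
  refine ⟨n, ?_⟩
  by_contra! hcon
  have hroot (ζ : PadicAlgCl p) (hζ : ζ ^ n = 1) : ‖x - ζ‖ = 1 := by
    refine le_antisymm ?_ (hcon ζ hn hnp hζ)
    have : ‖ζ‖ = 1 := by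
      have := congrArg norm hζ
      rw [norm_pow, norm_one] at this
      exact (pow_eq_one_iff_of_nonneg (norm_nonneg _) hn.ne').1 this
    exact (norm_sub_le_max' _ _).trans (by rw [hx, this, max_self])
  have hmonic : (Polynomial.X ^ n - 1 : Polynomial (PadicAlgCl p)).Monic :=
    Polynomial.monic_X_pow_sub_C 1 hn.ne'
  have hprod := (IsAlgClosed.splits (Polynomial.X ^ n - 1 : Polynomial
    (PadicAlgCl p))).eval_eq_prod_roots_of_monic hmonic x
  have hnorm := congrArg norm hprod
  simp only [Polynomial.eval_sub, Polynomial.eval_pow, Polynomial.eval_X, Polynomial.eval_one]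
    at hnorm
  have hcoe (y : PadicAlgCl p) : ‖y‖ = normHom y := rfl
  rw [hcoe (Multiset.prod _), map_multiset_prod, Multiset.map_map, Multiset.prod_eq_one] at hnorm
  · exact hxn.ne hnorm
  · intro a ha
    obtain ⟨ζ, hζ, rfl⟩ := Multiset.mem_map.1 ha
    refine hroot ζ ?_
    have := (Polynomial.mem_roots hmonic.ne_zero).1 hζ
    simpa [sub_eq_zero] using this

theorem algEquiv_root_of_unity (σ : PadicAlgCl p ≃ₐ[Qpnr p] PadicAlgCl p) {n : ℕ} (hn : 0 < n)
    (hnp : n.Coprime p) {ζ : PadicAlgCl p} (hζ : ζ ^ n = 1) : σ ζ = ζ :=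
  σ.commutes (⟨ζ, IntermediateField.subset_adjoin _ _ ⟨n, hn, hnp, hζ⟩⟩ : Qpnr p)

/-- The residue of `t` is that of a root of unity in `Qpnr p`, which `σ` fixes; and `σ` preserves
norms. -/
theorem norm_algEquiv_sub_self_lt_one (σ : PadicAlgCl p ≃ₐ[Qpnr p] PadicAlgCl p)
    {t : PadicAlgCl p} (ht : ‖t‖ = 1) : ‖σ t - t‖ < 1 := by
  obtain ⟨n, ζ, hn, hnp, hζ, hlt⟩ := exists_root_of_unity_near ht
  have : σ t - t = σ (t - ζ) - (t - ζ) := by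
    rw [map_sub, algEquiv_root_of_unity σ hn hnp hζ]; ring
  rw [this]
  exact (norm_sub_le_max' _ _).trans_lt (max_lt (by rwa [norm_algEquiv]) hlt)

/-- If `η ≠ 1`, then `1 + η + ... + η ^ (n - 1)` vanishes, yet it is congruent to the unit `n`. -/
theorem eq_one_of_pow_eq_one_of_norm_sub_lt {n : ℕ} (hnp : n.Coprime p) {η : PadicAlgCl p}
    (hη : η ^ n = 1) (h : ‖η - 1‖ < 1) : η = 1 := by
  by_contra hne
  have hn0 : n ≠ 0 := by
    rintro rfl
    exact (Fact.out : p.Prime).ne_one (by simpa using hnp)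
  have hη1 : ‖η‖ = 1 := by
    have := congrArg norm hη
    rw [norm_pow, norm_one] at this
    exact (pow_eq_one_iff_of_nonneg (norm_nonneg _) hn0).1 this
  have hsum : ∑ i ∈ Finset.range n, η ^ i = 0 := by
    have := geom_sum_mul η n
    rw [hη, sub_self] at this
    exact (mul_eq_zero.1 this).resolve_right (sub_ne_zero.2 hne)
  have hsum2 : ∑ i ∈ Finset.range n, (η ^ i - 1) = -(n : PadicAlgCl p) := by
    rw [Finset.sum_sub_distrib, hsum]; simp
  have hlt (i : ℕ) : ‖η ^ i - 1‖ < 1 := by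
    rw [← geom_sum_mul, norm_mul]
    refine mul_lt_one_of_nonneg_of_lt_one_right ?_ (norm_nonneg _) h
    exact (integers p).sum_mem fun j _ => (integers p).pow_mem (mem_integers.2 hη1.le) j
  have : ‖(n : PadicAlgCl p)‖ < 1 := by
    rw [← norm_neg, ← hsum2]
    obtain ⟨i, -, hi⟩ := IsUltrametricDist.exists_norm_finsetSum_le (Finset.range n)
      (fun i => η ^ i - 1)
    exact hi.trans_lt (hlt i)
  exact this.ne (norm_natCast_eq_one hnp)

/-- An automorphism over `ℚ_p^nr` that fixes the `n`-th power of an element of norm `1` fixes the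
element itself, if `n` is prime to `p`. -/
theorem algEquiv_eq_self_of_pow (σ : PadicAlgCl p ≃ₐ[Qpnr p] PadicAlgCl p) {n : ℕ}
    (hnp : n.Coprime p) {t : PadicAlgCl p} (ht : ‖t‖ = 1) (h : σ (t ^ n) = t ^ n) : σ t = t := by
  have ht0 : t ≠ 0 := by rintro rfl; simp at ht
  have h1 : σ t / t = 1 := by
    refine eq_one_of_pow_eq_one_of_norm_sub_lt hnp ?_ ?_
    · rw [div_pow, ← map_pow, h, div_self (pow_ne_zero n ht0)]
    · rw [div_sub_one ht0, norm_div, ht, div_one]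
      exact norm_algEquiv_sub_self_lt_one σ ht
  exact (div_eq_one_iff_eq ht0).1 h1

end Padic

/-! ### The value groups of `Qpnr p` and of its finite extensions are discrete. -/

section ValueGroup

variable {p : ℕ} [Fact p.Prime]

/-- The ring generated over `ℤ_p` by the roots of unity of order prime to `p`. -/
noncomputable def unramifiedIntegers (p : ℕ) [Fact p.Prime] : Subalgebra ℤ_[p] (PadicAlgCl p) :=
  Algebra.adjoin ℤ_[p] {z | ∃ n : ℕ, 0 < n ∧ n.Coprime p ∧ z ^ n = 1}

theorem norm_algebraMap_padicInt (a : ℤ_[p]) : ‖algebraMap ℤ_[p] (PadicAlgCl p) a‖ = ‖a‖ := by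
  rw [IsScalarTower.algebraMap_apply ℤ_[p] ℚ_[p] (PadicAlgCl p), PadicAlgCl.norm_extends]
  rfl

theorem norm_le_one_of_mem_unramifiedIntegers {y : PadicAlgCl p}
    (hy : y ∈ unramifiedIntegers p) : ‖y‖ ≤ 1 := by
  induction hy using Algebra.adjoin_induction with
  | mem z hz =>
    obtain ⟨n, hn, -, hz⟩ := hz
    have := congrArg norm hz
    rw [norm_pow, norm_one] at this
    exact ((pow_eq_one_iff_of_nonneg (norm_nonneg _) hn.ne').1 this).le
  | algebraMap a => rw [norm_algebraMap_padicInt]; exact PadicInt.norm_le_one a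
  | add x y _ _ hx hy => exact (integers p).add_mem hx hy
  | mul x y _ _ hx hy => exact (integers p).mul_mem hx hy

theorem dvd_pow_sub_self_of_dvd {R : Type*} [CommRing R] {a y : R} {q : ℕ}
    (h : a ∣ y ^ q - y) (m : ℕ) : a ∣ y ^ q ^ m - y := by
  induction m with
  | zero => simp
  | succ m ih =>
    have h1 : y ^ q ^ (m + 1) - y = ((y ^ q ^ m) ^ q - y ^ q) + (y ^ q - y) := by
      rw [← pow_mul, ← pow_succ]; ring
    rw [h1]
    exact dvd_add (ih.trans (sub_dvd_pow_sub_pow _ _ q)) h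

/-- Modulo `p`, the elements of `unramifiedIntegers p` are fixed by a power of Frobenius. -/
theorem exists_dvd_pow_sub_self (y : unramifiedIntegers p) :
    ∃ f : ℕ, 0 < f ∧ (p : unramifiedIntegers p) ∣ y ^ p ^ f - y := by
  have hp : p.Prime := Fact.out
  obtain ⟨y, hy⟩ := y
  induction hy using Algebra.adjoin_induction with
  | mem z hz =>
    obtain ⟨n, hn, hnp, hz⟩ := hz
    refine ⟨n.totient, Nat.totient_pos.2 hn, ?_⟩
    have h : z ^ p ^ n.totient = z := by
      obtain ⟨c, hc⟩ := (Nat.modEq_iff_dvd' (Nat.one_le_pow _ _ hp.pos)).1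
        (Nat.ModEq.pow_totient hnp.symm).symm
      have h2 : p ^ n.totient = n * c + 1 := by
        have := Nat.one_le_pow n.totient p hp.pos
        omega
      rw [h2, pow_succ, pow_mul, hz, one_pow, one_mul]
    convert dvd_zero _
    rw [sub_eq_zero]
    exact Subtype.ext h
  | algebraMap a =>
    refine ⟨1, one_pos, ?_⟩
    have h : (p : ℤ_[p]) ∣ a ^ p - a := by
      rw [← PadicInt.norm_lt_one_iff_dvd, ← PadicInt.mem_nonunits,
        ← IsLocalRing.mem_maximalIdeal, ← PadicInt.ker_toZMod, RingHom.mem_ker]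
      rw [map_sub, map_pow, ZMod.pow_card, sub_self]
    have := (algebraMap ℤ_[p] (unramifiedIntegers p)).map_dvd h
    rw [pow_one]
    change _ ∣ algebraMap ℤ_[p] (unramifiedIntegers p) a ^ p - algebraMap _ _ a
    simpa using this
  | add x y hx hy ihx ihy =>
    obtain ⟨f, hf, hfx⟩ := ihx
    obtain ⟨g, hg, hgy⟩ := ihy
    -- A common multiple of the two Frobenius periods serves both summands.
    refine ⟨f * g, Nat.mul_pos hf hg, ?_⟩
    have h1 := dvd_pow_sub_self_of_dvd hfx g
    have h2 := dvd_pow_sub_self_of_dvd hgy f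
    rw [← pow_mul] at h1 h2
    rw [mul_comm g f] at h2
    obtain ⟨r, hr⟩ := exists_add_pow_prime_pow_eq hp (⟨x, hx⟩ : unramifiedIntegers p)
      ⟨y, hy⟩ (f * g)
    have h3 : (⟨x + y, add_mem hx hy⟩ : unramifiedIntegers p) = ⟨x, hx⟩ + ⟨y, hy⟩ := rfl
    rw [h3, hr]
    obtain ⟨c, hc⟩ := h1
    obtain ⟨d, hd⟩ := h2
    refine ⟨c + d + ⟨x, hx⟩ * ⟨y, hy⟩ * r, ?_⟩
    linear_combination hc + hd
  | mul x y hx hy ihx ihy =>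
    obtain ⟨f, hf, hfx⟩ := ihx
    obtain ⟨g, hg, hgy⟩ := ihy
    refine ⟨f * g, Nat.mul_pos hf hg, ?_⟩
    have h1 := dvd_pow_sub_self_of_dvd hfx g
    have h2 := dvd_pow_sub_self_of_dvd hgy f
    rw [← pow_mul] at h1 h2
    rw [mul_comm g f] at h2
    have h3 : (⟨x * y, mul_mem hx hy⟩ : unramifiedIntegers p) = ⟨x, hx⟩ * ⟨y, hy⟩ := rfl
    rw [h3, mul_pow]
    obtain ⟨c, hc⟩ := h1
    obtain ⟨d, hd⟩ := h2
    refine ⟨c * ⟨y, hy⟩ ^ p ^ (f * g) + ⟨x, hx⟩ * d, ?_⟩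
    linear_combination (⟨y, hy⟩ : unramifiedIntegers p) ^ p ^ (f * g) * hc +
      (⟨x, hx⟩ : unramifiedIntegers p) * hd

/-- The norm is the spectral norm, the supremum of the `‖cᵢ‖ ^ (1 / (n - i))`, so it bounds each of
these terms. -/
theorem norm_coeff_minpoly_lt_one {y : PadicAlgCl p} (hy : ‖y‖ < 1) {i : ℕ}
    (hi : i < (minpoly ℚ_[p] y).natDegree) : ‖(minpoly ℚ_[p] y).coeff i‖ < 1 := by
  have h1 : spectralValueTerms (minpoly ℚ_[p] y) i ≤ ‖y‖ :=
    le_ciSup (spectralValueTerms_bddAbove (minpoly ℚ_[p] y)) i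
  rw [spectralValueTerms_of_lt_natDegree _ hi] at h1
  by_contra! h
  have h2 : (1 : ℝ) ≤ ‖(minpoly ℚ_[p] y).coeff i‖ ^
      (1 / ((minpoly ℚ_[p] y).natDegree - i : ℝ)) := by
    refine Real.one_le_rpow h (one_div_nonneg.2 (sub_nonneg.2 ?_))
    exact_mod_cast hi.le
  exact absurd (h2.trans h1) (not_le.2 hy)

/-- The lower coefficients of the minimal polynomial lie in `p ℤ_p`, so its equation expresses the
top power of `y` as `p` times an element of the ring. -/
theorem dvd_pow_natDegree {y : PadicAlgCl p} (hyR : y ∈ unramifiedIntegers p) (hy : ‖y‖ < 1) :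
    (p : unramifiedIntegers p) ∣ (⟨y, hyR⟩ : unramifiedIntegers p) ^
      (minpoly ℚ_[p] y).natDegree := by
  set g := minpoly ℚ_[p] y with hg
  have hint : IsIntegral ℚ_[p] y := Algebra.IsIntegral.isIntegral y
  have hmonic : g.Monic := minpoly.monic hint
  have hb (i : ℕ) : ∃ b : ℤ_[p], i < g.natDegree → g.coeff i = p * (b : ℚ_[p]) := by
    by_cases hi : i < g.natDegree
    · have h1 := norm_coeff_minpoly_lt_one hy hi
      obtain ⟨b, hb⟩ := (PadicInt.norm_lt_one_iff_dvd ⟨g.coeff i, h1.le⟩).1 h1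
      refine ⟨b, fun _ => ?_⟩
      have := congrArg (Subtype.val) hb
      simpa using this
    · exact ⟨0, fun h => absurd h hi⟩
  choose b hb using hb
  have h0 : Polynomial.aeval y g = 0 := minpoly.aeval _ _
  rw [Polynomial.aeval_eq_sum_range, Finset.sum_range_succ, hmonic.coeff_natDegree, one_smul] at h0
  refine ⟨-∑ i ∈ Finset.range g.natDegree, b i • (⟨y, hyR⟩ : unramifiedIntegers p) ^ i,
    Subtype.ext ?_⟩
  have h3 : ∑ i ∈ Finset.range g.natDegree, g.coeff i • y ^ i =
      p * ∑ i ∈ Finset.range g.natDegree, b i • y ^ i := by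
    rw [Finset.mul_sum]
    refine Finset.sum_congr rfl fun i hi => ?_
    rw [hb i (Finset.mem_range.1 hi), Algebra.smul_def, Algebra.smul_def, map_mul, map_natCast,
      mul_assoc]
    rfl
  push_cast
  rw [h3] at h0
  linear_combination h0

/-- This is unramifiedness: `p` generates the ideal of elements of norm less than 1. Modulo `p`,
such an element is nilpotent by `dvd_pow_natDegree` and fixed by a power of Frobenius, hence zero.
-/
theorem exists_eq_prime_mul {y : PadicAlgCl p} (hyR : y ∈ unramifiedIntegers p) (hy : ‖y‖ < 1) :
    ∃ z ∈ unramifiedIntegers p, y = p * z := by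
  have hp : p.Prime := Fact.out
  obtain ⟨f, hf, h⟩ := exists_dvd_pow_sub_self (⟨y, hyR⟩ : unramifiedIntegers p)
  set d := (minpoly ℚ_[p] y).natDegree with hd
  have h1 := dvd_pow_sub_self_of_dvd h d
  have hle : d ≤ (p ^ f) ^ d :=
    (Nat.lt_pow_self (Nat.one_lt_pow hf.ne' hp.one_lt)).le
  have h2 := (dvd_pow_natDegree hyR hy).trans (pow_dvd_pow _ hle)
  obtain ⟨z, hz⟩ := (dvd_sub_right h2).1 h1
  refine ⟨z, z.2, ?_⟩
  have := congrArg (Subtype.val) hz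
  simpa using this

theorem exists_norm_eq_of_mem_unramifiedIntegers {y : PadicAlgCl p}
    (hyR : y ∈ unramifiedIntegers p) (hy : y ≠ 0) : ∃ m : ℤ, ‖y‖ = (p : ℝ) ^ m := by
  have hp : p.Prime := Fact.out
  have hp1 : (1 : ℝ) < p := by exact_mod_cast hp.one_lt
  obtain ⟨m, hm⟩ := exists_pow_lt_of_lt_one (norm_pos_iff.2 hy) (inv_lt_one_of_one_lt₀ hp1)
  induction m generalizing y with
  | zero =>
    rw [pow_zero] at hm
    exact absurd hm (not_lt.2 (norm_le_one_of_mem_unramifiedIntegers hyR))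
  | succ m ih =>
    rcases (norm_le_one_of_mem_unramifiedIntegers hyR).lt_or_eq with h | h
    · obtain ⟨z, hzR, rfl⟩ := exists_eq_prime_mul hyR h
      rw [norm_mul, norm_natCast_prime] at hm ⊢
      obtain ⟨l, hl⟩ := ih hzR (right_ne_zero_of_mul hy) (by
        rw [pow_succ'] at hm
        exact lt_of_mul_lt_mul_left hm (by positivity))
      refine ⟨-1 + l, ?_⟩
      rw [hl, zpow_add₀ (by positivity), zpow_neg_one]
    · exact ⟨0, by simpa using h⟩

theorem exists_prime_pow_mul_mem {x : PadicAlgCl p} (hx : x ∈ Qpnr p) :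
    ∃ m : ℕ, (p : PadicAlgCl p) ^ m * x ∈ unramifiedIntegers p := by
  have hpow (m : ℕ) : (p : PadicAlgCl p) ^ m ∈ unramifiedIntegers p :=
    pow_mem (natCast_mem _ p) m
  have hx' : x ∈ Algebra.adjoin ℚ_[p]
      {z : PadicAlgCl p | ∃ n : ℕ, 0 < n ∧ n.Coprime p ∧ z ^ n = 1} := by
    rw [← IntermediateField.adjoin_toSubalgebra]
    exact hx
  clear hx
  induction hx' using Algebra.adjoin_induction with
  | mem z hz => exact ⟨0, by rw [pow_zero, one_mul]; exact Algebra.subset_adjoin hz⟩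
  | algebraMap a =>
    have hp1 : (1 : ℝ) < p := by exact_mod_cast (Fact.out : p.Prime).one_lt
    obtain ⟨m, hm⟩ := pow_unbounded_of_one_lt ‖a‖ hp1
    have hle : ‖(p : ℚ_[p]) ^ m * a‖ ≤ 1 := by
      rw [norm_mul, norm_pow, Padic.norm_p, inv_pow, inv_mul_le_iff₀ (by positivity), mul_one]
      exact hm.le
    refine ⟨m, ?_⟩
    have : algebraMap ℚ_[p] (PadicAlgCl p) ((p : ℚ_[p]) ^ m * a) ∈ unramifiedIntegers p :=
      (unramifiedIntegers p).algebraMap_mem ⟨_, hle⟩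
    simpa using this
  | add x y hx hy ihx ihy =>
    obtain ⟨m, hm⟩ := ihx
    obtain ⟨n, hn⟩ := ihy
    refine ⟨m + n, ?_⟩
    have : (p : PadicAlgCl p) ^ (m + n) * (x + y) =
        p ^ n * (p ^ m * x) + p ^ m * (p ^ n * y) := by ring
    rw [this]
    exact add_mem (mul_mem (hpow n) hm) (mul_mem (hpow m) hn)
  | mul x y hx hy ihx ihy =>
    obtain ⟨m, hm⟩ := ihx
    obtain ⟨n, hn⟩ := ihy
    refine ⟨m + n, ?_⟩
    have : (p : PadicAlgCl p) ^ (m + n) * (x * y) = (p ^ m * x) * (p ^ n * y) := by ring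
    rw [this]
    exact mul_mem hm hn

theorem exists_norm_eq_of_mem_Qpnr {x : PadicAlgCl p} (hx : x ∈ Qpnr p) (hx0 : x ≠ 0) :
    ∃ m : ℤ, ‖x‖ = (p : ℝ) ^ m := by
  have hp0 : (p : PadicAlgCl p) ≠ 0 := by exact_mod_cast (Fact.out : p.Prime).ne_zero
  have hp1 : (p : ℝ) ≠ 0 := by exact_mod_cast (Fact.out : p.Prime).ne_zero
  obtain ⟨m, hm⟩ := exists_prime_pow_mul_mem hx
  obtain ⟨l, hl⟩ := exists_norm_eq_of_mem_unramifiedIntegers hm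
    (mul_ne_zero (pow_ne_zero m hp0) hx0)
  refine ⟨m + l, ?_⟩
  rw [zpow_add₀ hp1, ← hl, norm_mul, norm_pow, norm_natCast_prime, zpow_natCast, ← mul_assoc,
    ← mul_pow, mul_inv_cancel₀ hp1, one_pow, one_mul]

/-- Up to sign the constant coefficient of the minimal polynomial is the product of the conjugates
of `x`, all of norm `‖x‖`; it lies in `Qpnr p`, where norms are integral powers of `p`. -/
theorem norm_pow_finrank_eq (K : IntermediateField (Qpnr p) (PadicAlgCl p))
    [FiniteDimensional (Qpnr p) K] {x : PadicAlgCl p} (hx : x ∈ K) (hx0 : x ≠ 0) :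
    ∃ m : ℤ, ‖x‖ ^ Module.finrank (Qpnr p) K = (p : ℝ) ^ m := by
  have hint : IsIntegral (Qpnr p) x := Algebra.IsIntegral.isIntegral x
  set g := minpoly (Qpnr p) x with hg
  obtain ⟨c, hc⟩ : g.natDegree ∣ Module.finrank (Qpnr p) K := by
    have h := minpoly.degree_dvd (K := Qpnr p) (x := (⟨x, hx⟩ : K))
      (Algebra.IsIntegral.isIntegral _)
    rwa [IntermediateField.minpoly_eq] at h
  have hmonic : g.Monic := minpoly.monic hint
  have hsplit : (g.map (algebraMap (Qpnr p) (PadicAlgCl p))).Splits := IsAlgClosed.splits _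
  have h0 := hsplit.coeff_zero_eq_prod_roots_of_monic (hmonic.map _)
  have hnorm := congrArg norm h0
  have hcoe (y : PadicAlgCl p) : ‖y‖ = normHom y := rfl
  have hall : ∀ b ∈ (g.map (algebraMap (Qpnr p) (PadicAlgCl p))).roots.map normHom,
      b = ‖x‖ := by
    intro b hb
    obtain ⟨r, hr, rfl⟩ := Multiset.mem_map.1 hb
    have hr0 : Polynomial.aeval r g = 0 := by
      have := (Polynomial.mem_roots (hmonic.map _).ne_zero).1 hr
      rwa [Polynomial.IsRoot, Polynomial.eval_map_algebraMap] at this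
    obtain ⟨σ, hσ⟩ := minpoly.exists_algEquiv_of_root hint.isAlgebraic hr0
    rw [← hcoe, ← hσ, norm_algEquiv]
  rw [norm_mul, norm_pow, norm_neg, norm_one, one_pow, one_mul, hcoe (Multiset.prod _),
    map_multiset_prod, Multiset.eq_replicate_of_mem hall, Multiset.prod_replicate,
    Multiset.card_map, ← hsplit.natDegree_eq_card_roots, Polynomial.natDegree_map,
    Polynomial.coeff_map] at hnorm
  obtain ⟨m, hm⟩ := exists_norm_eq_of_mem_Qpnr (g.coeff 0).2 (by
    have := minpoly.coeff_zero_ne_zero hint hx0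
    simpa using this)
  refine ⟨m * c, ?_⟩
  rw [hc, pow_mul, ← hnorm, zpow_mul, ← hm, zpow_natCast]
  rfl

theorem exists_isUniformizer (K : IntermediateField (Qpnr p) (PadicAlgCl p))
    [FiniteDimensional (Qpnr p) K] : ∃ ϖ, IsUniformizer K ϖ := by
  have hp1 : (1 : ℝ) < p := by exact_mod_cast (Fact.out : p.Prime).one_lt
  have hp0 : (p : PadicAlgCl p) ≠ 0 := by exact_mod_cast (Fact.out : p.Prime).ne_zero
  set d := Module.finrank (Qpnr p) K with hd
  have hd0 : d ≠ 0 := Module.finrank_pos.ne'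
  have key (x : PadicAlgCl p) (hxK : x ∈ K) (hx0 : x ≠ 0) (hx1 : ‖x‖ < 1) :
      ∃ m : ℕ, ‖x‖ ^ d = (p : ℝ)⁻¹ ^ m := by
    obtain ⟨m, hm⟩ := norm_pow_finrank_eq K hxK hx0
    have hlt : (p : ℝ) ^ m < (p : ℝ) ^ (0 : ℤ) := by
      rw [← hm, zpow_zero]
      exact pow_lt_one₀ (norm_nonneg _) hx1 hd0
    have hm0 := (zpow_lt_zpow_iff_right₀ hp1).1 hlt
    refine ⟨(-m).toNat, ?_⟩
    rw [hm, inv_pow, ← zpow_natCast, Int.toNat_of_nonneg (by omega), zpow_neg, inv_inv]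
  -- Norms below 1 are indexed by natural numbers `m`, so the least `m` that occurs gives the
  -- largest such norm. The element `p` shows that some `m` occurs.
  have hex : ∃ m : ℕ, ∃ x ∈ K, x ≠ 0 ∧ ‖x‖ < 1 ∧ ‖x‖ ^ d = (p : ℝ)⁻¹ ^ m := by
    obtain ⟨m, hm⟩ := key p (natCast_mem K p) hp0 norm_natCast_prime_lt_one
    exact ⟨m, p, natCast_mem K p, hp0, norm_natCast_prime_lt_one, hm⟩
  classical
  obtain ⟨ϖ, hϖK, hϖ0, hϖ1, hϖ⟩ := Nat.find_spec hex
  refine ⟨ϖ, hϖK, hϖ0, hϖ1, fun x hxK hx1 => ?_⟩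
  rcases eq_or_ne x 0 with rfl | hx0
  · simp
  obtain ⟨m, hm⟩ := key x hxK hx0 hx1
  have hle : Nat.find hex ≤ m := Nat.find_min' hex ⟨x, hxK, hx0, hx1, hm⟩
  refine le_of_pow_le_pow_left₀ hd0 (norm_nonneg _) ?_
  rw [hm, hϖ]
  exact pow_le_pow_of_le_one (by positivity) (inv_le_one_of_one_le₀ hp1.le) hle

theorem IsUniformizer.exists_norm_eq {K : IntermediateField (Qpnr p) (PadicAlgCl p)}
    {ϖ : PadicAlgCl p} (hϖ : IsUniformizer K ϖ) {x : PadicAlgCl p} (hx : x ∈ K) (hx0 : x ≠ 0) :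
    ∃ m : ℤ, ‖x‖ = ‖ϖ‖ ^ m := by
  obtain ⟨hϖK, hϖ0, hϖ1, hmax⟩ := hϖ
  have hpos : 0 < ‖ϖ‖ := norm_pos_iff.2 hϖ0
  -- Multiplication by `ϖ ^ (n + 1)` moves the norm of `x` into the interval `(‖ϖ‖, 1]`, where
  -- maximality of `‖ϖ‖` leaves only the value 1.
  obtain ⟨n, hn1, hn2⟩ := exists_mem_Ioc_zpow (norm_pos_iff.2 hx0) ((one_lt_inv₀ hpos).2 hϖ1)
  refine ⟨-(n + 1), ?_⟩
  set y := x * ϖ ^ (n + 1) with hy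
  have hyK : y ∈ K := mul_mem hx (zpow_mem hϖK _)
  have hny : ‖y‖ = ‖x‖ * ‖ϖ‖ ^ (n + 1) := by rw [hy, norm_mul, norm_zpow]
  have h1 : ‖y‖ ≤ 1 := by
    rw [hny, ← le_div_iff₀ (zpow_pos hpos _), one_div, ← inv_zpow]
    exact hn2
  have h2 : ‖ϖ‖ < ‖y‖ := by
    rw [hny]
    rw [inv_zpow, ← zpow_neg] at hn1
    have := mul_lt_mul_of_pos_right hn1 (zpow_pos hpos (n + 1))
    rwa [← zpow_add₀ hpos.ne', show -n + (n + 1) = 1 by ring, zpow_one] at this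
  have h3 : ‖y‖ = 1 := by
    by_contra hne
    exact absurd (hmax y hyK (lt_of_le_of_ne h1 hne)) (not_le.2 h2)
  rw [zpow_neg]
  exact eq_inv_of_mul_eq_one_left (hny.symm.trans h3)

end ValueGroup

/-! ### Models of a rigid form as matrices, and isomorphism of models as factorisation. -/

section Descent

variable {k Ω : Type*} [Field k] [Field Ω] [Algebra k Ω]

/-- A quartic form whose linear automorphisms are the sign changes of the coordinates. -/
structure IsRigid (F : MvPolynomial (Fin 3) Ω) : Prop where
  homogeneous : F.IsHomogeneous 4
  nonsingular : Nonsingular F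
  subst_diagonal : ∀ (d : Fin 3 → Ω) (u : Ω), (∀ i, d i ^ 2 = u) →
    subst (Matrix.diagonal d) F = u ^ 2 • F
  isSign : ∀ M : GL (Fin 3) Ω, IsIso M F F → IsSign (M : Matrix (Fin 3) (Fin 3) Ω)

theorem Nonsingular.ne_zero {F : MvPolynomial (Fin 3) Ω} (hF : Nonsingular F) : F ≠ 0 := by
  rintro rfl
  obtain ⟨i, hi⟩ := hF (fun _ => 1) (fun h => by simpa using congrFun h 0) (by simp)
  simp at hi

theorem SmoothQuartic.nonsingular_baseChange (Y : SmoothQuartic k Ω) :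
    Nonsingular Y.baseChange := by
  intro v hv h
  rw [SmoothQuartic.baseChange, eval_map, ← aeval_def] at h
  obtain ⟨i, hi⟩ := Y.smooth v hv h
  refine ⟨i, ?_⟩
  rwa [SmoothQuartic.baseChange, pderiv_map, eval_map, ← aeval_def]

theorem map_baseChange (Y : SmoothQuartic k Ω) (σ : Ω ≃ₐ[k] Ω) :
    map (σ : Ω →+* Ω) Y.baseChange = Y.baseChange := by
  have h : (σ : Ω →+* Ω).comp (algebraMap k Ω) = algebraMap k Ω := RingHom.ext σ.commutes
  rw [SmoothQuartic.baseChange, map_map, h]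

theorem subst_diagonal_standardForm [Infinite Ω] (A B C a b c : Ω) {d : Fin 3 → Ω} {u : Ω}
    (hd : ∀ i, d i ^ 2 = u) : subst (Matrix.diagonal d) (standardForm A B C a b c) =
      u ^ 2 • standardForm A B C a b c := by
  refine MvPolynomial.funext fun v => ?_
  have h2 (i : Fin 3) : (Matrix.diagonal d).mulVec v i ^ 2 = u * v i ^ 2 := by
    rw [Matrix.mulVec_diagonal, mul_pow, hd]
  have h4 (i : Fin 3) : (Matrix.diagonal d).mulVec v i ^ 4 = u ^ 2 * v i ^ 4 := by
    rw [show 4 = 2 * 2 from rfl, pow_mul, h2]; ring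
  rw [eval_subst, smul_eval, eval_standardForm, eval_standardForm, h4, h4, h4, h2, h2, h2]
  ring

theorem isSign_smul_diagonal (c : Ω) {d : Fin 3 → Ω} (hd : ∀ i, d i ^ 2 = 1) :
    IsSign (c • Matrix.diagonal d) := by
  obtain ⟨c', s, t, hs, ht, h⟩ := isSign_diagonal hd
  exact ⟨c * c', s, t, hs, ht, by rw [h, smul_smul]⟩

/-- A form that is fixed by the Galois group is defined over the base field. -/
theorem exists_map_eq_of_coeff {G : MvPolynomial (Fin 3) Ω}
    (hG : ∀ m, G.coeff m ∈ (algebraMap k Ω).range) :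
    ∃ g : MvPolynomial (Fin 3) k, map (algebraMap k Ω) g = G := by
  refine mem_range_map_iff_coeffs_subset.2 fun x hx => ?_
  obtain ⟨m, -, rfl⟩ := mem_coeffs_iff.1 hx
  exact hG m

theorem exists_smoothQuartic {F : MvPolynomial (Fin 3) Ω} (hF : IsRigid F)
    {D : Matrix (Fin 3) (Fin 3) Ω} (hD : D.det ≠ 0)
    (hG : ∀ m, (subst D F).coeff m ∈ (algebraMap k Ω).range) :
    ∃ Y : SmoothQuartic k Ω, Y.baseChange = subst D F := by
  obtain ⟨g, hg⟩ := exists_map_eq_of_coeff hG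
  have hns := hF.nonsingular.subst (isUnit_iff_ne_zero.2 hD)
  refine ⟨⟨g, ?_, fun v hv h => ?_⟩, hg⟩
  · refine IsHomogeneous.of_map (algebraMap k Ω).injective ?_
    rw [hg]
    exact isHomogeneous_subst D hF.homogeneous
  · rw [aeval_def, ← eval_map, hg] at h
    obtain ⟨i, hi⟩ := hns v hv h
    refine ⟨i, ?_⟩
    rwa [aeval_def, ← eval_map, ← pderiv_map, hg]

/-- Comparing one nonzero coefficient shows that the scalar `c` already lies in `k`. -/
theorem isomorphic_of_subst_map_eq {Y Y' : SmoothQuartic k Ω} {N : Matrix (Fin 3) (Fin 3) k}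
    (hN : N.det ≠ 0) {c : Ω}
    (h : subst (N.map (algebraMap k Ω)) Y'.baseChange = c • Y.baseChange) :
    Isomorphic Y.form Y'.form := by
  have hne : Y.form ≠ 0 := fun h0 => Y.nonsingular_baseChange.ne_zero (by
    rw [SmoothQuartic.baseChange, h0, map_zero])
  rw [SmoothQuartic.baseChange, ← map_subst] at h
  obtain ⟨m, hm⟩ := MvPolynomial.ne_zero_iff.1 hne
  have hcm := congrArg (coeff m) h
  rw [coeff_map, coeff_smul, SmoothQuartic.baseChange, coeff_map, smul_eq_mul] at hcm
  have hm' : algebraMap k Ω (coeff m Y.form) ≠ 0 := by simpa using hm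
  have hc : c = algebraMap k Ω (coeff m (subst N Y'.form) / coeff m Y.form) := by
    rw [map_div₀, hcm, mul_div_cancel_right₀ _ hm']
  set e := coeff m (subst N Y'.form) / coeff m Y.form
  have hform : subst N Y'.form = e • Y.form := by
    refine map_injective (algebraMap k Ω) (algebraMap k Ω).injective ?_
    rw [h, hc, map_smul_form]
    rfl
  have he : e ≠ 0 := by
    intro he
    rw [he, zero_smul] at hform
    have hns := Y'.nonsingular_baseChange.subst (M := N.map (algebraMap k Ω)) (by
      rw [← RingHom.mapMatrix_apply, ← RingHom.map_det]
      exact isUnit_iff_ne_zero.2 (by simpa using hN))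
    refine hns.ne_zero ?_
    rw [SmoothQuartic.baseChange, ← map_subst, hform, map_zero]
  exact ⟨Matrix.GeneralLinearGroup.mkOfDetNeZero N hN, Units.mk0 e he, hform⟩

/-- The sign change `E` only rescales `F`, so the rational matrix `N` carries one model to the
other. This is the statement that cohomologous cocycles give isomorphic twists. -/
theorem isomorphic_of_factor [Infinite Ω] {F : MvPolynomial (Fin 3) Ω} (hF : IsRigid F)
    {Y Y' : SmoothQuartic k Ω}
    {D D' E : Matrix (Fin 3) (Fin 3) Ω} {N : Matrix (Fin 3) (Fin 3) k} {c : Ω}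
    (hDdet : D.det ≠ 0) (hY : subst D F = c • Y.baseChange) (hY' : Y'.baseChange = subst D' F)
    (hE : IsSign E) (hD : D = E * D' * N.map (algebraMap k Ω)) :
    Isomorphic Y.form Y'.form := by
  have hdet : E.det ≠ 0 ∧ N.det ≠ 0 := by
    rw [hD, Matrix.det_mul, Matrix.det_mul] at hDdet
    refine ⟨left_ne_zero_of_mul (left_ne_zero_of_mul hDdet), fun h => ?_⟩
    refine right_ne_zero_of_mul hDdet ?_
    rw [← RingHom.mapMatrix_apply, ← RingHom.map_det, h, map_zero]
  obtain ⟨μ, s, t, hs, ht, rfl⟩ := hE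
  have hμ : μ ≠ 0 := by
    rintro rfl
    simp at hdet
  have hsub : subst (μ • Matrix.diagonal ![1, s, t]) F = μ ^ 4 • F := by
    rw [subst_smul_matrix hF.homogeneous, hF.subst_diagonal ![1, s, t] 1, one_pow, one_smul]
    intro i
    fin_cases i <;> simp [hs, ht]
  refine isomorphic_of_subst_map_eq (c := (μ ^ 4)⁻¹ * c) hdet.2 ?_
  rw [hY', mul_smul, ← hY, hD, mul_assoc, ← subst_subst, hsub, subst_smul, smul_smul,
    inv_mul_cancel₀ (pow_ne_zero 4 hμ), one_smul, subst_subst]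

/-- Linear maps from the same quartic to a rigid quartic differ by a sign change. -/
theorem exists_isSign_mul_eq {F G : MvPolynomial (Fin 3) Ω} (hF : IsRigid F)
    {D D' : Matrix (Fin 3) (Fin 3) Ω} (hD : D.det ≠ 0) (hD' : D'.det ≠ 0) {c c' : Ω}
    (hc' : c' ≠ 0) (h : subst D F = c • G) (h' : subst D' F = c' • G) :
    ∃ E, IsSign E ∧ D = E * D' := by
  have hc : c ≠ 0 := by
    rintro rfl
    rw [zero_smul] at h
    exact (hF.nonsingular.subst (isUnit_iff_ne_zero.2 hD)).ne_zero h
  let M : GL (Fin 3) Ω := Matrix.GeneralLinearGroup.mkOfDetNeZero D hD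
  let M' : GL (Fin 3) Ω := Matrix.GeneralLinearGroup.mkOfDetNeZero D' hD'
  have hM : IsIso M G F := ⟨Units.mk0 c hc, h⟩
  have hM' : IsIso M' G F := ⟨Units.mk0 c' hc', h'⟩
  refine ⟨_, hF.isSign _ (hM'.symm_form.comp hM), ?_⟩
  exact (congrArg Units.val (inv_mul_cancel_right M M')).symm

/-- The converse of `isomorphic_of_factor`: composing the rational isomorphism with `D'` gives a
second map to `F`, which by rigidity differs from `D` by a sign change. -/
theorem exists_isSign_of_isomorphic {F : MvPolynomial (Fin 3) Ω} (hF : IsRigid F)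
    {Y Y' : SmoothQuartic k Ω} {D D' : Matrix (Fin 3) (Fin 3) Ω} (hD : D.det ≠ 0)
    (hD' : D'.det ≠ 0) (hY : Y.baseChange = subst D F) (hY' : Y'.baseChange = subst D' F)
    (h : Isomorphic Y.form Y'.form) :
    ∃ (E : Matrix (Fin 3) (Fin 3) Ω) (N : Matrix (Fin 3) (Fin 3) k), IsSign E ∧ E.det ≠ 0 ∧
      D' * N.map (algebraMap k Ω) = E * D := by
  obtain ⟨N, c, h⟩ := h
  have h2 := congrArg (map (algebraMap k Ω)) h
  rw [map_subst, map_smul_form] at h2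
  change subst _ Y'.baseChange = _ • Y.baseChange at h2
  rw [hY', subst_subst, hY] at h2
  have hdet : (D' * (N : Matrix (Fin 3) (Fin 3) k).map (algebraMap k Ω)).det ≠ 0 := by
    rw [Matrix.det_mul, ← RingHom.mapMatrix_apply, ← RingHom.map_det]
    refine mul_ne_zero hD' ?_
    have : (N : Matrix (Fin 3) (Fin 3) k).det ≠ 0 :=
      ((Matrix.isUnit_iff_isUnit_det _).1 N.isUnit).ne_zero
    simpa using this
  obtain ⟨E, hE, hE2⟩ := exists_isSign_mul_eq hF hdet hD one_ne_zero h2 (one_smul _ _).symm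
  refine ⟨E, N, hE, ?_, hE2⟩
  rw [hE2, Matrix.det_mul] at hdet
  exact left_ne_zero_of_mul hdet

/-- The action of the Galois group on an isomorphism from a quartic over `k` to a rigid quartic. -/
theorem exists_isSign_galois {F : MvPolynomial (Fin 3) Ω} (hF : IsRigid F)
    {Y : SmoothQuartic k Ω} {D P : Matrix (Fin 3) (Fin 3) Ω} (hD : D.det ≠ 0) (hP : P.det ≠ 0)
    {c : Ω} (hc : c ≠ 0) (hY : subst D F = c • Y.baseChange) (σ : Ω ≃ₐ[k] Ω)
    (hσ : map (σ : Ω →+* Ω) F = subst P F) :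
    ∃ E, IsSign E ∧ P * D.map σ = E * D := by
  have h := congrArg (map (σ : Ω →+* Ω)) hY
  rw [map_subst, map_smul_form, hσ, subst_subst, map_baseChange] at h
  refine exists_isSign_mul_eq hF ?_ hD hc h hY
  have h2 : (D.map (σ : Ω →+* Ω)).det ≠ 0 := by
    rw [← RingHom.mapMatrix_apply, ← RingHom.map_det]
    simpa using hD
  rw [Matrix.det_mul]
  exact mul_ne_zero hP h2

end Descent

/-! ### The Galois action on the roots of a separable cubic over `K`. -/

section CubicRoots

variable {p : ℕ} [Fact p.Prime] {K : IntermediateField (Qpnr p) (PadicAlgCl p)}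

theorem isGalois_padicAlgCl (K : IntermediateField (Qpnr p) (PadicAlgCl p)) :
    IsGalois K (PadicAlgCl p) := by
  have : Algebra.IsAlgebraic (Qpnr p) (PadicAlgCl p) :=
    Algebra.IsAlgebraic.tower_top (K := ℚ_[p]) (Qpnr p)
  have : Algebra.IsAlgebraic K (PadicAlgCl p) :=
    Algebra.IsAlgebraic.tower_top (K := Qpnr p) K
  have : IsAlgClosure K (PadicAlgCl p) := ⟨inferInstance, inferInstance⟩
  have : CharZero K := charZero_of_injective_algebraMap (algebraMap (Qpnr p) K).injective
  exact IsAlgClosure.isGalois K (PadicAlgCl p)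

theorem mem_of_fixed {x : PadicAlgCl p}
    (h : ∀ σ : PadicAlgCl p ≃ₐ[K] PadicAlgCl p, σ x = x) : x ∈ K := by
  have := isGalois_padicAlgCl K
  obtain ⟨y, rfl⟩ := (InfiniteGalois.mem_range_algebraMap_iff_fixed x).2 h
  exact y.2

theorem algEquiv_of_mem {x : PadicAlgCl p} (hx : x ∈ K)
    (σ : PadicAlgCl p ≃ₐ[K] PadicAlgCl p) : σ x = x :=
  σ.commutes ⟨x, hx⟩

theorem mem_of_pow_mem {n : ℕ} (hnp : n.Coprime p) {t : PadicAlgCl p} (ht : ‖t‖ = 1)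
    (h : t ^ n ∈ K) : t ∈ K :=
  mem_of_fixed fun σ => algEquiv_eq_self_of_pow (σ.restrictScalars (Qpnr p)) hnp ht
    (algEquiv_of_mem h σ)

/-- `A`, `B`, `C` are the roots of a separable cubic over `K`. -/
structure CubicRoots (K : IntermediateField (Qpnr p) (PadicAlgCl p)) (A B C : PadicAlgCl p) :
    Prop where
  sum : A + B + C ∈ K
  pair : A * B + A * C + B * C ∈ K
  prod : A * B * C ∈ K
  hAB : A ≠ B
  hAC : A ≠ C
  hBC : B ≠ C

namespace CubicRoots

variable {A B C : PadicAlgCl p}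

theorem rotate (h : CubicRoots K A B C) : CubicRoots K B C A where
  sum := by convert h.sum using 1; ring
  pair := by convert h.pair using 1; ring
  prod := by convert h.prod using 1; ring
  hAB := h.hBC
  hAC := h.hAB.symm
  hBC := h.hAC.symm

theorem swap (h : CubicRoots K A B C) : CubicRoots K A C B where
  sum := by convert h.sum using 1; ring
  pair := by convert h.pair using 1; ring
  prod := by convert h.prod using 1; ring
  hAB := h.hAC
  hAC := h.hAB
  hBC := h.hBC.symm

theorem apply_eq (h : CubicRoots K A B C) (σ : PadicAlgCl p ≃ₐ[K] PadicAlgCl p) :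
    σ A = A ∨ σ A = B ∨ σ A = C := by
  have e1 := algEquiv_of_mem h.sum σ
  have e2 := algEquiv_of_mem h.pair σ
  have e3 := algEquiv_of_mem h.prod σ
  simp only [map_add, map_mul] at e1 e2 e3
  have key : (σ A - A) * ((σ A - B) * (σ A - C)) = 0 := by
    linear_combination (-σ A ^ 2) * (-e1) - σ A * e2 + e3
  rcases mul_eq_zero.1 key with h | h
  · exact Or.inl (sub_eq_zero.1 h)
  · rcases mul_eq_zero.1 h with h | h
    · exact Or.inr (Or.inl (sub_eq_zero.1 h))
    · exact Or.inr (Or.inr (sub_eq_zero.1 h))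

theorem eq_third (h : CubicRoots K A B C) (σ : PadicAlgCl p ≃ₐ[K] PadicAlgCl p)
    {X Y Z : PadicAlgCl p} (hA : σ A = X) (hB : σ B = Y) (hXYZ : X + Y + Z = A + B + C) :
    σ C = Z := by
  have e1 := algEquiv_of_mem h.sum σ
  simp only [map_add, hA, hB] at e1
  linear_combination e1 - hXYZ

/-- An automorphism that fixes `A` fixes `B` and `C` or exchanges them. -/
theorem of_apply_eq (h : CubicRoots K A B C) {σ : PadicAlgCl p ≃ₐ[K] PadicAlgCl p}
    (hA : σ A = A) : (σ B = B ∧ σ C = C) ∨ (σ B = C ∧ σ C = B) := by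
  rcases h.rotate.apply_eq σ with hB | hB | hB
  · exact Or.inl ⟨hB, h.eq_third σ hA hB (by ring)⟩
  · exact Or.inr ⟨hB, h.eq_third σ hA hB (by ring)⟩
  · exact absurd (σ.injective (hA.trans hB.symm)) h.hAB

theorem exists_cube_root_of_unity (p : ℕ) [Fact p.Prime] :
    ∃ ω : PadicAlgCl p, ω ^ 2 + ω + 1 = 0 := by
  obtain ⟨δ, hδ⟩ := IsAlgClosed.exists_pow_nat_eq (-3 : PadicAlgCl p) (n := 2) (by norm_num)
  exact ⟨(-1 + δ) / 2, by field_simp; linear_combination hδ⟩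

/-- The Galois group of a cubic over `K` does not contain transpositions and three-cycles. -/
theorem not_swap_and_cycle (h : CubicRoots K A B C) (hp : 3 < p)
    {σ τ : PadicAlgCl p ≃ₐ[K] PadicAlgCl p} (hσA : σ A = A) (hσB : σ B = C) (hσC : σ C = B)
    (hτA : τ A = B) (hτB : τ B = C) (hτC : τ C = A) : False := by
  have h3 : (3 : ℕ).Coprime p :=
    (Nat.coprime_primes Nat.prime_three Fact.out).2 hp.ne
  obtain ⟨ω, hω⟩ := exists_cube_root_of_unity p
  have hω3 : ω ^ 3 = 1 := by linear_combination (ω - 1) * hω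
  have hfix (g : PadicAlgCl p ≃ₐ[K] PadicAlgCl p) : g ω = ω :=
    algEquiv_root_of_unity (g.restrictScalars (Qpnr p)) (by norm_num) h3 hω3
  have hω0 : ω ≠ 0 := by rintro rfl; simp at hω
  have hω1 : ω ≠ 1 := by
    rintro rfl
    have : (3 : PadicAlgCl p) = 0 := by linear_combination hω
    norm_num at this
  -- The Lagrange resolvents `u` and `v` are exchanged by the transposition, so `u / v` has norm 1.
  -- Its cube is fixed by the three-cycle, so by tameness `u / v` is fixed too; but the three-cycle
  -- multiplies it by `ω`.
  set u := A + ω * B + ω ^ 2 * C with hu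
  set v := A + ω ^ 2 * B + ω * C with hv
  have hσu : σ u = v := by
    simp only [hu, hv, map_add, map_mul, map_pow, hfix, hσA, hσB, hσC]; ring
  have hτu : τ u = ω ^ 2 * u := by
    simp only [hu, map_add, map_mul, map_pow, hfix, hτA, hτB, hτC]
    linear_combination (-B - ω * C) * hω3
  have hτv : τ v = ω * v := by
    simp only [hv, map_add, map_mul, map_pow, hfix, hτA, hτB, hτC]
    linear_combination (-B) * hω3
  have hu0 : u ≠ 0 := by
    intro hu0
    have hv0 : v = 0 := by rw [← hσu, hu0, map_zero]
    have : (ω * (1 - ω)) * (B - C) = 0 := by linear_combination hu0 - hv0 - hu + hv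
    exact mul_ne_zero (mul_ne_zero hω0 (sub_ne_zero.2 hω1.symm)) (sub_ne_zero.2 h.hBC) this
  have hv0 : v ≠ 0 := by
    rw [← hσu]
    simpa using hu0
  have hnorm : ‖u / v‖ = 1 := by
    rw [norm_div, ← hσu, div_eq_one_iff_eq (norm_ne_zero_iff.2 (by rw [hσu]; exact hv0))]
    exact (norm_algEquiv (σ.restrictScalars (Qpnr p)) u).symm
  have hτ : τ (u / v) = ω * (u / v) := by
    rw [map_div₀, hτu, hτv]
    field_simp
  have hfixed : τ (u / v) = u / v := by
    refine algEquiv_eq_self_of_pow (τ.restrictScalars (Qpnr p)) h3 hnorm ?_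
    change τ ((u / v) ^ 3) = _
    rw [map_pow, hτ, mul_pow, hω3, one_mul]
  rw [hfixed] at hτ
  have : (1 - ω) * (u / v) = 0 := by linear_combination hτ
  exact mul_ne_zero (sub_ne_zero.2 hω1.symm) (div_ne_zero hu0 hv0) this

theorem not_swap_and_move (h : CubicRoots K A B C) (hp : 3 < p)
    {σ ρ : PadicAlgCl p ≃ₐ[K] PadicAlgCl p} (hσA : σ A = A) (hσB : σ B = C) (hσC : σ C = B)
    (hρA : ρ A = B) : False := by
  rcases h.rotate.apply_eq ρ with hρB | hρB | hρB
  · exact h.hAB (ρ.injective (hρA.trans hρB.symm))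
  · exact h.not_swap_and_cycle hp hσA hσB hσC hρA hρB (h.eq_third ρ hρA hρB (by ring))
  · have hρC : ρ C = C := h.eq_third ρ hρA hρB (by ring)
    -- Here `ρ` is the transposition of `A` and `B`; two different transpositions compose to a
    -- three-cycle.
    exact h.not_swap_and_cycle hp hσA hσB hσC (τ := σ.trans ρ)
      (by simp [hσA, hρA]) (by simp [hσB, hρC]) (by simp [hσC, hρB])

/-- If no root is rational, the stabiliser of a root acts trivially. -/
theorem apply_eq_of_irrational (h : CubicRoots K A B C) (hp : 3 < p) (hA : A ∉ K)
    {σ : PadicAlgCl p ≃ₐ[K] PadicAlgCl p} (hσA : σ A = A) : σ B = B ∧ σ C = C := by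
  refine (h.of_apply_eq hσA).resolve_right fun ⟨hσB, hσC⟩ => ?_
  obtain ⟨ρ, hρ⟩ : ∃ ρ : PadicAlgCl p ≃ₐ[K] PadicAlgCl p, ρ A ≠ A := by
    by_contra! hcon
    exact hA (mem_of_fixed hcon)
  rcases h.apply_eq ρ with hρA | hρA | hρA
  · exact hρ hρA
  · exact h.not_swap_and_move hp hσA hσB hσC hρA
  · exact h.swap.not_swap_and_move hp hσA hσC hσB hρA

/-- The alternative is that `ρ` exchanges `A` and `B`. It would then fix the irrational root `C`
without fixing the others, which `apply_eq_of_irrational` forbids. -/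
theorem exists_cycle_of_apply_eq (h : CubicRoots K A B C) (hp : 3 < p) (hC : C ∉ K)
    {ρ : PadicAlgCl p ≃ₐ[K] PadicAlgCl p} (hρA : ρ A = B) : ρ B = C ∧ ρ C = A := by
  rcases h.rotate.apply_eq ρ with hρB | hρB | hρB
  · exact absurd (ρ.injective (hρA.trans hρB.symm)) h.hAB
  · exact ⟨hρB, h.eq_third ρ hρA hρB (by ring)⟩
  · have hρC : ρ C = C := h.eq_third ρ hρA hρB (by ring)
    have := (h.rotate.rotate.apply_eq_of_irrational hp hC hρC).1
    exact absurd (hρA.symm.trans this) h.hAB.symm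

/-- If no root is rational, the Galois group acts through the cyclic group of order three. -/
theorem exists_cycle (h : CubicRoots K A B C) (hp : 3 < p) (hA : A ∉ K) (hB : B ∉ K)
    (hC : C ∉ K) : ∃ τ : PadicAlgCl p ≃ₐ[K] PadicAlgCl p, τ A = B ∧ τ B = C ∧ τ C = A := by
  obtain ⟨ρ, hρ⟩ : ∃ ρ : PadicAlgCl p ≃ₐ[K] PadicAlgCl p, ρ A ≠ A := by
    by_contra! hcon
    exact hA (mem_of_fixed hcon)
  rcases h.apply_eq ρ with hρA | hρA | hρA
  · exact absurd hρA hρ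
  · obtain ⟨h1, h2⟩ := h.exists_cycle_of_apply_eq hp hC hρA
    exact ⟨ρ, hρA, h1, h2⟩
  · obtain ⟨h1, h2⟩ := h.swap.exists_cycle_of_apply_eq hp hB hρA
    refine ⟨ρ.symm, ?_, ?_, ?_⟩ <;> rw [AlgEquiv.symm_apply_eq] <;> simp [hρA, h1, h2]

/-- An element fixed by a three-cycle and by the automorphisms fixing the roots is rational. -/
theorem mem_of_cycle (h : CubicRoots K A B C) (hp : 3 < p) (hA : A ∉ K)
    {τ : PadicAlgCl p ≃ₐ[K] PadicAlgCl p} (hτA : τ A = B) (hτB : τ B = C)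
    {x : PadicAlgCl p}
    (hx : ∀ g : PadicAlgCl p ≃ₐ[K] PadicAlgCl p, g A = A → g B = B → g C = C → g x = x)
    (hτ : τ x = x) : x ∈ K := by
  have hstab (g : PadicAlgCl p ≃ₐ[K] PadicAlgCl p) (hg : g A = A) : g x = x :=
    hx g hg (h.apply_eq_of_irrational hp hA hg).1 (h.apply_eq_of_irrational hp hA hg).2
  have hτ' : τ.symm x = x := by rw [AlgEquiv.symm_apply_eq, hτ]
  refine mem_of_fixed fun g => ?_
  rcases h.apply_eq g with hg | hg | hg
  · exact hstab g hg
  · have := hstab (g.trans τ.symm) (by simp [hg, ← hτA])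
    rw [AlgEquiv.trans_apply, AlgEquiv.symm_apply_eq, hτ] at this
    exact this
  · have := hstab ((g.trans τ.symm).trans τ.symm) (by simp [hg, ← hτA, ← hτB])
    rw [AlgEquiv.trans_apply, AlgEquiv.trans_apply, AlgEquiv.symm_apply_eq, hτ,
      AlgEquiv.symm_apply_eq, hτ] at this
    exact this

theorem mem_of_rational (h : CubicRoots K A B C) (hA : A ∈ K) (hB : B ∈ K) : C ∈ K := by
  have := K.sub_mem (K.sub_mem h.sum hA) hB
  convert this using 1
  ring

/-- If exactly one root is rational, some automorphism exchanges the other two. -/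
theorem exists_swap (h : CubicRoots K A B C) (hA : A ∈ K) (hB : B ∉ K) :
    ∃ τ : PadicAlgCl p ≃ₐ[K] PadicAlgCl p, τ B = C ∧ τ C = B := by
  obtain ⟨ρ, hρ⟩ : ∃ ρ : PadicAlgCl p ≃ₐ[K] PadicAlgCl p, ρ B ≠ B := by
    by_contra! hcon
    exact hB (mem_of_fixed hcon)
  rcases h.of_apply_eq (algEquiv_of_mem hA ρ) with h1 | h1
  · exact absurd h1.1 hρ
  · exact ⟨ρ, h1⟩

theorem mem_of_swap (h : CubicRoots K A B C) (hA : A ∈ K)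
    {τ : PadicAlgCl p ≃ₐ[K] PadicAlgCl p} (hτB : τ B = C)
    {x : PadicAlgCl p}
    (hx : ∀ g : PadicAlgCl p ≃ₐ[K] PadicAlgCl p, g A = A → g B = B → g C = C → g x = x)
    (hτ : τ x = x) : x ∈ K := by
  refine mem_of_fixed fun g => ?_
  have hgA := algEquiv_of_mem hA
  rcases h.of_apply_eq (hgA g) with ⟨h1, h2⟩ | ⟨h1, h2⟩
  · exact hx g (hgA g) h1 h2
  · have hs : (g.trans τ.symm) B = B := by simp [h1, ← hτB]
    rcases h.of_apply_eq (hgA (g.trans τ.symm)) with h3 | h3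
    · have := hx (g.trans τ.symm) (hgA _) h3.1 h3.2
      rw [AlgEquiv.trans_apply, AlgEquiv.symm_apply_eq, hτ] at this
      exact this
    · exact absurd (hs.symm.trans h3.1) h.hBC

/-! ### The splitting field -/

theorem adjoin_eq_of_mem (hB : B ∈ IntermediateField.adjoin K {A})
    (hC : C ∈ IntermediateField.adjoin K {A}) :
    IntermediateField.adjoin K {A, B, C} = IntermediateField.adjoin K {A} := by
  refine le_antisymm (IntermediateField.adjoin_le_iff.2 ?_)
    (IntermediateField.adjoin.mono _ _ _ (by simp))
  rintro x (rfl | rfl | rfl)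
  exacts [IntermediateField.mem_adjoin_simple_self K x, hB, hC]

/-- The Galois correspondence for `K(A)`; it reduces the splitting field to a field generated by one
root. -/
theorem mem_adjoin_of_fixed {x : PadicAlgCl p}
    (h : ∀ g : PadicAlgCl p ≃ₐ[K] PadicAlgCl p, g A = A → g x = x) :
    x ∈ IntermediateField.adjoin K {A} := by
  have := isGalois_padicAlgCl K
  rw [← InfiniteGalois.fixedField_fixingSubgroup (IntermediateField.adjoin K {A}),
    IntermediateField.mem_fixedField_iff]
  intro g hg
  refine h g ?_
  exact (IntermediateField.mem_fixingSubgroup_iff _ _).1 hg A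
    (IntermediateField.mem_adjoin_simple_self K A)

theorem finrank_adjoin_le {x : PadicAlgCl p} {g : Polynomial K} (hg : g.Monic)
    (hx : Polynomial.aeval x g = 0) :
    0 < Module.finrank K (IntermediateField.adjoin K {x}) ∧
      Module.finrank K (IntermediateField.adjoin K {x}) ≤ g.natDegree := by
  have hint : IsIntegral K x := ⟨g, hg, hx⟩
  have := IntermediateField.adjoin.finiteDimensional hint
  refine ⟨Module.finrank_pos, ?_⟩
  rw [IntermediateField.adjoin.finrank hint]
  exact Polynomial.natDegree_le_natDegree (minpoly.min K x hg hx)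

theorem finrank_le_two (h : CubicRoots K A B C) (hA : A ∈ K) :
    0 < Module.finrank K (IntermediateField.adjoin K {A, B, C}) ∧
      Module.finrank K (IntermediateField.adjoin K {A, B, C}) ≤ 2 := by
  have hs : B + C ∈ K := by
    convert K.sub_mem h.sum hA using 1; ring
  have hq : B * C ∈ K := by
    convert K.sub_mem h.pair (K.mul_mem hA hs) using 1; ring
  have hset : ({A, B, C} : Set (PadicAlgCl p)) = {B, C, A} := by
    ext x; simp only [Set.mem_insert_iff, Set.mem_singleton_iff]; tauto
  have hC : C ∈ IntermediateField.adjoin K {B} :=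
    mem_adjoin_of_fixed fun g hg => by
      have := algEquiv_of_mem hs g
      rw [map_add, hg] at this
      exact add_left_cancel this
  have hA' : A ∈ IntermediateField.adjoin K {B} :=
    mem_adjoin_of_fixed fun g _ => algEquiv_of_mem hA g
  rw [hset, adjoin_eq_of_mem hC hA']
  let g : Polynomial K := Polynomial.X ^ 2 - Polynomial.C (⟨B + C, hs⟩ : K) * Polynomial.X +
    Polynomial.C (⟨B * C, hq⟩ : K)
  have hdeg : g.natDegree = 2 := by simp only [g]; compute_degree!
  have hmonic : g.Monic := by simp only [g]; monicity!
  rw [← hdeg]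
  refine finrank_adjoin_le hmonic ?_
  simp only [g, map_add, map_sub, map_mul, map_pow, Polynomial.aeval_X, Polynomial.aeval_C]
  change B ^ 2 - (B + C) * B + B * C = 0
  ring

/-- Without a rational root the stabiliser of `A` fixes `B` and `C`, so `A` alone generates the
splitting field. This is where degree 6 is excluded. -/
theorem finrank_le_three (h : CubicRoots K A B C) (hp : 3 < p) :
    0 < Module.finrank K (IntermediateField.adjoin K {A, B, C}) ∧
      Module.finrank K (IntermediateField.adjoin K {A, B, C}) ≤ 3 := by
  by_cases hA : A ∈ K
  · exact ⟨(h.finrank_le_two hA).1, (h.finrank_le_two hA).2.trans (by norm_num)⟩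
  rw [adjoin_eq_of_mem (mem_adjoin_of_fixed fun g hg => (h.apply_eq_of_irrational hp hA hg).1)
    (mem_adjoin_of_fixed fun g hg => (h.apply_eq_of_irrational hp hA hg).2)]
  let g : Polynomial K := Polynomial.X ^ 3 - Polynomial.C (⟨_, h.sum⟩ : K) * Polynomial.X ^ 2 +
    Polynomial.C (⟨_, h.pair⟩ : K) * Polynomial.X - Polynomial.C (⟨_, h.prod⟩ : K)
  have hdeg : g.natDegree = 3 := by simp only [g]; compute_degree!
  have hmonic : g.Monic := by simp only [g]; monicity!
  rw [← hdeg]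
  refine finrank_adjoin_le hmonic ?_
  simp only [g, map_add, map_sub, map_mul, map_pow, Polynomial.aeval_X, Polynomial.aeval_C]
  change A ^ 3 - (A + B + C) * A ^ 2 + (A * B + A * C + B * C) * A - A * B * C = 0
  ring

theorem finrank_eq_one_iff (K : IntermediateField (Qpnr p) (PadicAlgCl p))
    (A B C : PadicAlgCl p) :
    Module.finrank K (IntermediateField.adjoin K {A, B, C}) = 1 ↔ A ∈ K ∧ B ∈ K ∧ C ∈ K := by
  have hbot (x : PadicAlgCl p) : x ∈ (⊥ : IntermediateField K (PadicAlgCl p)) ↔ x ∈ K := by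
    rw [IntermediateField.mem_bot]
    exact ⟨fun ⟨y, hy⟩ => hy ▸ y.2, fun hx => ⟨⟨x, hx⟩, rfl⟩⟩
  rw [IntermediateField.finrank_adjoin_eq_one_iff, Set.insert_subset_iff, Set.insert_subset_iff,
    Set.singleton_subset_iff]
  simp only [SetLike.mem_coe, hbot]

theorem irrational_of_finrank_eq_three (h : CubicRoots K A B C)
    (hd : Module.finrank K (IntermediateField.adjoin K {A, B, C}) = 3) :
    A ∉ K ∧ B ∉ K ∧ C ∉ K := by
  have key {X Y Z : PadicAlgCl p} (hX : CubicRoots K X Y Z)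
      (hset : ({A, B, C} : Set (PadicAlgCl p)) = {X, Y, Z}) : X ∉ K := by
    intro hK
    rw [hset] at hd
    have := (hX.finrank_le_two hK).2
    omega
  refine ⟨key h rfl, key h.rotate ?_, key h.rotate.rotate ?_⟩ <;>
  · ext x; simp only [Set.mem_insert_iff, Set.mem_singleton_iff]; tauto

end CubicRoots

end CubicRoots

/-! ### Square classes of `K`, and the twists when all roots are rational. -/

section Factor

variable {p : ℕ} [Fact p.Prime] {K : IntermediateField (Qpnr p) (PadicAlgCl p)}

theorem IsUniformizer.not_mem_of_sq_norm_eq {u x : PadicAlgCl p} (hu : IsUniformizer K u)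
    (hx : ‖x‖ ^ 2 = ‖u‖) : x ∉ K := by
  intro hxK
  have hpos : 0 < ‖u‖ := norm_pos_iff.2 hu.2.1
  have hx0 : x ≠ 0 := by
    rintro rfl
    rw [norm_zero, zero_pow two_ne_zero] at hx
    exact hpos.ne hx
  obtain ⟨m, hm⟩ := hu.exists_norm_eq hxK hx0
  rw [hm, ← zpow_natCast, ← zpow_mul] at hx
  have h1 : ‖u‖ ^ (m * (2 : ℕ)) = ‖u‖ ^ (1 : ℤ) := by rw [hx, zpow_one]
  have := zpow_right_injective₀ hpos hu.2.2.1.ne h1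
  push_cast at this
  omega

/-- The square classes of `K` are those of `1` and of a uniformizer. -/
theorem IsUniformizer.mem_or_mul_mem {u ϖ x : PadicAlgCl p} (hp : 3 < p) (hu : IsUniformizer K u)
    (hϖK : ϖ ^ 2 ∈ K) (hϖ : ‖ϖ‖ ^ 2 = ‖u‖) (hx : x ^ 2 ∈ K) : x ∈ K ∨ x * ϖ ∈ K := by
  rcases eq_or_ne x 0 with rfl | hx0
  · exact Or.inl K.zero_mem
  have hpos : 0 < ‖u‖ := norm_pos_iff.2 hu.2.1
  have hϖ0 : ϖ ≠ 0 := by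
    rintro rfl
    rw [norm_zero, zero_pow two_ne_zero] at hϖ
    exact hpos.ne hϖ
  obtain ⟨m, hm⟩ := hu.exists_norm_eq hx (pow_ne_zero 2 hx0)
  have hcop : (2 : ℕ).Coprime p := (Nat.coprime_primes Nat.prime_two Fact.out).2 (by omega)
  have hxm : ‖x‖ = ‖ϖ‖ ^ m := by
    rw [← hϖ, norm_pow, ← zpow_natCast, ← zpow_natCast, ← zpow_mul, mul_comm, zpow_mul] at hm
    rw [zpow_natCast, zpow_natCast] at hm
    exact (pow_left_inj₀ (norm_nonneg _) (zpow_nonneg (norm_nonneg _) _) two_ne_zero).1 hm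
  have hsq (l : ℤ) : ϖ ^ (2 * l) ∈ K := by
    rw [zpow_mul]
    exact zpow_mem (by exact_mod_cast hϖK) l
  -- The quotient has norm 1 and its square lies in `K`, so tameness applies; the parity of `m` then
  -- decides between the two alternatives.
  have ht : x / ϖ ^ m ∈ K := by
    refine mem_of_pow_mem hcop ?_ ?_
    · rw [norm_div, norm_zpow, hxm, div_self (zpow_ne_zero _ (norm_ne_zero_iff.2 hϖ0))]
    · rw [div_pow]
      refine K.div_mem hx ?_
      rw [← zpow_natCast, ← zpow_mul, mul_comm]
      exact hsq m
  have hxt : x = x / ϖ ^ m * ϖ ^ m := (div_mul_cancel₀ x (zpow_ne_zero m hϖ0)).symm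
  rcases Int.even_or_odd' m with ⟨l, hl | hl⟩
  · left
    rw [hxt]
    exact K.mul_mem ht (by rw [hl]; exact hsq l)
  · right
    have : x * ϖ = x / ϖ ^ m * ϖ ^ (2 * (l + 1)) := by
      rw [show 2 * (l + 1) = m + 1 by omega, zpow_add_one₀ hϖ0, ← mul_assoc, ← hxt]
    rw [this]
    exact K.mul_mem ht (hsq _)

theorem exists_map_eq_of_mem {M : Matrix (Fin 3) (Fin 3) (PadicAlgCl p)}
    (hM : ∀ i j, M i j ∈ K) :
    ∃ N : Matrix (Fin 3) (Fin 3) K, N.map (algebraMap K (PadicAlgCl p)) = M :=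
  ⟨fun i j => ⟨M i j, hM i j⟩, rfl⟩

theorem exists_ne_zero_of_det_ne_zero {k : Type*} [Field k] {D : Matrix (Fin 3) (Fin 3) k}
    (hD : D.det ≠ 0) (i : Fin 3) : ∃ j, D i j ≠ 0 := by
  by_contra! h
  exact hD (Matrix.det_eq_zero_of_row_eq_zero i h)

theorem IsSign.exists_mul_apply {k : Type*} [Field k] {E : Matrix (Fin 3) (Fin 3) k}
    (hE : IsSign E) : ∃ (c : k) (e : Fin 3 → k), e 0 = 1 ∧ (∀ i, e i ^ 2 = 1) ∧
      E = c • Matrix.diagonal e ∧ ∀ D : Matrix (Fin 3) (Fin 3) k, ∀ i j,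
        (E * D) i j = c * (e i * D i j) := by
  obtain ⟨c, s, t, hs, ht, rfl⟩ := hE
  refine ⟨c, ![1, s, t], rfl, fun i => ?_, rfl, fun D i j => ?_⟩
  · fin_cases i <;> simp [hs, ht]
  · rw [Matrix.smul_mul, Matrix.smul_apply, Matrix.diagonal_mul, smul_eq_mul]

variable {F : MvPolynomial (Fin 3) (PadicAlgCl p)}

/-- The criterion used to show that a representative is defined over `K`. The common square `u` may
be `-1`, since `F` is only multiplied by `u²`; the second quadratic twist needs this. -/
theorem map_subst_eq_of_diagonal (hF : IsRigid F) {D P : Matrix (Fin 3) (Fin 3) (PadicAlgCl p)}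
    {σ : PadicAlgCl p ≃ₐ[K] PadicAlgCl p}
    (hσ : map (σ : PadicAlgCl p →+* PadicAlgCl p) F = subst P F) {d : Fin 3 → PadicAlgCl p}
    {u : PadicAlgCl p} (hd : ∀ i, d i ^ 2 = u) (hu : u ^ 2 = 1)
    (hPD : P * D.map σ = Matrix.diagonal d * D) (m : Fin 3 →₀ ℕ) :
    σ ((subst D F).coeff m) = (subst D F).coeff m := by
  have h : map (σ : PadicAlgCl p →+* PadicAlgCl p) (subst D F) = subst D F := by
    rw [map_subst, hσ, subst_subst]
    change subst (P * D.map σ) F = _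
    rw [hPD, ← subst_subst, hF.subst_diagonal d u hd, hu, one_smul]
  have h2 := congrArg (coeff m) h
  rwa [coeff_map] at h2

/-- Normal form of the Galois action on a matrix whose first row has been normalised. -/
theorem exists_signs (hF : IsRigid F) {Y : SmoothQuartic K (PadicAlgCl p)}
    {D P : Matrix (Fin 3) (Fin 3) (PadicAlgCl p)} (hD : D.det ≠ 0) (hP : P.det ≠ 0)
    {c : PadicAlgCl p} (hc : c ≠ 0) (hY : subst D F = c • Y.baseChange) {j₀ : Fin 3}
    (hj₀ : D 0 j₀ = 1) (σ : PadicAlgCl p ≃ₐ[K] PadicAlgCl p)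
    (hσ : map (σ : PadicAlgCl p →+* PadicAlgCl p) F = subst P F)
    (hrow : ∀ (M : Matrix (Fin 3) (Fin 3) (PadicAlgCl p)) j, (P * M) 0 j = M 0 j) :
    ∃ e : Fin 3 → PadicAlgCl p, e 0 = 1 ∧ (∀ i, e i ^ 2 = 1) ∧
      ∀ i j, (P * D.map σ) i j = e i * D i j := by
  obtain ⟨E, hE, hPD⟩ := exists_isSign_galois hF hD hP hc hY σ hσ
  obtain ⟨μ, e, he0, he, -, hmul⟩ := hE.exists_mul_apply
  have hμ : μ = 1 := by
    have := congrFun₂ hPD 0 j₀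
    rw [hrow, hmul, Matrix.map_apply, hj₀, map_one, he0, mul_one, mul_one] at this
    exact this.symm
  refine ⟨e, he0, he, fun i j => ?_⟩
  rw [hPD, hmul, hμ, one_mul]

/-- An entry 1 in the first row removes the scalar ambiguity of the cocycle in `exists_signs`. -/
theorem exists_normalization (hF : IsRigid F) {Y : SmoothQuartic K (PadicAlgCl p)}
    {D : Matrix (Fin 3) (Fin 3) (PadicAlgCl p)} (hD : D.det ≠ 0)
    {c : PadicAlgCl p} (hc : c ≠ 0) (hY : subst D F = c • Y.baseChange) :
    ∃ (r c' : PadicAlgCl p) (D' : Matrix (Fin 3) (Fin 3) (PadicAlgCl p)) (j₀ : Fin 3),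
      D = r • D' ∧ D'.det ≠ 0 ∧ c' ≠ 0 ∧ subst D' F = c' • Y.baseChange ∧ D' 0 j₀ = 1 := by
  obtain ⟨j₀, hj₀⟩ := exists_ne_zero_of_det_ne_zero hD 0
  refine ⟨D 0 j₀, (D 0 j₀)⁻¹ ^ 4 * c, (D 0 j₀)⁻¹ • D, j₀, ?_, ?_, ?_, ?_, ?_⟩
  · rw [smul_smul, mul_inv_cancel₀ hj₀, one_smul]
  · rw [Matrix.det_smul]
    exact mul_ne_zero (pow_ne_zero _ (inv_ne_zero hj₀)) hD
  · exact mul_ne_zero (pow_ne_zero _ (inv_ne_zero hj₀)) hc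
  · rw [subst_smul_matrix hF.homogeneous, hY, smul_smul]
  · rw [Matrix.smul_apply, smul_eq_mul, inv_mul_cancel₀ hj₀]

theorem IsSign.smul {k : Type*} [Field k] {E : Matrix (Fin 3) (Fin 3) k} (hE : IsSign E) (r : k) :
    IsSign (r • E) := by
  obtain ⟨c, s, t, hs, ht, rfl⟩ := hE
  exact ⟨r * c, s, t, hs, ht, smul_smul _ _ _⟩

/-- The diagonal matrices that represent the twists in the split case. -/
noncomputable def splitTwist (ϖ : PadicAlgCl p) (i : Fin 4) : Fin 3 → PadicAlgCl p :=
  ![![1, 1, 1], ![ϖ, 1, 1], ![1, ϖ, 1], ![1, 1, ϖ]] i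

/-- Galois acts on each row of the normalised matrix by a sign. Ratios within a row and squares of
entries are therefore rational, so each row lies in `K` or in `ϖ K`; the first row lies in `K` by
the normalisation. -/
theorem exists_factor_split (hp : 3 < p) (hF : IsRigid F)
    (hfix : ∀ σ : PadicAlgCl p ≃ₐ[K] PadicAlgCl p,
      map (σ : PadicAlgCl p →+* PadicAlgCl p) F = F)
    {u ϖ : PadicAlgCl p} (hu : IsUniformizer K u) (hϖK : ϖ ^ 2 ∈ K) (hϖ : ‖ϖ‖ ^ 2 = ‖u‖)
    {Y : SmoothQuartic K (PadicAlgCl p)} {D : Matrix (Fin 3) (Fin 3) (PadicAlgCl p)}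
    (hD : D.det ≠ 0) {c : PadicAlgCl p} (hc : c ≠ 0) (hY : subst D F = c • Y.baseChange) :
    ∃ (i : Fin 4) (E : Matrix (Fin 3) (Fin 3) (PadicAlgCl p)) (N : Matrix (Fin 3) (Fin 3) K),
      IsSign E ∧ D = E * Matrix.diagonal (splitTwist ϖ i) *
        N.map (algebraMap K (PadicAlgCl p)) := by
  have hϖ0 : ϖ ≠ 0 := by
    rintro rfl
    rw [norm_zero, zero_pow two_ne_zero] at hϖ
    exact hu.2.1 (norm_eq_zero.1 hϖ.symm)
  obtain ⟨r, c', D', j₀, rfl, hD', hc', hY', hj₀⟩ := exists_normalization hF hD hc hY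
  suffices h : ∃ (i : Fin 4) (μ : PadicAlgCl p), μ ≠ 0 ∧
      ∀ l j, D' l j / (μ * splitTwist ϖ i l) ∈ K by
    obtain ⟨i, μ, hμ, hmem⟩ := h
    obtain ⟨N, hN⟩ := exists_map_eq_of_mem
      (M := fun l j => D' l j / (μ * splitTwist ϖ i l)) hmem
    have hne (l : Fin 3) : splitTwist ϖ i l ≠ 0 := by
      fin_cases i <;> fin_cases l <;> simp [splitTwist, hϖ0]
    refine ⟨i, r • (μ • Matrix.diagonal fun _ => 1), N,
      (isSign_smul_diagonal μ fun _ => one_pow 2).smul r, ?_⟩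
    rw [Matrix.smul_mul, Matrix.smul_mul]
    congr 1
    ext l j
    rw [Matrix.diagonal_one, Matrix.smul_mul, one_mul, Matrix.smul_mul, Matrix.smul_apply,
      Matrix.diagonal_mul, hN, smul_eq_mul, ← mul_assoc, mul_div_cancel₀]
    exact mul_ne_zero hμ (hne l)
  have hact (σ : PadicAlgCl p ≃ₐ[K] PadicAlgCl p) : ∃ e : Fin 3 → PadicAlgCl p, e 0 = 1 ∧
      (∀ i, e i ^ 2 = 1) ∧ ∀ i j, σ (D' i j) = e i * D' i j := by
    obtain ⟨e, he0, he, h⟩ := exists_signs hF hD' (P := 1) (by simp) hc' hY' hj₀ σ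
      (by rw [hfix, subst_one]) (by simp)
    exact ⟨e, he0, he, by simpa using h⟩
  have h0 (j : Fin 3) : D' 0 j ∈ K := by
    refine mem_of_fixed fun σ => ?_
    obtain ⟨e, he0, -, h⟩ := hact σ
    rw [h, he0, one_mul]
  have hrow (l : Fin 3) : (∀ j, D' l j ∈ K) ∨ ∀ j, D' l j / ϖ ∈ K := by
    obtain ⟨j₁, hj₁⟩ := exists_ne_zero_of_det_ne_zero hD' l
    have hquot (j : Fin 3) : D' l j / D' l j₁ ∈ K := by
      refine mem_of_fixed fun σ => ?_
      obtain ⟨e, -, he, h⟩ := hact σ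
      have hne : e l ≠ 0 := by
        intro h0
        simpa [h0] using he l
      rw [map_div₀, h, h, mul_div_mul_left _ _ hne]
    have hsq : D' l j₁ ^ 2 ∈ K := by
      refine mem_of_fixed fun σ => ?_
      obtain ⟨e, -, he, h⟩ := hact σ
      rw [map_pow, h, mul_pow, he, one_mul]
    rcases hu.mem_or_mul_mem hp hϖK hϖ hsq with hmem | hmem
    · refine Or.inl fun j => ?_
      have := K.mul_mem (hquot j) hmem
      rwa [div_mul_cancel₀ _ hj₁] at this
    · refine Or.inr fun j => ?_
      have := K.div_mem (K.mul_mem (hquot j) hmem) hϖK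
      convert this using 1
      field_simp
  have key (i : Fin 4) (μ : PadicAlgCl p) (hμ : μ ≠ 0)
      (h0 : ∀ j, D' 0 j / (μ * splitTwist ϖ i 0) ∈ K)
      (h1 : ∀ j, D' 1 j / (μ * splitTwist ϖ i 1) ∈ K)
      (h2 : ∀ j, D' 2 j / (μ * splitTwist ϖ i 2) ∈ K) :
      ∃ (i : Fin 4) (μ : PadicAlgCl p), μ ≠ 0 ∧ ∀ l j, D' l j / (μ * splitTwist ϖ i l) ∈ K := by
    refine ⟨i, μ, hμ, fun l j => ?_⟩
    fin_cases l
    exacts [h0 j, h1 j, h2 j]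
  rcases hrow 1 with h1 | h1 <;> rcases hrow 2 with h2 | h2
  · exact key 0 1 one_ne_zero (by simpa [splitTwist] using h0) (by simpa [splitTwist] using h1)
      (by simpa [splitTwist] using h2)
  · exact key 3 1 one_ne_zero (by simpa [splitTwist] using h0) (by simpa [splitTwist] using h1)
      (by simpa [splitTwist] using h2)
  · exact key 2 1 one_ne_zero (by simpa [splitTwist] using h0) (by simpa [splitTwist] using h1)
      (by simpa [splitTwist] using h2)
  -- The pattern `(1, ϖ, ϖ)` is `ϖ` times `(ϖ, 1, 1)` up to the factor `ϖ² ∈ K` in the first row.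
  · refine key 1 ϖ hϖ0 (fun j => ?_) (by simpa [splitTwist] using h1)
      (by simpa [splitTwist] using h2)
    have := K.div_mem (h0 j) hϖK
    rw [pow_two] at this
    simpa [splitTwist] using this

/-- The products of corresponding diagonal entries of the two representatives all lie in `K` after
multiplication by one scalar `c`. For different representatives both `1` and `ϖ` occur among these
products, which would give `ϖ ∈ K`. -/
theorem eq_of_isSign_split {u ϖ : PadicAlgCl p} (hu : IsUniformizer K u) (hϖK : ϖ ^ 2 ∈ K)
    (hϖ : ‖ϖ‖ ^ 2 = ‖u‖) {i j : Fin 4} {E : Matrix (Fin 3) (Fin 3) (PadicAlgCl p)}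
    {N : Matrix (Fin 3) (Fin 3) K} (hE : IsSign E) (hE0 : E.det ≠ 0)
    (h : Matrix.diagonal (splitTwist ϖ j) * N.map (algebraMap K (PadicAlgCl p)) =
      E * Matrix.diagonal (splitTwist ϖ i)) : i = j := by
  have hϖ' : ϖ ∉ K := hu.not_mem_of_sq_norm_eq hϖ
  have hϖ0 : ϖ ≠ 0 := by
    rintro rfl
    exact hϖ' K.zero_mem
  obtain ⟨c, e, he0, he, hEe, hmul⟩ := hE.exists_mul_apply
  have hc : c ≠ 0 := by
    rintro rfl
    rw [hEe, zero_smul] at hE0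
    simp at hE0
  have hentry (l : Fin 3) : splitTwist ϖ j l * (N l l : PadicAlgCl p) =
      c * (e l * splitTwist ϖ i l) := by
    have := congrFun₂ h l l
    rw [Matrix.diagonal_mul, hmul, Matrix.diagonal_apply_eq] at this
    exact this
  have heK (l : Fin 3) : e l ∈ K := by
    rcases sq_eq_sq_iff_eq_or_eq_neg.1 ((he l).trans (one_pow 2).symm) with h | h
    · rw [h]; exact K.one_mem
    · rw [h]; exact K.neg_mem K.one_mem
  have hsq (l : Fin 3) : splitTwist ϖ j l ^ 2 ∈ K := by
    fin_cases j <;> fin_cases l <;> simp [splitTwist, hϖK, K.one_mem]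
  have hprod (l : Fin 3) : c * (splitTwist ϖ i l * splitTwist ϖ j l) ∈ K := by
    have := K.mul_mem (heK l) (K.mul_mem (hsq l) (N l l).2)
    convert this using 1
    have h1 : e l * (splitTwist ϖ j l ^ 2 * (N l l : PadicAlgCl p)) =
      e l * splitTwist ϖ j l * (splitTwist ϖ j l * (N l l : PadicAlgCl p)) := by ring
    rw [h1, hentry]
    linear_combination (-c * splitTwist ϖ i l * splitTwist ϖ j l) * he l
  have hcontra (l m : Fin 3) (hl : splitTwist ϖ i l * splitTwist ϖ j l = ϖ)
      (hm : splitTwist ϖ i m * splitTwist ϖ j m = 1) : False := by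
    have h1 := hprod l
    have h2 := hprod m
    rw [hl] at h1
    rw [hm, mul_one] at h2
    have := K.div_mem h1 h2
    rw [mul_div_cancel_left₀ _ hc] at this
    exact hϖ' this
  fin_cases i <;> fin_cases j <;> first
    | rfl
    | (exfalso; refine hcontra 0 1 ?_ ?_ <;> (simp [splitTwist]; done))
    | (exfalso; refine hcontra 0 2 ?_ ?_ <;> (simp [splitTwist]; done))
    | (exfalso; refine hcontra 1 0 ?_ ?_ <;> (simp [splitTwist]; done))
    | (exfalso; refine hcontra 1 2 ?_ ?_ <;> (simp [splitTwist]; done))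
    | (exfalso; refine hcontra 2 0 ?_ ?_ <;> (simp [splitTwist]; done))

end Factor

/-! ### The twists when exactly one root is rational. -/

section Quadratic

variable {p : ℕ} [Fact p.Prime] {K : IntermediateField (Qpnr p) (PadicAlgCl p)}
variable {F : MvPolynomial (Fin 3) (PadicAlgCl p)} {A B C : PadicAlgCl p}
variable {τ : PadicAlgCl p ≃ₐ[K] PadicAlgCl p}

theorem algEquiv_of_sq_eq_one {e : PadicAlgCl p} (he : e ^ 2 = 1)
    (σ : PadicAlgCl p ≃ₐ[K] PadicAlgCl p) : σ e = e := by
  rcases sq_eq_sq_iff_eq_or_eq_neg.1 (he.trans (one_pow 2).symm) with h | h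
  · rw [h, map_one]
  · rw [h, map_neg, map_one]

/-- The Galois group acts on the quartic `F` by exchanging the last two coordinates according to
its action on two conjugate roots of a cubic with a rational root. -/
structure SwapAction (K : IntermediateField (Qpnr p) (PadicAlgCl p))
    (F : MvPolynomial (Fin 3) (PadicAlgCl p)) (A B C : PadicAlgCl p)
    (τ : PadicAlgCl p ≃ₐ[K] PadicAlgCl p) : Prop where
  roots : CubicRoots K A B C
  A_mem : A ∈ K
  apply_B : τ B = C
  apply_C : τ C = B
  map_eq : ∀ g : PadicAlgCl p ≃ₐ[K] PadicAlgCl p, g B = B → g C = C →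
    map (g : PadicAlgCl p →+* PadicAlgCl p) F = F
  map_swap : map (τ : PadicAlgCl p →+* PadicAlgCl p) F = subst !![1, 0, 0; 0, 0, 1; 0, 1, 0] F

/-- `x` is fixed by the automorphisms that fix the roots. -/
def FixedByRoots (K : IntermediateField (Qpnr p) (PadicAlgCl p)) (B C x : PadicAlgCl p) : Prop :=
  ∀ g : PadicAlgCl p ≃ₐ[K] PadicAlgCl p, g B = B → g C = C → g x = x

namespace SwapAction

theorem mem (h : SwapAction K F A B C τ) {x : PadicAlgCl p} (hx : FixedByRoots K B C x)
    (hτ : τ x = x) : x ∈ K :=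
  h.roots.mem_of_swap h.A_mem h.apply_B (fun g _ hB hC => hx g hB hC) hτ

theorem apply_apply (h : SwapAction K F A B C τ) {x : PadicAlgCl p}
    (hx : FixedByRoots K B C x) : τ (τ x) = x :=
  hx (τ.trans τ) (by simp [h.apply_B, h.apply_C]) (by simp [h.apply_B, h.apply_C])

theorem fixed_apply (h : SwapAction K F A B C τ) {x : PadicAlgCl p}
    (hx : FixedByRoots K B C x) : FixedByRoots K B C (τ x) := by
  intro g hB hC
  have := hx ((τ.trans g).trans τ.symm)
    (by simp [h.apply_B, hC, AlgEquiv.symm_apply_eq]) (by simp [h.apply_C, hB, AlgEquiv.symm_apply_eq])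
  rwa [AlgEquiv.trans_apply, AlgEquiv.trans_apply, AlgEquiv.symm_apply_eq] at this

/-- Descent for the regular representation of the group of order two. -/
theorem exists_coordinates (h : SwapAction K F A B C τ) {x : PadicAlgCl p}
    (hx : FixedByRoots K B C x) :
    ∃ n₁ ∈ K, ∃ n₂ ∈ K, x = n₁ + B * n₂ ∧ τ x = n₁ + C * n₂ := by
  have hne : B - C ≠ 0 := sub_ne_zero.2 h.roots.hBC
  have hne' : C - B ≠ 0 := sub_ne_zero.2 h.roots.hBC.symm
  have hx' := h.fixed_apply hx
  have hxx := h.apply_apply hx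
  refine ⟨(B * τ x - C * x) / (B - C), h.mem (fun g hB hC => ?_) ?_,
    (x - τ x) / (B - C), h.mem (fun g hB hC => ?_) ?_, ?_, ?_⟩
  · simp only [map_div₀, map_sub, map_mul, hB, hC, hx g hB hC, hx' g hB hC]
  · simp only [map_div₀, map_sub, map_mul, h.apply_B, h.apply_C, hxx]
    rw [div_eq_div_iff hne' hne]; ring
  · simp only [map_div₀, map_sub, hB, hC, hx g hB hC, hx' g hB hC]
  · simp only [map_div₀, map_sub, h.apply_B, h.apply_C, hxx]
    rw [div_eq_div_iff hne' hne]; ring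
  · field_simp; ring
  · field_simp; ring

/-- Both `B - C` and `w` have their square in `K`, and `B - C` is irrational because `τ` negates it.
As `K` has only two square classes, the product is rational: the splitting field is `K(w)`. -/
theorem sub_mul_mem (h : SwapAction K F A B C τ) (hp : 3 < p) {u w : PadicAlgCl p}
    (hu : IsUniformizer K u) (hwK : w ^ 2 ∈ K) (hw : ‖w‖ ^ 2 = ‖u‖) : (B - C) * w ∈ K := by
  refine (hu.mem_or_mul_mem hp hwK hw (h.mem (fun g hB hC => ?_) ?_)).resolve_left fun hK => ?_
  · rw [map_pow, map_sub, hB, hC]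
  · rw [map_pow, map_sub, h.apply_B, h.apply_C]; ring
  · have := algEquiv_of_mem hK τ
    rw [map_sub, h.apply_B, h.apply_C] at this
    have h2 : 2 * (B - C) = 0 := by linear_combination -this
    exact mul_ne_zero two_ne_zero (sub_ne_zero.2 h.roots.hBC) h2

theorem fixed_of_sq (h : SwapAction K F A B C τ) (hp : 3 < p) {u w : PadicAlgCl p}
    (hu : IsUniformizer K u) (hwK : w ^ 2 ∈ K) (hw : ‖w‖ ^ 2 = ‖u‖) :
    FixedByRoots K B C w := by
  intro g hB hC
  have := algEquiv_of_mem (h.sub_mul_mem hp hu hwK hw) g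
  rw [map_mul, map_sub, hB, hC] at this
  exact mul_left_cancel₀ (sub_ne_zero.2 h.roots.hBC) this

theorem apply_of_sq (h : SwapAction K F A B C τ) (hp : 3 < p) {u w : PadicAlgCl p}
    (hu : IsUniformizer K u) (hwK : w ^ 2 ∈ K) (hw : ‖w‖ ^ 2 = ‖u‖) : τ w = -w := by
  have := algEquiv_of_mem (h.sub_mul_mem hp hu hwK hw) τ
  rw [map_mul, map_sub, h.apply_B, h.apply_C] at this
  refine mul_left_cancel₀ (sub_ne_zero.2 h.roots.hBC) ?_
  linear_combination -this

end SwapAction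

/-- A fourth root of a uniformizer and a primitive fourth root of unity. -/
structure QuarticRoot (K : IntermediateField (Qpnr p) (PadicAlgCl p)) (u ϖ ζ : PadicAlgCl p) :
    Prop where
  uniformizer : IsUniformizer K u
  pow_mem : ϖ ^ 4 ∈ K
  norm_eq : ‖ϖ‖ ^ 4 = ‖u‖
  sq : ζ ^ 2 = -1

namespace QuarticRoot

variable {u ϖ ζ : PadicAlgCl p}

theorem ne_zero (hq : QuarticRoot K u ϖ ζ) : ϖ ≠ 0 := by
  rintro rfl
  have := hq.norm_eq
  rw [norm_zero, zero_pow four_ne_zero] at this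
  exact hq.uniformizer.2.1 (norm_eq_zero.1 this.symm)

theorem ne_zero' (hq : QuarticRoot K u ϖ ζ) : ζ ≠ 0 := by
  rintro rfl
  simpa using hq.sq

theorem apply_unity (hq : QuarticRoot K u ϖ ζ) (hp : 3 < p)
    (σ : PadicAlgCl p ≃ₐ[K] PadicAlgCl p) : σ ζ = ζ := by
  have hcop : (4 : ℕ).Coprime p :=
    Nat.Coprime.pow_left 2 ((Nat.coprime_primes Nat.prime_two Fact.out).2 (by omega))
  refine algEquiv_root_of_unity (σ.restrictScalars (Qpnr p)) (by norm_num) hcop ?_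
  linear_combination (ζ ^ 2 - 1) * hq.sq

theorem sq_sq_mem (hq : QuarticRoot K u ϖ ζ) : (ϖ ^ 2) ^ 2 ∈ K := by
  rw [← pow_mul]; exact hq.pow_mem

theorem norm_sq_sq (hq : QuarticRoot K u ϖ ζ) : ‖ϖ ^ 2‖ ^ 2 = ‖u‖ := by
  rw [norm_pow, ← pow_mul]; exact hq.norm_eq

theorem exists_sign (hq : QuarticRoot K u ϖ ζ) (h : SwapAction K F A B C τ) (hp : 3 < p)
    {g : PadicAlgCl p ≃ₐ[K] PadicAlgCl p} (hB : g B = B) (hC : g C = C) :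
    ∃ ε : PadicAlgCl p, ε ^ 2 = 1 ∧ g ϖ = ε * ϖ := by
  have := h.fixed_of_sq hp hq.uniformizer hq.sq_sq_mem hq.norm_sq_sq g hB hC
  rw [map_pow] at this
  rcases sq_eq_sq_iff_eq_or_eq_neg.1 this with h1 | h1
  · exact ⟨1, one_pow 2, by rw [h1, one_mul]⟩
  · exact ⟨-1, by ring, by rw [h1]; ring⟩

theorem exists_sign_swap (hq : QuarticRoot K u ϖ ζ) (h : SwapAction K F A B C τ) (hp : 3 < p) :
    ∃ κ : PadicAlgCl p, κ ^ 2 = 1 ∧ τ ϖ = κ * ζ * ϖ := by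
  have := h.apply_of_sq hp hq.uniformizer hq.sq_sq_mem hq.norm_sq_sq
  have h2 : τ ϖ ^ 2 = (ζ * ϖ) ^ 2 := by
    rw [← map_pow, this, mul_pow, hq.sq]; ring
  rcases sq_eq_sq_iff_eq_or_eq_neg.1 h2 with h1 | h1
  · exact ⟨1, one_pow 2, by rw [h1, one_mul]⟩
  · exact ⟨-1, by ring, by rw [h1]; ring⟩

/-- Since `ϖ²` is negated by `τ`, one has `τ ϖ = ± ζ ϖ` with `ζ` fixed. The sign obtained here
separates the two twists, because `τ²` is trivial on the splitting field. -/
theorem apply_apply (hq : QuarticRoot K u ϖ ζ) (h : SwapAction K F A B C τ) (hp : 3 < p) :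
    τ (τ ϖ) = -ϖ := by
  obtain ⟨κ, hκ, hτ⟩ := hq.exists_sign_swap h hp
  rw [hτ, map_mul, map_mul, algEquiv_of_sq_eq_one hκ, hq.apply_unity hp, hτ]
  linear_combination ϖ * ζ ^ 2 * hκ + ϖ * hq.sq

end QuarticRoot

/-- The matrices that represent the twists when the cubic has exactly one rational root. -/
noncomputable def swapTwist (B C ϖ ζ : PadicAlgCl p) (i : Fin 2) : Matrix (Fin 3) (Fin 3) (PadicAlgCl p) :=
  ![!![1, 0, 0; 0, 1, B; 0, 1, C], !![ϖ, 0, 0; 0, 1, B; 0, ζ, ζ * C]] i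

variable {u ϖ ζ : PadicAlgCl p}

theorem swap_mul_apply (M : Matrix (Fin 3) (Fin 3) (PadicAlgCl p)) (j : Fin 3) :
    ((!![1, 0, 0; 0, 0, 1; 0, 1, 0] : Matrix (Fin 3) (Fin 3) (PadicAlgCl p)) * M) 0 j = M 0 j ∧
    ((!![1, 0, 0; 0, 0, 1; 0, 1, 0] : Matrix (Fin 3) (Fin 3) (PadicAlgCl p)) * M) 1 j = M 2 j ∧
    ((!![1, 0, 0; 0, 0, 1; 0, 1, 0] : Matrix (Fin 3) (Fin 3) (PadicAlgCl p)) * M) 2 j = M 1 j := by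
  simp [Matrix.mul_apply, Fin.sum_univ_three]

theorem det_swapTwist (h : B ≠ C) (hϖ : ϖ ≠ 0) (hζ : ζ ≠ 0) (i : Fin 2) :
    (swapTwist B C ϖ ζ i).det ≠ 0 := by
  have hne := sub_ne_zero.2 h.symm
  fin_cases i
  · simpa [swapTwist, Matrix.det_fin_three] using hne
  · have : (swapTwist B C ϖ ζ 1).det = ϖ * (ζ * (C - B)) := by
      simp [swapTwist, Matrix.det_fin_three]; ring
    exact this ▸ mul_ne_zero hϖ (mul_ne_zero hζ hne)

theorem coeff_subst_swapTwist_mem (hF : IsRigid F) (h : SwapAction K F A B C τ) (hp : 3 < p)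
    (hq : QuarticRoot K u ϖ ζ) (i : Fin 2) (m : Fin 3 →₀ ℕ) :
    (subst (swapTwist B C ϖ ζ i) F).coeff m ∈ K := by
  refine h.mem (fun g hB hC => ?_) ?_
  · obtain ⟨ε, hε, hg⟩ := hq.exists_sign h hp hB hC
    have hmap := h.map_eq g hB hC
    refine map_subst_eq_of_diagonal hF (P := 1) (hmap.trans (subst_one F).symm)
      (d := ![![1, ε] i, 1, 1]) (u := 1) (fun l => ?_) (one_pow 2) ?_ m
    · fin_cases i <;> fin_cases l <;> simp [hε]
    · ext a b
      rw [one_mul, Matrix.diagonal_mul]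
      fin_cases i <;> fin_cases a <;> fin_cases b <;>
        simp [swapTwist, hB, hC, hg, hq.apply_unity hp]
  · obtain ⟨κ, hκ, hτ⟩ := hq.exists_sign_swap h hp
    have hsq := hq.sq
    -- For the second twist `τ` multiplies the first row by `κ ζ`. Exchanging the other two rows
    -- costs `ζ` and `ζ⁻¹ = -ζ`. All three factors have square `-1`.
    refine map_subst_eq_of_diagonal hF h.map_swap (d := ![![1, 1, 1], ![κ * ζ, ζ, -ζ]] i)
      (u := ![1, -1] i) (fun l => ?_) ?_ ?_ m
    · fin_cases i <;> fin_cases l <;> simp [hsq, mul_pow, hκ]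
    · fin_cases i <;> simp
    · ext a b
      rw [Matrix.diagonal_mul]
      obtain ⟨h0, h1, h2⟩ := swap_mul_apply ((swapTwist B C ϖ ζ i).map τ) b
      fin_cases a
      · refine h0.trans ?_
        fin_cases i <;> fin_cases b <;> simp [swapTwist, hτ]
      · refine h1.trans ?_
        fin_cases i <;> fin_cases b <;> simp [swapTwist, h.apply_C, hq.apply_unity hp]
      · refine h2.trans ?_
        fin_cases i <;> fin_cases b <;> simp [swapTwist, h.apply_B]
        · linear_combination hsq
        · linear_combination C * hsq

/-- Both representatives have the same second row, which forces the scalar `c` into the splitting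
field, where `τ²` is trivial. For different representatives the corner entry makes `c` and a
rational number differ by the factor `ϖ`, which `τ²` negates. -/
theorem eq_of_isSign_swap (h : SwapAction K F A B C τ) (hp : 3 < p)
    (hq : QuarticRoot K u ϖ ζ) {i j : Fin 2} {E : Matrix (Fin 3) (Fin 3) (PadicAlgCl p)}
    {N : Matrix (Fin 3) (Fin 3) K} (hE : IsSign E) (hE0 : E.det ≠ 0)
    (hN : swapTwist B C ϖ ζ j * N.map (algebraMap K (PadicAlgCl p)) =
      E * swapTwist B C ϖ ζ i) : i = j := by
  obtain ⟨c, e, he0, he, hEe, hmul⟩ := hE.exists_mul_apply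
  have hc : c ≠ 0 := by
    rintro rfl
    rw [hEe, zero_smul] at hE0
    simp at hE0
  have key {z z' : PadicAlgCl p} (hz : τ (τ z) = z) (hz' : τ (τ z') = z') (hzz : z = ϖ * z')
      (h0 : z' ≠ 0) : False := by
    rw [hzz, map_mul, map_mul, hz', hq.apply_apply h hp] at hz
    have : 2 * (ϖ * z') = 0 := by linear_combination -hz
    exact mul_ne_zero two_ne_zero (mul_ne_zero hq.ne_zero h0) this
  have hK (x : K) : τ (x : PadicAlgCl p) = x := τ.commutes x
  have h1 : (N 1 1 : PadicAlgCl p) + B * (N 2 1 : PadicAlgCl p) = c * e 1 := by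
    have := congrFun₂ hN 1 1
    rw [hmul] at this
    fin_cases i <;> fin_cases j <;>
      simpa [swapTwist, Matrix.mul_apply, Fin.sum_univ_three] using this
  have hce : c = e 1 * ((N 1 1 : PadicAlgCl p) + B * (N 2 1 : PadicAlgCl p)) := by
    rw [h1]; linear_combination (-c) * he 1
  have hfix : τ (τ c) = c := by
    rw [hce]
    simp only [map_mul, map_add, algEquiv_of_sq_eq_one (he 1), hK, h.apply_B, h.apply_C]
  have h0 := congrFun₂ hN 0 0
  rw [hmul, he0] at h0
  fin_cases i <;> fin_cases j
  · rfl
  · exfalso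
    have h0' : ϖ * (N 0 0 : PadicAlgCl p) = c := by
      simpa [swapTwist, Matrix.mul_apply, Fin.sum_univ_three] using h0
    refine key hfix (z' := N 0 0) (by rw [hK, hK]) h0'.symm fun hz => hc ?_
    rw [← h0', hz, mul_zero]
  · exfalso
    have h0' : (N 0 0 : PadicAlgCl p) = c * ϖ := by
      simpa [swapTwist, Matrix.mul_apply, Fin.sum_univ_three] using h0
    exact key (z := N 0 0) (by rw [hK, hK]) hfix (h0'.trans (mul_comm _ _)) hc
  · rfl

theorem exists_factor_swap (hp : 3 < p) (hF : IsRigid F) (h : SwapAction K F A B C τ)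
    (hq : QuarticRoot K u ϖ ζ) {Y : SmoothQuartic K (PadicAlgCl p)}
    {D : Matrix (Fin 3) (Fin 3) (PadicAlgCl p)}
    (hD : D.det ≠ 0) {c : PadicAlgCl p} (hc : c ≠ 0) (hY : subst D F = c • Y.baseChange) :
    ∃ (i : Fin 2) (E : Matrix (Fin 3) (Fin 3) (PadicAlgCl p)) (N : Matrix (Fin 3) (Fin 3) K),
      IsSign E ∧ D = E * swapTwist B C ϖ ζ i * N.map (algebraMap K (PadicAlgCl p)) := by
  obtain ⟨r, c', D', j₀, rfl, hD', hc', hY', hj₀⟩ := exists_normalization hF hD hc hY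
  suffices hs : ∃ (i : Fin 2) (E : Matrix (Fin 3) (Fin 3) (PadicAlgCl p))
      (N : Matrix (Fin 3) (Fin 3) K),
      IsSign E ∧ D' = E * swapTwist B C ϖ ζ i * N.map (algebraMap K (PadicAlgCl p)) by
    obtain ⟨i, E, N, hE, hDE⟩ := hs
    refine ⟨i, r • E, N, hE.smul r, ?_⟩
    rw [hDE, Matrix.smul_mul, Matrix.smul_mul]
  clear hY hD hc
  have hact (g : PadicAlgCl p ≃ₐ[K] PadicAlgCl p) (hB : g B = B) (hC : g C = C) :
      ∃ e : Fin 3 → PadicAlgCl p, e 0 = 1 ∧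
      (∀ i, e i ^ 2 = 1) ∧ ∀ i j, g (D' i j) = e i * D' i j := by
    obtain ⟨e, he0, he, h⟩ := exists_signs hF hD' (P := 1) (by simp) hc' hY' hj₀ g
      ((h.map_eq g hB hC).trans (subst_one F).symm) (by simp)
    exact ⟨e, he0, he, by simpa using h⟩
  obtain ⟨e, he0, he, heD⟩ := exists_signs hF hD' (by simp [Matrix.det_fin_three]) hc' hY' hj₀ τ
    h.map_swap (fun M j => (swap_mul_apply M j).1)
  have hτ0 (j : Fin 3) : τ (D' 0 j) = D' 0 j := by
    have := heD 0 j
    rwa [(swap_mul_apply _ j).1, he0, one_mul] at this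
  have hτ2 (j : Fin 3) : τ (D' 2 j) = e 1 * D' 1 j := by
    have := heD 1 j
    rwa [(swap_mul_apply _ j).2.1] at this
  have hτ1 (j : Fin 3) : τ (D' 1 j) = e 2 * D' 2 j := by
    have := heD 2 j
    rwa [(swap_mul_apply _ j).2.2] at this
  have h0 (j : Fin 3) : D' 0 j ∈ K := by
    refine h.mem (fun g hB hC => ?_) (hτ0 j)
    obtain ⟨f, hf0, -, hf⟩ := hact g hB hC
    rw [hf, hf0, one_mul]
  have hD2 (j : Fin 3) : D' 2 j = e 2 * τ (D' 1 j) := by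
    rw [hτ1]; linear_combination (-D' 2 j) * he 2
  obtain ⟨j₁, hj₁⟩ := exists_ne_zero_of_det_ne_zero hD' 1
  have hsq (i j : Fin 3) : FixedByRoots K B C (D' i j ^ 2) := by
    intro g hB hC
    obtain ⟨f, -, hf, hg⟩ := hact g hB hC
    rw [map_pow, hg, mul_pow, hf, one_mul]
  have hquot (j : Fin 3) : FixedByRoots K B C (D' 1 j / D' 1 j₁) := by
    intro g hB hC
    obtain ⟨f, -, hf, hg⟩ := hact g hB hC
    have hne : f 1 ≠ 0 := fun h0 => by simpa [h0] using hf 1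
    rw [map_div₀, hg, hg, mul_div_mul_left _ _ hne]
  have hw := h.fixed_of_sq hp hq.uniformizer hq.sq_sq_mem hq.norm_sq_sq
  -- The two factors have equal norm because `τ` exchanges rows 1 and 2 up to sign. Hence the fourth
  -- power of the norm of `D' 1 j₁` is an integral power of `‖u‖`, and its norm is an integral power
  -- of `‖ϖ‖`.
  have hprod : D' 1 j₁ ^ 2 * D' 2 j₁ ^ 2 ∈ K := by
    refine h.mem (fun g hB hC => ?_) ?_
    · rw [map_mul, hsq 1 j₁ g hB hC, hsq 2 j₁ g hB hC]
    · rw [map_mul, map_pow, map_pow, hτ1, hτ2, mul_pow, mul_pow, he, he]; ring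
  have hnormD2 : ‖D' 2 j₁‖ = ‖D' 1 j₁‖ := by
    have he2 : ‖e 2‖ = 1 := by
      rcases sq_eq_sq_iff_eq_or_eq_neg.1 ((he 2).trans (one_pow 2).symm) with h | h <;> simp [h]
    rw [hD2, norm_mul, he2, one_mul]
    exact norm_algEquiv (τ.restrictScalars (Qpnr p)) _
  have hj₂ : D' 2 j₁ ≠ 0 := by
    rw [← norm_ne_zero_iff, hnormD2]; exact norm_ne_zero_iff.2 hj₁
  obtain ⟨m, hm⟩ := hq.uniformizer.exists_norm_eq hprod
    (mul_ne_zero (pow_ne_zero 2 hj₁) (pow_ne_zero 2 hj₂))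
  have hxm : ‖D' 1 j₁‖ = ‖ϖ‖ ^ m := by
    rw [norm_mul, norm_pow, norm_pow, hnormD2, ← pow_add, ← hq.norm_eq, ← zpow_natCast,
      ← zpow_natCast, ← zpow_mul, mul_comm _ m, zpow_mul, zpow_natCast, zpow_natCast] at hm
    exact (pow_left_inj₀ (norm_nonneg _) (zpow_nonneg (norm_nonneg _) _) four_ne_zero).1 hm
  have hcop : (2 : ℕ).Coprime p := (Nat.coprime_primes Nat.prime_two Fact.out).2 (by omega)
  have hsqm (l : ℤ) : FixedByRoots K B C (ϖ ^ (2 * l)) := by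
    intro g hB hC
    rw [zpow_mul, map_zpow₀]
    congr 1
    exact_mod_cast hw g hB hC
  have ht : FixedByRoots K B C (D' 1 j₁ / ϖ ^ m) := by
    intro g hB hC
    refine algEquiv_eq_self_of_pow (g.restrictScalars (Qpnr p)) hcop ?_ ?_
    · rw [norm_div, norm_zpow, hxm, div_self (zpow_ne_zero _ (norm_ne_zero_iff.2 hq.ne_zero))]
    · change g _ = _
      have hm2 : (ϖ ^ m) ^ 2 = ϖ ^ (2 * m) := by rw [two_mul, zpow_add₀ hq.ne_zero, sq]
      rw [div_pow, map_div₀, hsq 1 j₁ g hB hC, hm2, hsqm m g hB hC]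
  -- The parity of `m` decides which of the two representatives occurs, since even powers of `ϖ` lie
  -- in the splitting field.
  have hscale : FixedByRoots K B C (D' 1 j₁) ∨ FixedByRoots K B C (ϖ * D' 1 j₁) := by
    have hxt : D' 1 j₁ = D' 1 j₁ / ϖ ^ m * ϖ ^ m :=
      (div_mul_cancel₀ _ (zpow_ne_zero m hq.ne_zero)).symm
    rcases Int.even_or_odd' m with ⟨l, hl | hl⟩
    · left
      intro g hB hC
      rw [hxt, map_mul, ht g hB hC]
      congr 1
      rw [hl]; exact hsqm l g hB hC
    · right
      have : ϖ * D' 1 j₁ = D' 1 j₁ / ϖ ^ m * ϖ ^ (2 * (l + 1)) := by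
        rw [show 2 * (l + 1) = m + 1 by omega, zpow_add_one₀ hq.ne_zero, ← mul_assoc, ← hxt,
          mul_comm]
      intro g hB hC
      rw [this, map_mul, ht g hB hC, hsqm _ g hB hC]
  have hcoord {q : PadicAlgCl p} (hq : FixedByRoots K B C (q * D' 1 j₁)) :
      ∃ N : Matrix (Fin 3) (Fin 3) K, ∀ j, D' 0 j = N 0 j ∧
        q * D' 1 j = N 1 j + B * N 2 j ∧ τ q * τ (D' 1 j) = N 1 j + C * N 2 j := by
    have hv (j : Fin 3) : FixedByRoots K B C (q * D' 1 j) := by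
      intro g hB hC
      have : q * D' 1 j = q * D' 1 j₁ * (D' 1 j / D' 1 j₁) := by field_simp
      rw [this, map_mul, hq g hB hC, hquot j g hB hC]
    choose n₁ hn₁ n₂ hn₂ hn hn' using fun j => h.exists_coordinates (hv j)
    let N : Matrix (Fin 3) (Fin 3) K := fun i j =>
      (![⟨D' 0 j, h0 j⟩, ⟨n₁ j, hn₁ j⟩, ⟨n₂ j, hn₂ j⟩] : Fin 3 → K) i
    refine ⟨N, fun j => ⟨rfl, hn j, ?_⟩⟩
    rw [← map_mul]
    exact hn' j
  rcases hscale with hx | hx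
  · obtain ⟨N, hN⟩ := hcoord (q := 1) (by simpa using hx)
    refine ⟨0, (1 : PadicAlgCl p) • Matrix.diagonal ![1, 1, e 2], N, ?_, ?_⟩
    · refine isSign_smul_diagonal 1 fun i => ?_
      fin_cases i <;> simp [he]
    ext i j
    obtain ⟨h1, h2, h3⟩ := hN j
    rw [mul_assoc, one_smul, Matrix.diagonal_mul]
    fin_cases i
    · simpa [swapTwist, Matrix.mul_apply, Fin.sum_univ_three] using h1
    · simpa [swapTwist, Matrix.mul_apply, Fin.sum_univ_three] using h2
    · simp only [map_one, one_mul] at h3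
      simp [swapTwist, Matrix.mul_apply, Fin.sum_univ_three, hD2, h3]
  · obtain ⟨N, hN⟩ := hcoord hx
    obtain ⟨κ, hκ, hτϖ⟩ := hq.exists_sign_swap h hp
    -- The sign in the last place compensates `τ ϖ = κ ζ ϖ` against the `ζ` in the last row of the
    -- representative: `-κ ζ * (κ ζ) = 1`.
    refine ⟨1, ϖ⁻¹ • Matrix.diagonal ![1, 1, -(κ * e 2)], N, ?_, ?_⟩
    · refine isSign_smul_diagonal _ fun i => ?_
      fin_cases i <;> simp [mul_pow, he, hκ]
    ext i j
    obtain ⟨h1, h2, h3⟩ := hN j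
    rw [mul_assoc, Matrix.smul_mul, Matrix.smul_apply, Matrix.diagonal_mul, smul_eq_mul,
      eq_inv_mul_iff_mul_eq₀ hq.ne_zero]
    fin_cases i
    · simp [swapTwist, Matrix.mul_apply, Fin.sum_univ_three, h1]
    · simpa [swapTwist, Matrix.mul_apply, Fin.sum_univ_three] using h2
    · rw [hτϖ] at h3
      simp [swapTwist, Matrix.mul_apply, Fin.sum_univ_three, hD2]
      linear_combination (-(κ * e 2) * ζ) * h3 + (ϖ * e 2 * τ (D' 1 j)) * hq.sq +
        (e 2 * ζ ^ 2 * ϖ * τ (D' 1 j)) * hκ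

end Quadratic

/-! ### The twists when the cubic is irreducible. -/

section Cyclic

variable {p : ℕ} [Fact p.Prime] {K : IntermediateField (Qpnr p) (PadicAlgCl p)}
variable {F : MvPolynomial (Fin 3) (PadicAlgCl p)} {A B C : PadicAlgCl p}
variable {τ : PadicAlgCl p ≃ₐ[K] PadicAlgCl p}

/-- The Galois group acts on the quartic `F` by permuting the coordinates cyclically according to
its action on the roots of an irreducible cubic. -/
structure CycleAction (K : IntermediateField (Qpnr p) (PadicAlgCl p))
    (F : MvPolynomial (Fin 3) (PadicAlgCl p)) (A B C : PadicAlgCl p)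
    (τ : PadicAlgCl p ≃ₐ[K] PadicAlgCl p) : Prop where
  roots : CubicRoots K A B C
  A_not_mem : A ∉ K
  apply_A : τ A = B
  apply_B : τ B = C
  apply_C : τ C = A
  map_eq : ∀ g : PadicAlgCl p ≃ₐ[K] PadicAlgCl p, g A = A → g B = B → g C = C →
    map (g : PadicAlgCl p →+* PadicAlgCl p) F = F
  map_cycle : map (τ : PadicAlgCl p →+* PadicAlgCl p) F = subst !![0, 0, 1; 1, 0, 0; 0, 1, 0] F

namespace CycleAction

theorem apply_A_of_fixed (h : CycleAction K F A B C τ) {g : PadicAlgCl p ≃ₐ[K] PadicAlgCl p}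
    (hB : g B = B) (hC : g C = C) : g A = A :=
  h.roots.rotate.eq_third g hB hC (by ring)

theorem mem (h : CycleAction K F A B C τ) (hp : 3 < p) {x : PadicAlgCl p}
    (hx : FixedByRoots K B C x) (hτ : τ x = x) : x ∈ K :=
  h.roots.mem_of_cycle hp h.A_not_mem h.apply_A h.apply_B (fun g _ hB hC => hx g hB hC) hτ

theorem fixed_apply (h : CycleAction K F A B C τ) {x : PadicAlgCl p}
    (hx : FixedByRoots K B C x) : FixedByRoots K B C (τ x) := by
  intro g hB hC
  have hA := h.apply_A_of_fixed hB hC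
  have := hx ((τ.trans g).trans τ.symm)
    (by simp [h.apply_B, hC, AlgEquiv.symm_apply_eq]) (by simp [h.apply_C, hA, AlgEquiv.symm_apply_eq])
  rwa [AlgEquiv.trans_apply, AlgEquiv.trans_apply, AlgEquiv.symm_apply_eq] at this

theorem apply_apply_apply (h : CycleAction K F A B C τ) {x : PadicAlgCl p}
    (hx : FixedByRoots K B C x) : τ (τ (τ x)) = x :=
  hx ((τ.trans τ).trans τ) (by simp [h.apply_A, h.apply_B, h.apply_C])
    (by simp [h.apply_A, h.apply_B, h.apply_C])

theorem trace_mem (h : CycleAction K F A B C τ) (hp : 3 < p) {x : PadicAlgCl p}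
    (hx : FixedByRoots K B C x) : x + τ x + τ (τ x) ∈ K := by
  refine h.mem hp (fun g hB hC => ?_) ?_
  · rw [map_add, map_add, hx g hB hC, h.fixed_apply hx g hB hC,
      h.fixed_apply (h.fixed_apply hx) g hB hC]
  · rw [map_add, map_add, h.apply_apply_apply hx]; ring

theorem norm_mem (h : CycleAction K F A B C τ) (hp : 3 < p) {x : PadicAlgCl p}
    (hx : FixedByRoots K B C x) : x * τ x * τ (τ x) ∈ K := by
  refine h.mem hp (fun g hB hC => ?_) ?_
  · rw [map_mul, map_mul, hx g hB hC, h.fixed_apply hx g hB hC,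
      h.fixed_apply (h.fixed_apply hx) g hB hC]
  · rw [map_mul, map_mul, h.apply_apply_apply hx]; ring

/-- Descent for the regular representation of the cyclic group of order three. -/
theorem exists_coordinates (h : CycleAction K F A B C τ) (hp : 3 < p) {x : PadicAlgCl p}
    (hx : FixedByRoots K B C x) :
    ∃ n₀ ∈ K, ∃ n₁ ∈ K, ∃ n₂ ∈ K, x = n₀ + A * n₁ + A ^ 2 * n₂ ∧
      τ x = n₀ + B * n₁ + B ^ 2 * n₂ ∧ τ (τ x) = n₀ + C * n₁ + C ^ 2 * n₂ := by
  have hAB : A - B ≠ 0 := sub_ne_zero.2 h.roots.hAB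
  have hAC : A - C ≠ 0 := sub_ne_zero.2 h.roots.hAC
  have hBC : B - C ≠ 0 := sub_ne_zero.2 h.roots.hBC
  have hBA : B - A ≠ 0 := sub_ne_zero.2 h.roots.hAB.symm
  have hCA : C - A ≠ 0 := sub_ne_zero.2 h.roots.hAC.symm
  have hCB : C - B ≠ 0 := sub_ne_zero.2 h.roots.hBC.symm
  -- Lagrange interpolation through `(A, x)`, `(B, τ x)`, `(C, τ² x)`: each coefficient of the
  -- interpolating polynomial is a trace.
  refine ⟨_, h.trace_mem hp (x := x * (B * C) / ((A - B) * (A - C))) fun g hB hC => ?_,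
    _, h.trace_mem hp (x := -(x * (B + C)) / ((A - B) * (A - C))) fun g hB hC => ?_,
    _, h.trace_mem hp (x := x / ((A - B) * (A - C))) fun g hB hC => ?_, ?_, ?_, ?_⟩
  · simp only [map_div₀, map_mul, map_sub, hx g hB hC, hB, hC, h.apply_A_of_fixed hB hC]
  · simp only [map_div₀, map_neg, map_mul, map_add, map_sub, hx g hB hC, hB, hC,
      h.apply_A_of_fixed hB hC]
  · simp only [map_div₀, map_mul, map_sub, hx g hB hC, hB, hC, h.apply_A_of_fixed hB hC]
  all_goals
    simp only [map_div₀, map_neg, map_mul, map_add, map_sub, h.apply_A, h.apply_B, h.apply_C]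
    rw [show (B - C) * (B - A) = -((A - B) * (B - C)) by ring,
      show (C - A) * (C - B) = (A - C) * (B - C) by ring]
    field_simp
    ring

end CycleAction

theorem vandermonde_det_ne_zero (h : CubicRoots K A B C) :
    (!![1, A, A ^ 2; 1, B, B ^ 2; 1, C, C ^ 2]).det ≠ 0 := by
  have : (!![1, A, A ^ 2; 1, B, B ^ 2; 1, C, C ^ 2]).det = (B - A) * (C - A) * (C - B) := by
    simp [Matrix.det_fin_three]; ring
  rw [this]
  exact mul_ne_zero (mul_ne_zero (sub_ne_zero.2 h.hAB.symm) (sub_ne_zero.2 h.hAC.symm))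
    (sub_ne_zero.2 h.hBC.symm)

theorem cycle_mul_apply (M : Matrix (Fin 3) (Fin 3) (PadicAlgCl p)) (j : Fin 3) :
    ((!![0, 0, 1; 1, 0, 0; 0, 1, 0] : Matrix (Fin 3) (Fin 3) (PadicAlgCl p)) * M) 0 j = M 2 j ∧
    ((!![0, 0, 1; 1, 0, 0; 0, 1, 0] : Matrix (Fin 3) (Fin 3) (PadicAlgCl p)) * M) 1 j = M 0 j ∧
    ((!![0, 0, 1; 1, 0, 0; 0, 1, 0] : Matrix (Fin 3) (Fin 3) (PadicAlgCl p)) * M) 2 j = M 1 j := by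
  simp [Matrix.mul_apply, Fin.sum_univ_three]

theorem coeff_subst_vandermonde_mem (hF : IsRigid F) (h : CycleAction K F A B C τ) (hp : 3 < p)
    (m : Fin 3 →₀ ℕ) :
    (subst !![1, A, A ^ 2; 1, B, B ^ 2; 1, C, C ^ 2] F).coeff m ∈ K := by
  refine h.mem hp (fun g hB hC => ?_) ?_
  · have hA := h.apply_A_of_fixed hB hC
    refine map_subst_eq_of_diagonal hF (P := 1)
      ((h.map_eq g hA hB hC).trans (subst_one F).symm)
      (d := fun _ => 1) (u := 1) (fun l => one_pow 2) (one_pow 2) ?_ m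
    ext a b
    rw [one_mul, Matrix.diagonal_mul]
    fin_cases a <;> fin_cases b <;> simp [hA, hB, hC]
  · refine map_subst_eq_of_diagonal hF h.map_cycle (d := fun _ => 1) (u := 1)
      (fun l => one_pow 2) (one_pow 2) ?_ m
    ext a b
    rw [Matrix.diagonal_mul]
    obtain ⟨h0, h1, h2⟩ :=
      cycle_mul_apply ((!![1, A, A ^ 2; 1, B, B ^ 2; 1, C, C ^ 2]).map τ) b
    fin_cases a
    · refine h0.trans ?_
      fin_cases b <;> simp [h.apply_C]
    · refine h1.trans ?_
      fin_cases b <;> simp [h.apply_A]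
    · refine h2.trans ?_
      fin_cases b <;> simp [h.apply_B]

/-- The three-cycle moves the first row, so normalising an entry of it no longer controls the
scalar. Instead `D` carries `F` exactly to the equation of `Y`, and comparing the Galois conjugate
with the original leaves a scalar with `c⁴ = 1`. -/
theorem exists_quartic_signs (hF : IsRigid F) {Y : SmoothQuartic K (PadicAlgCl p)}
    {D P : Matrix (Fin 3) (Fin 3) (PadicAlgCl p)} (hD : D.det ≠ 0) (hP : P.det ≠ 0)
    (hY : subst D F = Y.baseChange) (σ : PadicAlgCl p ≃ₐ[K] PadicAlgCl p)
    (hσ : map (σ : PadicAlgCl p →+* PadicAlgCl p) F = subst P F) :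
    ∃ (c : PadicAlgCl p) (e : Fin 3 → PadicAlgCl p), c ^ 4 = 1 ∧ e 0 = 1 ∧ (∀ i, e i ^ 2 = 1) ∧
      ∀ i j, (P * D.map σ) i j = c * (e i * D i j) := by
  obtain ⟨E, hE, hPD⟩ := exists_isSign_galois hF hD hP one_ne_zero
    (hY.trans (one_smul _ _).symm) σ hσ
  obtain ⟨c, e, he0, he, hEe, hmul⟩ := hE.exists_mul_apply
  refine ⟨c, e, ?_, he0, he, fun i j => by rw [hPD, hmul]⟩
  have h := congrArg (map (σ : PadicAlgCl p →+* PadicAlgCl p)) hY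
  rw [map_baseChange, ← hY, map_subst, hσ, subst_subst] at h
  change subst (P * D.map σ) F = _ at h
  rw [hPD, ← subst_subst, hEe, subst_smul_matrix hF.homogeneous,
    hF.subst_diagonal e 1 he, one_pow, one_smul, subst_smul] at h
  have hne := (hF.nonsingular.subst (isUnit_iff_ne_zero.2 hD)).ne_zero
  have h2 : (c ^ 4 - 1) • subst D F = 0 := by rw [sub_smul, h, one_smul, sub_self]
  exact sub_eq_zero.1 ((smul_eq_zero.1 h2).resolve_right hne)

theorem algEquiv_of_pow_four_eq_one (hp : 3 < p) {e : PadicAlgCl p} (he : e ^ 4 = 1)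
    (σ : PadicAlgCl p ≃ₐ[K] PadicAlgCl p) : σ e = e := by
  have hcop : (4 : ℕ).Coprime p :=
    Nat.Coprime.pow_left 2 ((Nat.coprime_primes Nat.prime_two Fact.out).2 (by omega))
  exact algEquiv_root_of_unity (σ.restrictScalars (Qpnr p)) (by norm_num) hcop he

/-- One scalar `w` moves the first row into the splitting field, and `τ` then generates the other
rows from it up to signs. That `τ³` is trivial there makes the remaining fourth root of unity a
sign, so everything is absorbed in `E` and there is a single class. -/
theorem exists_factor_cycle (hp : 3 < p) (hF : IsRigid F) (h : CycleAction K F A B C τ)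
    {u : PadicAlgCl p} (hu : IsUniformizer K u) {Y : SmoothQuartic K (PadicAlgCl p)}
    {D : Matrix (Fin 3) (Fin 3) (PadicAlgCl p)}
    (hD : D.det ≠ 0) {c : PadicAlgCl p} (hc : c ≠ 0) (hY : subst D F = c • Y.baseChange) :
    ∃ (E : Matrix (Fin 3) (Fin 3) (PadicAlgCl p)) (N : Matrix (Fin 3) (Fin 3) K),
      IsSign E ∧ D = E * !![1, A, A ^ 2; 1, B, B ^ 2; 1, C, C ^ 2] *
        N.map (algebraMap K (PadicAlgCl p)) := by
  obtain ⟨ρ, hρ⟩ := IsAlgClosed.exists_pow_nat_eq c⁻¹ (n := 4) (by norm_num)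
  have hρ0 : ρ ≠ 0 := by
    rintro rfl
    exact inv_ne_zero hc (by rw [← hρ, zero_pow four_ne_zero])
  obtain ⟨D', rfl⟩ : ∃ D', D = ρ⁻¹ • D' :=
    ⟨ρ • D, by rw [smul_smul, inv_mul_cancel₀ hρ0, one_smul]⟩
  suffices hs : ∃ (E : Matrix (Fin 3) (Fin 3) (PadicAlgCl p))
      (N : Matrix (Fin 3) (Fin 3) K), IsSign E ∧
      D' = E * !![1, A, A ^ 2; 1, B, B ^ 2; 1, C, C ^ 2] *
        N.map (algebraMap K (PadicAlgCl p)) by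
    obtain ⟨E, N, hE, hDE⟩ := hs
    refine ⟨ρ⁻¹ • E, N, hE.smul _, ?_⟩
    rw [Matrix.smul_mul, Matrix.smul_mul, ← hDE]
  have hD' : D'.det ≠ 0 := by
    rw [Matrix.det_smul] at hD
    exact right_ne_zero_of_mul hD
  have hY' : subst D' F = Y.baseChange := by
    rw [subst_smul_matrix hF.homogeneous, inv_pow, hρ, inv_inv] at hY
    exact smul_right_injective _ hc hY
  clear hY hD hρ
  have hact (g : PadicAlgCl p ≃ₐ[K] PadicAlgCl p) (hB : g B = B) (hC : g C = C) :
      ∃ l : PadicAlgCl p, l ^ 4 = 1 ∧ ∀ j, g (D' 0 j) = l * D' 0 j := by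
    obtain ⟨l, e, hl, he0, -, h⟩ := exists_quartic_signs hF hD' (P := 1) (by simp) hY' g
      ((h.map_eq g (h.apply_A_of_fixed hB hC) hB hC).trans (subst_one F).symm)
    refine ⟨l, hl, fun j => ?_⟩
    have := h 0 j
    rwa [he0, one_mul, one_mul] at this
  obtain ⟨l, e, hl, he0, he, heD⟩ := exists_quartic_signs hF hD'
    (P := !![0, 0, 1; 1, 0, 0; 0, 1, 0]) (by simp [Matrix.det_fin_three]) hY' τ h.map_cycle
  have hτ2 (j : Fin 3) : τ (D' 2 j) = l * D' 0 j := by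
    have := heD 0 j
    rwa [(cycle_mul_apply _ j).1, he0, one_mul] at this
  have hτ0 (j : Fin 3) : τ (D' 0 j) = l * (e 1 * D' 1 j) := by
    have := heD 1 j
    rwa [(cycle_mul_apply _ j).2.1] at this
  have hτ1 (j : Fin 3) : τ (D' 1 j) = l * (e 2 * D' 2 j) := by
    have := heD 2 j
    rwa [(cycle_mul_apply _ j).2.2] at this
  obtain ⟨j₁, hj₁⟩ := exists_ne_zero_of_det_ne_zero hD' 0
  have hpow : FixedByRoots K B C (D' 0 j₁ ^ 4) := by
    intro g hB hC
    obtain ⟨l, hl, hg⟩ := hact g hB hC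
    rw [map_pow, hg, mul_pow, hl, one_mul]
  have hquot (j : Fin 3) : FixedByRoots K B C (D' 0 j / D' 0 j₁) := by
    intro g hB hC
    obtain ⟨l, hl, hg⟩ := hact g hB hC
    have hne : l ≠ 0 := by
      rintro rfl
      rw [zero_pow four_ne_zero] at hl
      exact zero_ne_one hl
    rw [map_div₀, hg, hg, mul_div_mul_left _ _ hne]
  have hnorm (x : PadicAlgCl p) : ‖τ x‖ = ‖x‖ := norm_algEquiv (τ.restrictScalars (Qpnr p)) x
  have hτne {x : PadicAlgCl p} (hx : x ≠ 0) : τ x ≠ 0 := by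
    simpa using hx
  have hx4 := pow_ne_zero 4 hj₁
  obtain ⟨m, hm⟩ := hu.exists_norm_eq (h.norm_mem hp hpow)
    (mul_ne_zero (mul_ne_zero hx4 (hτne hx4)) (hτne (hτne hx4)))
  -- The element `w = v ^ m` is chosen so that `w⁴ ∈ K` and `‖w‖ = ‖x‖³` for `x = D' 0 j₁`. By
  -- tameness `x³ / w` lies in the splitting field, and so does `w x = x⁴ / (x³ / w)`.
  obtain ⟨v, hv⟩ := IsAlgClosed.exists_pow_nat_eq u (n := 4) (by norm_num)
  have hv0 : v ≠ 0 := by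
    rintro rfl
    exact hu.2.1 (by rw [← hv, zero_pow four_ne_zero])
  obtain ⟨w, hw⟩ : ∃ w, w = v ^ m := ⟨_, rfl⟩
  have hw0 : w ≠ 0 := by rw [hw]; exact zpow_ne_zero m hv0
  have hw4 : w ^ 4 = u ^ m := by
    rw [hw, ← hv, ← zpow_natCast, ← zpow_natCast, ← zpow_mul, ← zpow_mul, mul_comm]
  have hw4K : w ^ 4 ∈ K := by
    rw [hw4]; exact zpow_mem hu.1 m
  have hxw : ‖D' 0 j₁‖ ^ 3 = ‖w‖ := by
    rw [norm_mul, norm_mul, hnorm, hnorm, hnorm, ← norm_zpow, ← hw4, norm_pow, norm_pow] at hm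
    refine (pow_left_inj₀ (pow_nonneg (norm_nonneg _) _) (norm_nonneg _) four_ne_zero).1 ?_
    rw [← hm]; ring
  have hcop : (4 : ℕ).Coprime p :=
    Nat.Coprime.pow_left 2 ((Nat.coprime_primes Nat.prime_two Fact.out).2 (by omega))
  have ht : FixedByRoots K B C (D' 0 j₁ ^ 3 / w) := by
    intro g hB hC
    refine algEquiv_eq_self_of_pow (g.restrictScalars (Qpnr p)) hcop ?_ ?_
    · rw [norm_div, norm_pow, hxw, div_self (norm_ne_zero_iff.2 hw0)]
    · change g _ = _
      have : (D' 0 j₁ ^ 3 / w) ^ 4 = (D' 0 j₁ ^ 4) ^ 3 / w ^ 4 := by rw [div_pow]; ring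
      rw [this, map_div₀, map_pow, hpow g hB hC, algEquiv_of_mem hw4K]
  have hrow (j : Fin 3) : FixedByRoots K B C (w * D' 0 j) := by
    intro g hB hC
    have : w * D' 0 j = D' 0 j₁ ^ 4 / (D' 0 j₁ ^ 3 / w) * (D' 0 j / D' 0 j₁) := by field_simp
    rw [this, map_mul, map_div₀, hpow g hB hC, ht g hB hC, hquot j g hB hC]
  obtain ⟨μ, hμ, hτw⟩ : ∃ μ : PadicAlgCl p, μ ^ 4 = 1 ∧ τ w = μ * w := by
    refine ⟨τ w / w, ?_, (div_mul_cancel₀ _ hw0).symm⟩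
    rw [div_pow, ← map_pow, algEquiv_of_mem hw4K, div_self (pow_ne_zero 4 hw0)]
  obtain ⟨ν, hν⟩ : ∃ ν, ν = μ * l := ⟨_, rfl⟩
  have hν4 : ν ^ 4 = 1 := by rw [hν, mul_pow, hμ, hl, one_mul]
  have hτν := algEquiv_of_pow_four_eq_one hp hν4 τ
  have h1 (j : Fin 3) : τ (w * D' 0 j) = ν * e 1 * (w * D' 1 j) := by
    rw [map_mul, hτw, hτ0, hν]; ring
  have h2 (j : Fin 3) : τ (w * D' 1 j) = ν * e 2 * (w * D' 2 j) := by
    rw [map_mul, hτw, hτ1, hν]; ring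
  have h3 (j : Fin 3) : τ (w * D' 2 j) = ν * (w * D' 0 j) := by
    rw [map_mul, hτw, hτ2, hν]; ring
  have h12 (j : Fin 3) : τ (τ (w * D' 0 j)) = ν ^ 2 * (e 1 * e 2) * (w * D' 2 j) := by
    rw [h1, map_mul, map_mul, hτν, algEquiv_of_sq_eq_one (he 1), h2]; ring
  have hνe : ν ^ 3 * (e 1 * e 2) = 1 := by
    have := h.apply_apply_apply (hrow j₁)
    rw [h12, map_mul, map_mul, map_mul, map_pow, hτν, algEquiv_of_sq_eq_one (he 1),
      algEquiv_of_sq_eq_one (he 2), h3] at this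
    refine mul_right_cancel₀ (mul_ne_zero hw0 hj₁) ?_
    linear_combination this
  -- Squaring `hνe` gives `ν⁶ = 1`, to be combined with `ν⁴ = 1`.
  have hν2 : ν ^ 2 = 1 := by
    have hν6 : ν ^ 6 = 1 := by
      linear_combination (ν ^ 3 * (e 1 * e 2) + 1) * hνe - ν ^ 6 * e 2 ^ 2 * he 1 - ν ^ 6 * he 2
    linear_combination hν6 - ν ^ 2 * hν4
  have hνe' : ν * (e 1 * e 2) = 1 := by linear_combination hνe - ν * (e 1 * e 2) * hν2
  choose n₀ hn₀ n₁ hn₁ n₂ hn₂ hn hn' hn'' using fun j => h.exists_coordinates hp (hrow j)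
  let N : Matrix (Fin 3) (Fin 3) K := fun i j =>
    (![⟨n₀ j, hn₀ j⟩, ⟨n₁ j, hn₁ j⟩, ⟨n₂ j, hn₂ j⟩] : Fin 3 → K) i
  have hN (i j : Fin 3) : ((N i j : K) : PadicAlgCl p) = ![n₀ j, n₁ j, n₂ j] i := by
    fin_cases i <;> rfl
  refine ⟨w⁻¹ • Matrix.diagonal ![1, e 2, e 1 * e 2], N, ?_, ?_⟩
  · refine isSign_smul_diagonal _ fun i => ?_
    fin_cases i <;> simp [mul_pow, he]
  ext i j
  rw [mul_assoc, Matrix.smul_mul, Matrix.smul_apply, Matrix.diagonal_mul, smul_eq_mul,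
    eq_inv_mul_iff_mul_eq₀ hw0]
  fin_cases i
  · simp [Matrix.mul_apply, Fin.sum_univ_three, hN, hn]
  · have : w * D' 1 j = e 2 * τ (w * D' 0 j) := by
      rw [h1]; linear_combination (-(w * D' 1 j)) * hνe'
    change w * D' 1 j = _
    rw [this, hn']
    simp [Matrix.mul_apply, Fin.sum_univ_three, hN]
  · have : w * D' 2 j = e 1 * e 2 * τ (τ (w * D' 0 j)) := by
      rw [h12]
      linear_combination (-(w * D' 2 j)) * (ν ^ 2 * e 2 ^ 2 * he 1 + ν ^ 2 * he 2 + hν2)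
    change w * D' 2 j = _
    rw [this, hn'']
    simp [Matrix.mul_apply, Fin.sum_univ_three, hN]

end Cyclic

/-! ### From factorisations of matrices to the set of twists. -/

section Twists

variable {k Ω : Type*} [Field k] [Field Ω] [Algebra k Ω]

/-- A system of representatives for the models of a rigid quartic gives all twists. -/
theorem exists_models_bijective [Infinite Ω] {F : MvPolynomial (Fin 3) Ω} (hF : IsRigid F)
    {φ : Matrix (Fin 3) (Fin 3) Ω} (hφ : φ.det ≠ 0) {Y₀ : SmoothQuartic k Ω}
    (hY₀ : Y₀.baseChange = subst φ F) {ι : Type*} {D : ι → Matrix (Fin 3) (Fin 3) Ω}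
    (hD : ∀ i, (D i).det ≠ 0)
    (hcoeff : ∀ i m, (subst (D i) F).coeff m ∈ (algebraMap k Ω).range)
    (hsurj : ∀ (Y : SmoothQuartic k Ω) (D' : Matrix (Fin 3) (Fin 3) Ω) (c : Ω), D'.det ≠ 0 →
      c ≠ 0 → subst D' F = c • Y.baseChange → ∃ (i : ι) (E : Matrix (Fin 3) (Fin 3) Ω)
        (N : Matrix (Fin 3) (Fin 3) k), IsSign E ∧ D' = E * D i * N.map (algebraMap k Ω))
    (hinj : ∀ (i j : ι) (E : Matrix (Fin 3) (Fin 3) Ω) (N : Matrix (Fin 3) (Fin 3) k),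
      IsSign E → E.det ≠ 0 → D j * N.map (algebraMap k Ω) = E * D i → i = j) :
    ∃ Y : ι → Model Y₀, (∀ i, (Y i).1.baseChange = subst (D i) F) ∧
      Function.Bijective fun i => Twist.mk (Y i) := by
  choose Z hZ using fun i => exists_smoothQuartic hF (hD i) (hcoeff i)
  have hiso (i : ι) : Isomorphic (Z i).baseChange Y₀.baseChange := by
    have hu : IsUnit φ.det := isUnit_iff_ne_zero.2 hφ
    refine ⟨Matrix.GeneralLinearGroup.mkOfDetNeZero (φ⁻¹ * D i) ?_, 1, ?_⟩
    · rw [Matrix.det_mul]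
      exact mul_ne_zero (Matrix.isUnit_nonsing_inv_det φ hu).ne_zero (hD i)
    · change subst (φ⁻¹ * D i) Y₀.baseChange = _
      rw [hY₀, subst_subst, ← mul_assoc, Matrix.mul_nonsing_inv φ hu, one_mul, hZ, Units.val_one,
        one_smul]
  refine ⟨fun i => ⟨Z i, hiso i⟩, hZ, fun i j hij => ?_, fun t => ?_⟩
  · have h : Isomorphic (Z i).form (Z j).form := Quotient.exact hij
    obtain ⟨E, N, hE, hE0, h⟩ := exists_isSign_of_isomorphic hF (hD i) (hD j) (hZ i) (hZ j) h
    exact hinj i j E N hE hE0 h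
  · obtain ⟨⟨Y, M, c, hM⟩, rfl⟩ := Quotient.exists_rep t
    rw [hY₀, subst_subst] at hM
    have hdet : (φ * (M : Matrix (Fin 3) (Fin 3) Ω)).det ≠ 0 := by
      rw [Matrix.det_mul]
      exact mul_ne_zero hφ ((Matrix.isUnit_iff_isUnit_det _).1 M.isUnit).ne_zero
    obtain ⟨i, E, N, hE, h⟩ := hsurj Y _ c hdet c.ne_zero hM
    refine ⟨i, (Quotient.sound ?_).symm⟩
    exact isomorphic_of_factor hF hdet hM (hZ i) hE h

theorem natCard_twist {Y₀ : SmoothQuartic k Ω} {n : ℕ} {Y : Fin n → Model Y₀}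
    (h : Function.Bijective fun i => Twist.mk (Y i)) : Nat.card (Twist Y₀) = n := by
  rw [← Nat.card_congr (Equiv.ofBijective _ h), Nat.card_fin]

end Twists

/-! ### The quartic `Y₁`: smoothness from the invariants, rigidity, and the Galois action on its
equation. -/

section Reconstruction

variable {K Ω : Type*} [Field K] [Field Ω] [Algebra K Ω] {I : Invariants K}

namespace Choice

theorem eval_roots (ch : Choice I Ω) (t : Ω) :
    t ^ 3 - algebraMap K Ω I.S1 * t ^ 2 + algebraMap K Ω I.S2 * t - algebraMap K Ω I.S3 =
      (t - ch.A) * (t - ch.B) * (t - ch.C) := by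
  have h := congrArg (Polynomial.eval t) ch.roots
  simpa [Invariants.cubic] using h

theorem prod_eq (ch : Choice I Ω) : ch.A * ch.B * ch.C = algebraMap K Ω I.S3 := by
  linear_combination ch.eval_roots 0

theorem sum_eq [CharZero Ω] (ch : Choice I Ω) : ch.A + ch.B + ch.C = algebraMap K Ω I.S1 := by
  have h2 : (2 : Ω) ≠ 0 := two_ne_zero
  refine mul_left_cancel₀ h2 ?_
  -- The second difference of the cubic at 0 isolates its quadratic coefficient.
  linear_combination -2 * ch.eval_roots 0 + ch.eval_roots 1 + ch.eval_roots (-1)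

theorem pair_eq [CharZero Ω] (ch : Choice I Ω) :
    ch.A * ch.B + ch.A * ch.C + ch.B * ch.C = algebraMap K Ω I.S2 := by
  have h2 : (2 : Ω) ≠ 0 := two_ne_zero
  refine mul_left_cancel₀ h2 ?_
  linear_combination ch.eval_roots (-1) - ch.eval_roots 1

theorem L_eq (ch : Choice I Ω) : I.L Ω = IntermediateField.adjoin K {ch.A, ch.B, ch.C} := by
  have hne : I.cubic ≠ 0 := by
    have : I.cubic.Monic := by
      unfold Invariants.cubic
      monicity!
    exact this.ne_zero
  rw [Invariants.L]
  congr 1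
  ext x
  rw [Polynomial.mem_rootSet, and_iff_right hne]
  have : Polynomial.aeval x I.cubic = (x - ch.A) * (x - ch.B) * (x - ch.C) := by
    rw [← ch.eval_roots]
    simp [Invariants.cubic]
  rw [this, mul_eq_zero, mul_eq_zero, sub_eq_zero, sub_eq_zero, sub_eq_zero, or_assoc]
  rfl

theorem degL_eq (ch : Choice I Ω) :
    I.degL Ω = Module.finrank K (IntermediateField.adjoin K {ch.A, ch.B, ch.C}) := by
  rw [Invariants.degL, ch.L_eq]

theorem map_Y1_of_cycle (ch : Choice I Ω) (hP : I.P ≠ 0) {σ : Ω ≃ₐ[K] Ω}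
    (hA : σ ch.A = ch.B) (hB : σ ch.B = ch.C) (hC : σ ch.C = ch.A) :
    map (σ : Ω →+* Ω) ch.Y1 = subst !![0, 0, 1; 1, 0, 0; 0, 1, 0] ch.Y1 := by
  rw [Y1, if_pos hP, map_standardForm, subst_cycle]
  simp [hA, hB, hC]

end Choice

theorem Invariants.ne_zero_of_disc (hdisc : I.disc ≠ 0) : I.I3 ≠ 0 ∧ I.I3'' ≠ 0 ∧ I.I6 ≠ 0 := by
  unfold Invariants.disc at hdisc
  refine ⟨?_, ?_, ?_⟩ <;> intro h <;> simp [h] at hdisc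

namespace Choice

variable [CharZero Ω]

/-- The factors of the discriminant reappear as minors: `A B C = I₃ P²`, the product of the three
terms `P² - 4 B C` and its analogues is `P⁴ I₆`, and the determinant condition evaluates to `P²
I₃''`. -/
theorem isSmoothStandard_of_P_ne_zero (ch : Choice I Ω) (hdisc : I.disc ≠ 0) (hP : I.P ≠ 0) :
    IsSmoothStandard ch.A ch.B ch.C (algebraMap K Ω I.P) (algebraMap K Ω I.P)
      (algebraMap K Ω I.P) := by
  obtain ⟨h3, h3'', h6⟩ := Invariants.ne_zero_of_disc hdisc
  have hι {x : K} (hx : x ≠ 0) : algebraMap K Ω x ≠ 0 := by simpa using hx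
  have e1 := ch.sum_eq
  have e2 := ch.pair_eq
  have e3 := ch.prod_eq
  have hS3 : I.S3 ≠ 0 := mul_ne_zero h3 (pow_ne_zero 2 hP)
  have hABC := e3 ▸ hι hS3
  have hS1 : I.S1 = I.P + I.I3'' + 4 * I.I3 := by simp only [Invariants.S1, Invariants.P]; ring
  have hK : CharZero K := (algebraMap K Ω).charZero
  have hS2 : 4 * I.S2 = I.P ^ 2 + 16 * I.I3 * (I.P + I.I3'') - I.I6 := by
    simp only [Invariants.S2]; ring
  have e0 : I.S3 = I.I3 * I.P ^ 2 := rfl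
  apply_fun algebraMap K Ω at hS1 hS2 e0
  simp only [map_add, map_sub, map_mul, map_pow, map_ofNat] at hS1 hS2 e0
  have hprod : (algebraMap K Ω I.P ^ 2 - 4 * ch.B * ch.C) *
      ((algebraMap K Ω I.P ^ 2 - 4 * ch.A * ch.C) * (algebraMap K Ω I.P ^ 2 - 4 * ch.A * ch.B)) =
      algebraMap K Ω I.P ^ 4 * algebraMap K Ω I.I6 := by
    have h : (algebraMap K Ω I.P ^ 2 - 4 * ch.B * ch.C) * ((algebraMap K Ω I.P ^ 2 -
        4 * ch.A * ch.C) * (algebraMap K Ω I.P ^ 2 - 4 * ch.A * ch.B)) =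
        algebraMap K Ω I.P ^ 6 -
        4 * algebraMap K Ω I.P ^ 4 * (ch.A * ch.B + ch.A * ch.C + ch.B * ch.C) +
        16 * algebraMap K Ω I.P ^ 2 * (ch.A * ch.B * ch.C) * (ch.A + ch.B + ch.C) -
        64 * (ch.A * ch.B * ch.C) ^ 2 := by ring
    rw [h, e1, e2, e3, e0, hS1]
    linear_combination -algebraMap K Ω I.P ^ 4 * hS2
  have hne := mul_ne_zero (pow_ne_zero 4 (hι hP)) (hι h6)
  rw [← hprod] at hne
  exact
  { hA := left_ne_zero_of_mul (left_ne_zero_of_mul hABC)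
    hB := right_ne_zero_of_mul (left_ne_zero_of_mul hABC)
    hC := right_ne_zero_of_mul hABC
    ha := left_ne_zero_of_mul hne
    hb := left_ne_zero_of_mul (right_ne_zero_of_mul hne)
    hc := right_ne_zero_of_mul (right_ne_zero_of_mul hne)
    hdet := by
      have : -4 * ch.A * ch.B * ch.C + ch.A * algebraMap K Ω I.P ^ 2 +
          ch.B * algebraMap K Ω I.P ^ 2 + ch.C * algebraMap K Ω I.P ^ 2 -
          algebraMap K Ω I.P * algebraMap K Ω I.P * algebraMap K Ω I.P =
          algebraMap K Ω I.P ^ 2 * algebraMap K Ω I.I3'' := by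
        linear_combination algebraMap K Ω I.P ^ 2 * e1 - 4 * e3 - 4 * e0 +
          algebraMap K Ω I.P ^ 2 * hS1
      rw [this]
      exact mul_ne_zero (pow_ne_zero 2 (hι hP)) (hι h3'') }

/-- With `A = 0` the other roots satisfy `B C = S₂` and `B + C = I₃'' + 4 I₃`. The two conditions on
`b` and `c` multiply to `-S₂³ I₆ / 4`, and the determinant condition becomes `S₂² I₃''`. -/
theorem isSmoothStandard_of_P_eq_zero (ch : Choice I Ω) (hdisc : I.disc ≠ 0) (hP : I.P = 0)
    (hS : I.S2 ≠ 0) :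
    IsSmoothStandard (algebraMap K Ω (I.I3 * I.S2)) ch.B ch.C 0 (algebraMap K Ω I.S2)
      (algebraMap K Ω I.S2) := by
  obtain ⟨h3, h3'', h6⟩ := Invariants.ne_zero_of_disc hdisc
  have hι {x : K} (hx : x ≠ 0) : algebraMap K Ω x ≠ 0 := by simpa using hx
  have e1 := ch.sum_eq
  have e2 := ch.pair_eq
  rw [ch.A_eq_zero hP] at e1 e2
  have hBC : ch.B * ch.C = algebraMap K Ω I.S2 := by linear_combination e2
  have hBC0 := hBC ▸ hι hS
  have hS1 : I.S1 = I.P + I.I3'' + 4 * I.I3 := by simp only [Invariants.S1, Invariants.P]; ring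
  have hK : CharZero K := (algebraMap K Ω).charZero
  have hS2 : 4 * I.S2 = I.P ^ 2 + 16 * I.I3 * (I.P + I.I3'') - I.I6 := by
    simp only [Invariants.S2]; ring
  rw [hP] at hS1 hS2
  apply_fun algebraMap K Ω at hS1 hS2
  simp only [map_add, map_sub, map_mul, map_pow, map_ofNat, map_zero] at hS1 hS2
  rw [map_mul]
  have hprod : 4 * ((algebraMap K Ω I.S2 ^ 2 - 4 * (algebraMap K Ω I.I3 * algebraMap K Ω I.S2) *
      ch.C) * (algebraMap K Ω I.S2 ^ 2 - 4 * (algebraMap K Ω I.I3 * algebraMap K Ω I.S2) * ch.B)) =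
      -(algebraMap K Ω I.S2 ^ 3 * algebraMap K Ω I.I6) := by
    linear_combination 64 * algebraMap K Ω I.I3 ^ 2 * algebraMap K Ω I.S2 ^ 2 * hBC -
      16 * algebraMap K Ω I.I3 * algebraMap K Ω I.S2 ^ 3 * (e1 + hS1) +
      algebraMap K Ω I.S2 ^ 3 * hS2
  have hne := neg_ne_zero.2 (mul_ne_zero (pow_ne_zero 3 (hι hS)) (hι h6))
  rw [← hprod] at hne
  replace hne := right_ne_zero_of_mul hne
  exact
  { hA := mul_ne_zero (hι h3) (hι hS)
    hB := left_ne_zero_of_mul hBC0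
    hC := right_ne_zero_of_mul hBC0
    ha := by
      have : (0 : Ω) ^ 2 - 4 * ch.B * ch.C = -(4 * algebraMap K Ω I.S2) := by
        linear_combination -4 * hBC
      rw [this]
      exact neg_ne_zero.2 (mul_ne_zero (by norm_num) (hι hS))
    hb := left_ne_zero_of_mul hne
    hc := right_ne_zero_of_mul hne
    hdet := by
      have : -4 * (algebraMap K Ω I.I3 * algebraMap K Ω I.S2) * ch.B * ch.C +
          (algebraMap K Ω I.I3 * algebraMap K Ω I.S2) * 0 ^ 2 +
          ch.B * algebraMap K Ω I.S2 ^ 2 + ch.C * algebraMap K Ω I.S2 ^ 2 -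
          0 * algebraMap K Ω I.S2 * algebraMap K Ω I.S2 =
          algebraMap K Ω I.S2 ^ 2 * algebraMap K Ω I.I3'' := by
        linear_combination algebraMap K Ω I.S2 ^ 2 * (e1 + hS1) -
          4 * algebraMap K Ω I.I3 * algebraMap K Ω I.S2 * hBC
      rw [this]
      exact mul_ne_zero (pow_ne_zero 2 (hι hS)) (hι h3'') }

theorem isSmoothStandard_of_eq_zero (ch : Choice I Ω) (hdisc : I.disc ≠ 0) (hP : I.P = 0) :
    IsSmoothStandard (algebraMap K Ω I.I3) (algebraMap K Ω I.I3) (algebraMap K Ω I.I3) 0 0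
      ch.r := by
  obtain ⟨h3, h3'', h6⟩ := Invariants.ne_zero_of_disc hdisc
  have hι {x : K} (hx : x ≠ 0) : algebraMap K Ω x ≠ 0 := by simpa using hx
  have hS1 : I.S1 = I.P + I.I3'' + 4 * I.I3 := by simp only [Invariants.S1, Invariants.P]; ring
  rw [hP] at hS1
  apply_fun algebraMap K Ω at hS1
  have hr := ch.r_sq
  simp only [map_add, map_mul, map_ofNat, map_zero] at hS1 hr
  have h4 : (4 : Ω) ≠ 0 := by norm_num
  have hsq : (0 : Ω) ^ 2 - 4 * algebraMap K Ω I.I3 * algebraMap K Ω I.I3 ≠ 0 := by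
    have := neg_ne_zero.2 (mul_ne_zero (mul_ne_zero h4 (hι h3)) (hι h3))
    convert this using 1
    ring
  refine ⟨hι h3, hι h3, hι h3, hsq, hsq, ?_, ?_⟩
  · have := mul_ne_zero (hι h3) (hι h3'')
    convert this using 1
    linear_combination hr + algebraMap K Ω I.I3 * hS1
  · have := mul_ne_zero (pow_ne_zero 2 (hι h3)) (hι h3'')
    convert this using 1
    linear_combination algebraMap K Ω I.I3 * hr + algebraMap K Ω I.I3 ^ 2 * hS1

/-- The third equation has `a = b = 0`, so `A a² = B b²` and it is always special. Hence that case,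
with its exceptional `φ`, never occurs under the hypotheses. -/
theorem S2_ne_zero_of_nonSpecial [IsAlgClosed Ω] (ch : Choice I Ω) (hdisc : I.disc ≠ 0)
    (hns : NonSpecial ch.Y1) (hP : I.P = 0) : I.S2 ≠ 0 := by
  intro hS
  rw [Y1, if_neg (not_not.2 hP), if_neg (not_not.2 hS)] at hns
  exact hns.ne₀₁ (ch.isSmoothStandard_of_eq_zero hdisc hP) (by ring)

/-- The shape of a non-special quartic `Y₁`, in the two cases that occur. -/
theorem Y1_cases [IsAlgClosed Ω] (ch : Choice I Ω) (hdisc : I.disc ≠ 0)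
    (hns : NonSpecial ch.Y1) :
    (I.P ≠ 0 ∧ ch.Y1 = standardForm ch.A ch.B ch.C (algebraMap K Ω I.P) (algebraMap K Ω I.P)
      (algebraMap K Ω I.P)) ∨
    (I.P = 0 ∧ I.S2 ≠ 0 ∧ ch.Y1 = standardForm (algebraMap K Ω (I.I3 * I.S2)) ch.B ch.C 0
      (algebraMap K Ω I.S2) (algebraMap K Ω I.S2)) := by
  by_cases hP : I.P = 0
  · have hS := ch.S2_ne_zero_of_nonSpecial hdisc hns hP
    refine Or.inr ⟨hP, hS, ?_⟩
    rw [Y1, if_neg (not_not.2 hP), if_pos hS]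
  · refine Or.inl ⟨hP, ?_⟩
    rw [Y1, if_pos hP]

theorem isRigid_Y1 [IsAlgClosed Ω] (ch : Choice I Ω) (hdisc : I.disc ≠ 0)
    (hns : NonSpecial ch.Y1) : IsRigid ch.Y1 := by
  have key {A B C a b c : Ω} (hY : ch.Y1 = standardForm A B C a b c)
      (h : IsSmoothStandard A B C a b c) (hb : b ≠ 0) (hc : c ≠ 0) : IsRigid ch.Y1 := by
    rw [hY] at hns ⊢
    exact ⟨isHomogeneous_standardForm A B C a b c, h.nonsingular,
      fun d u hd => subst_diagonal_standardForm A B C a b c hd,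
      fun M hM => isSign_of_isIso h hb hc hns hM⟩
  have hι {x : K} (hx : x ≠ 0) : algebraMap K Ω x ≠ 0 := by simpa using hx
  rcases ch.Y1_cases hdisc hns with ⟨hP, hY⟩ | ⟨hP, hS, hY⟩
  · exact key hY (ch.isSmoothStandard_of_P_ne_zero hdisc hP) (hι hP) (hι hP)
  · exact key hY (ch.isSmoothStandard_of_P_eq_zero hdisc hP hS) (hι hS) (hι hS)

/-- Where the mixed coefficients agree, the distinct quantities of `NonSpecial.injective` are the
roots times a common nonzero square. If `P = 0`, the root `A = 0` differs from `B` and `C` by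
smoothness. -/
theorem distinct_roots [IsAlgClosed Ω] (ch : Choice I Ω) (hdisc : I.disc ≠ 0)
    (hns : NonSpecial ch.Y1) : ch.A ≠ ch.B ∧ ch.A ≠ ch.C ∧ ch.B ≠ ch.C := by
  rcases ch.Y1_cases hdisc hns with ⟨hP, hY⟩ | ⟨hP, hS, hY⟩
  · rw [hY] at hns
    have hinj := hns.injective (ch.isSmoothStandard_of_P_ne_zero hdisc hP)
    refine ⟨fun h => ?_, fun h => ?_, fun h => ?_⟩
    · exact absurd (@hinj 0 1 (by simp [h])) (by decide)
    · exact absurd (@hinj 0 2 (by simp [h])) (by decide)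
    · exact absurd (@hinj 1 2 (by simp [h])) (by decide)
  · rw [hY] at hns
    have hsm := ch.isSmoothStandard_of_P_eq_zero hdisc hP hS
    have hinj := hns.injective hsm
    rw [ch.A_eq_zero hP]
    exact ⟨hsm.hB.symm, hsm.hC.symm,
      fun h => absurd (@hinj 1 2 (by simp [h])) (by decide)⟩

theorem map_Y1_of_fixed [IsAlgClosed Ω] (ch : Choice I Ω) (hdisc : I.disc ≠ 0)
    (hns : NonSpecial ch.Y1) {σ : Ω ≃ₐ[K] Ω} (hA : σ ch.A = ch.A) (hB : σ ch.B = ch.B)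
    (hC : σ ch.C = ch.C) : map (σ : Ω →+* Ω) ch.Y1 = ch.Y1 := by
  rcases ch.Y1_cases hdisc hns with ⟨hP, hY⟩ | ⟨hP, hS, hY⟩ <;>
  · rw [hY, map_standardForm]
    simp [hA, hB, hC]

theorem map_Y1_of_swap [IsAlgClosed Ω] (ch : Choice I Ω) (hdisc : I.disc ≠ 0)
    (hns : NonSpecial ch.Y1) {σ : Ω ≃ₐ[K] Ω} (hA : σ ch.A = ch.A) (hB : σ ch.B = ch.C)
    (hC : σ ch.C = ch.B) :
    map (σ : Ω →+* Ω) ch.Y1 = subst !![1, 0, 0; 0, 0, 1; 0, 1, 0] ch.Y1 := by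
  rcases ch.Y1_cases hdisc hns with ⟨hP, hY⟩ | ⟨hP, hS, hY⟩ <;>
  · rw [hY, map_standardForm, subst_swap₁₂]
    simp [hA, hB, hC]

end Choice

end Reconstruction

/-! ### Assembly of the three cases over `K`. -/

section TwistsOfCianiQuartics

variable {p : ℕ} [Fact p.Prime] {K : IntermediateField (Qpnr p) (PadicAlgCl p)}
variable {F : MvPolynomial (Fin 3) (PadicAlgCl p)}

theorem mem_range_of_mem {x : PadicAlgCl p} (hx : x ∈ K) :
    x ∈ (algebraMap K (PadicAlgCl p)).range :=
  ⟨⟨x, hx⟩, rfl⟩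

theorem det_diagonal_splitTwist {ϖ : PadicAlgCl p} (hϖ : ϖ ≠ 0) (i : Fin 4) :
    (Matrix.diagonal (splitTwist ϖ i)).det ≠ 0 := by
  rw [Matrix.det_diagonal, Fin.prod_univ_three]
  fin_cases i <;> simp [splitTwist, hϖ]

theorem coeff_subst_splitTwist_mem (hF : IsRigid F)
    (hfix : ∀ σ : PadicAlgCl p ≃ₐ[K] PadicAlgCl p,
      map (σ : PadicAlgCl p →+* PadicAlgCl p) F = F)
    {ϖ : PadicAlgCl p} (hϖK : ϖ ^ 2 ∈ K) (i : Fin 4) (m : Fin 3 →₀ ℕ) :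
    (subst (Matrix.diagonal (splitTwist ϖ i)) F).coeff m ∈ K := by
  refine mem_of_fixed fun σ => ?_
  obtain ⟨ε, hε, hσ⟩ : ∃ ε : PadicAlgCl p, ε ^ 2 = 1 ∧ σ ϖ = ε * ϖ := by
    have := algEquiv_of_mem hϖK σ
    rw [map_pow] at this
    rcases sq_eq_sq_iff_eq_or_eq_neg.1 this with h | h
    · exact ⟨1, one_pow 2, by rw [h, one_mul]⟩
    · exact ⟨-1, by ring, by rw [h]; ring⟩
  refine map_subst_eq_of_diagonal hF (P := 1) ((hfix σ).trans (subst_one F).symm)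
    (d := splitTwist ε i) (u := 1) (fun l => ?_) (one_pow 2) ?_ m
  · fin_cases i <;> fin_cases l <;> simp [splitTwist, hε]
  · rw [one_mul, Matrix.diagonal_mul_diagonal, Matrix.diagonal_map (map_zero σ)]
    congr 1
    ext l
    fin_cases i <;> fin_cases l <;> simp [splitTwist, hσ]

theorem twists_split (hp : 3 < p) (hF : IsRigid F)
    (hfix : ∀ σ : PadicAlgCl p ≃ₐ[K] PadicAlgCl p,
      map (σ : PadicAlgCl p →+* PadicAlgCl p) F = F)
    {Y₀ : SmoothQuartic K (PadicAlgCl p)} (hY₀ : Y₀.baseChange = F)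
    {ϖ : PadicAlgCl p} (hϖK : ϖ ^ 2 ∈ K) (hϖ : HasValuationOneDiv K ϖ 2) :
    ∃ Y : Fin 4 → Model Y₀,
      (∀ i, (Y i).1.baseChange = subst (Matrix.diagonal (splitTwist ϖ i)) F) ∧
      Function.Bijective fun i => Twist.mk (Y i) := by
  obtain ⟨u, hu, hϖu⟩ := hϖ
  have hϖ0 : ϖ ≠ 0 := by
    rintro rfl
    rw [norm_zero, zero_pow two_ne_zero] at hϖu
    exact hu.2.1 (norm_eq_zero.1 hϖu.symm)
  exact exists_models_bijective hF (φ := 1) (by simp) (hY₀.trans (subst_one F).symm)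
    (fun i => det_diagonal_splitTwist hϖ0 i)
    (fun i m => mem_range_of_mem (coeff_subst_splitTwist_mem hF hfix hϖK i m))
    (fun Y D c hD hc hY => exists_factor_split hp hF hfix hu hϖK hϖu hD hc hY)
    (fun i j E N hE hE0 h => eq_of_isSign_split hu hϖK hϖu hE hE0 h)

theorem twists_swap {A B C : PadicAlgCl p} {τ : PadicAlgCl p ≃ₐ[K] PadicAlgCl p} (hp : 3 < p)
    (hF : IsRigid F) (h : SwapAction K F A B C τ) {u ϖ ζ : PadicAlgCl p}
    (hq : QuarticRoot K u ϖ ζ) {Y₀ : SmoothQuartic K (PadicAlgCl p)}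
    (hY₀ : Y₀.baseChange = subst !![1, 0, 0; 0, 1, B; 0, 1, C] F) :
    ∃ Y : Fin 2 → Model Y₀, (∀ i, (Y i).1.baseChange = subst (swapTwist B C ϖ ζ i) F) ∧
      Function.Bijective fun i => Twist.mk (Y i) :=
  exists_models_bijective hF (det_swapTwist h.roots.hBC hq.ne_zero hq.ne_zero' 0) hY₀
    (det_swapTwist h.roots.hBC hq.ne_zero hq.ne_zero')
    (fun i m => mem_range_of_mem (coeff_subst_swapTwist_mem hF h hp hq i m))
    (fun _ _ _ hD hc hY => exists_factor_swap hp hF h hq hD hc hY)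
    (fun _ _ _ _ hE hE0 hN => eq_of_isSign_swap h hp hq hE hE0 hN)

theorem natCard_twist_cycle {A B C : PadicAlgCl p} {τ : PadicAlgCl p ≃ₐ[K] PadicAlgCl p}
    (hp : 3 < p) (hF : IsRigid F) (h : CycleAction K F A B C τ) {u : PadicAlgCl p}
    (hu : IsUniformizer K u) {Y₀ : SmoothQuartic K (PadicAlgCl p)}
    (hY₀ : Y₀.baseChange = subst !![1, A, A ^ 2; 1, B, B ^ 2; 1, C, C ^ 2] F) :
    Nat.card (Twist Y₀) = 1 := by
  have hdet := vandermonde_det_ne_zero h.roots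
  obtain ⟨Y, -, hY⟩ := exists_models_bijective hF hdet hY₀
    (D := fun _ : Fin 1 => !![1, A, A ^ 2; 1, B, B ^ 2; 1, C, C ^ 2]) (fun _ => hdet)
    (fun _ m => mem_range_of_mem (coeff_subst_vandermonde_mem hF h hp m))
    (fun _ _ _ hD hc hY => ⟨0, exists_factor_cycle hp hF h hu hD hc hY⟩)
    (fun _ _ _ _ _ _ _ => Subsingleton.elim _ _)
  exact natCard_twist hY

variable {I : Invariants K}

theorem Choice.cubicRoots (ch : Choice I (PadicAlgCl p)) (hdisc : I.disc ≠ 0)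
    (hns : NonSpecial ch.Y1) : CubicRoots K ch.A ch.B ch.C := by
  obtain ⟨hAB, hAC, hBC⟩ := ch.distinct_roots hdisc hns
  refine ⟨?_, ?_, ?_, hAB, hAC, hBC⟩
  · rw [ch.sum_eq]; exact I.S1.2
  · rw [ch.pair_eq]; exact I.S2.2
  · rw [ch.prod_eq]; exact I.S3.2

theorem Choice.degL_cases (ch : Choice I (PadicAlgCl p)) (hp : 3 < p) (hdisc : I.disc ≠ 0)
    (hns : NonSpecial ch.Y1) :
    I.degL (PadicAlgCl p) = 1 ∨ I.degL (PadicAlgCl p) = 2 ∨ I.degL (PadicAlgCl p) = 3 := by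
  have := (ch.cubicRoots hdisc hns).finrank_le_three hp
  rw [ch.degL_eq]
  omega

theorem Choice.phi_eq_one (ch : Choice I (PadicAlgCl p)) (hdisc : I.disc ≠ 0)
    (hns : NonSpecial ch.Y1) (hdeg : I.degL (PadicAlgCl p) = 1) : ch.phi = 1 := by
  rw [Choice.phi, if_pos hdeg, if_neg]
  exact fun h => ch.S2_ne_zero_of_nonSpecial hdisc hns h.1 h.2.1

theorem Choice.map_Y1_of_degL_eq_one (ch : Choice I (PadicAlgCl p)) (hdisc : I.disc ≠ 0)
    (hns : NonSpecial ch.Y1) (hdeg : I.degL (PadicAlgCl p) = 1)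
    (σ : PadicAlgCl p ≃ₐ[K] PadicAlgCl p) :
    map (σ : PadicAlgCl p →+* PadicAlgCl p) ch.Y1 = ch.Y1 := by
  rw [ch.degL_eq, CubicRoots.finrank_eq_one_iff] at hdeg
  exact ch.map_Y1_of_fixed hdisc hns (algEquiv_of_mem hdeg.1 σ) (algEquiv_of_mem hdeg.2.1 σ)
    (algEquiv_of_mem hdeg.2.2 σ)

theorem Choice.exists_swapAction (ch : Choice I (PadicAlgCl p)) (hdisc : I.disc ≠ 0)
    (hns : NonSpecial ch.Y1) (hdeg : I.degL (PadicAlgCl p) = 2) :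
    ∃ τ, SwapAction K ch.Y1 ch.A ch.B ch.C τ := by
  have hroots := ch.cubicRoots hdisc hns
  obtain ⟨a, ha⟩ := ch.A_rational hdeg
  have hA : ch.A ∈ K := ha ▸ a.2
  have hB : ch.B ∉ K := by
    intro hB
    have := (CubicRoots.finrank_eq_one_iff K ch.A ch.B ch.C).2
      ⟨hA, hB, hroots.mem_of_rational hA hB⟩
    rw [ch.degL_eq] at hdeg
    omega
  obtain ⟨τ, hτB, hτC⟩ := hroots.exists_swap hA hB
  exact ⟨τ, hroots, hA, hτB, hτC,
    fun g hB hC => ch.map_Y1_of_fixed hdisc hns (algEquiv_of_mem hA g) hB hC,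
    ch.map_Y1_of_swap hdisc hns (algEquiv_of_mem hA τ) hτB hτC⟩

theorem Choice.exists_cycleAction (ch : Choice I (PadicAlgCl p)) (hp : 3 < p)
    (hdisc : I.disc ≠ 0) (hns : NonSpecial ch.Y1) (hdeg : I.degL (PadicAlgCl p) = 3) :
    ∃ τ, CycleAction K ch.Y1 ch.A ch.B ch.C τ := by
  have hroots := ch.cubicRoots hdisc hns
  rw [ch.degL_eq] at hdeg
  obtain ⟨hA, hB, hC⟩ := hroots.irrational_of_finrank_eq_three hdeg
  obtain ⟨τ, hτA, hτB, hτC⟩ := hroots.exists_cycle hp hA hB hC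
  -- If `P = 0` then 0 is a rational root, so degree 3 occurs only for the equation that is
  -- symmetric in the roots.
  have hP : I.P ≠ 0 := fun hP => hA (by rw [ch.A_eq_zero hP]; exact K.zero_mem)
  exact ⟨τ, hroots, hA, hτA, hτB, hτC,
    fun g hA hB hC => ch.map_Y1_of_fixed hdisc hns hA hB hC, ch.map_Y1_of_cycle hP hτA hτB hτC⟩

theorem exists_quarticRoot {u : PadicAlgCl p} (hu : IsUniformizer K u) :
    ∃ ϖ ζ, QuarticRoot K u ϖ ζ := by
  obtain ⟨ϖ, hϖ⟩ := IsAlgClosed.exists_pow_nat_eq u (n := 4) (by norm_num)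
  obtain ⟨ζ, hζ⟩ := IsAlgClosed.exists_pow_nat_eq (-1 : PadicAlgCl p) (n := 2) (by norm_num)
  exact ⟨ϖ, ζ, hu, hϖ ▸ hu.1, by rw [← norm_pow, hϖ], hζ⟩

theorem exists_sqrt_uniformizer {u : PadicAlgCl p} (hu : IsUniformizer K u) :
    ∃ ϖ : PadicAlgCl p, ϖ ^ 2 ∈ K ∧ HasValuationOneDiv K ϖ 2 := by
  obtain ⟨ϖ, hϖ⟩ := IsAlgClosed.exists_pow_nat_eq u (n := 2) (by norm_num)
  exact ⟨ϖ, hϖ ▸ hu.1, u, hu, by rw [← norm_pow, hϖ]⟩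

theorem sq_eq_neg_one_of_isPrimitiveRoot {k : Type*} [Field k] {ζ : k}
    (hζ : IsPrimitiveRoot ζ 4) : ζ ^ 2 = -1 := by
  have h1 : (ζ ^ 2) ^ 2 = 1 ^ 2 := by rw [← pow_mul, one_pow]; exact hζ.pow_eq_one
  refine (sq_eq_sq_iff_eq_or_eq_neg.1 h1).resolve_left fun h => ?_
  have := (hζ.pow_eq_one_iff_dvd 2).1 h
  omega

end TwistsOfCianiQuartics

end Ciani

theorem lemma3p5 (p : ℕ) [Fact p.Prime] (hp : 3 < p)
    (K : IntermediateField (Ciani.Qpnr p) (PadicAlgCl p)) [FiniteDimensional (Ciani.Qpnr p) K]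
    (I : Ciani.Invariants K) (hdisc : I.disc ≠ 0)
    (ch : Ciani.Choice I (PadicAlgCl p)) (hns : Ciani.NonSpecial ch.Y1) :
    I.degL (PadicAlgCl p) ∈ ({1, 2, 3} : Set ℕ) ∧
    ∃ Y₀ : Ciani.SmoothQuartic K (PadicAlgCl p),
      Y₀.baseChange = Ciani.subst ch.phi ch.Y1 ∧
      (I.degL (PadicAlgCl p) = 1 → Nat.card (Ciani.Twist Y₀) = 4) ∧
      (I.degL (PadicAlgCl p) = 2 → Nat.card (Ciani.Twist Y₀) = 2) ∧
      (I.degL (PadicAlgCl p) = 3 → Nat.card (Ciani.Twist Y₀) = 1) ∧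
      (I.degL (PadicAlgCl p) = 1 →
        ∀ ϖ : PadicAlgCl p, ϖ ^ 2 ∈ K → Ciani.HasValuationOneDiv K ϖ 2 →
          ∃ Y : Fin 4 → Ciani.Model Y₀,
            (Y 0).1.baseChange =
              Ciani.subst !![1, 0, 0; 0, 1, 0; 0, 0, 1] Y₀.baseChange ∧
            (Y 1).1.baseChange =
              Ciani.subst !![ϖ, 0, 0; 0, 1, 0; 0, 0, 1] Y₀.baseChange ∧
            (Y 2).1.baseChange =
              Ciani.subst !![1, 0, 0; 0, ϖ, 0; 0, 0, 1] Y₀.baseChange ∧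
            (Y 3).1.baseChange =
              Ciani.subst !![1, 0, 0; 0, 1, 0; 0, 0, ϖ] Y₀.baseChange ∧
            Function.Bijective fun i => Ciani.Twist.mk (Y i)) ∧
      (I.degL (PadicAlgCl p) = 2 →
        ∀ ϖ₁ ζ₄ : PadicAlgCl p, ϖ₁ ^ 4 ∈ K → Ciani.HasValuationOneDiv K ϖ₁ 4 →
          IsPrimitiveRoot ζ₄ 4 →
          ∃ Y : Fin 2 → Ciani.Model Y₀,
            (Y 0).1.baseChange =
              Ciani.subst !![1, 0, 0; 0, 1, ch.B; 0, 1, ch.C] ch.Y1 ∧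
            (Y 1).1.baseChange =
              Ciani.subst !![ϖ₁, 0, 0; 0, 1, ch.B; 0, ζ₄, ζ₄ * ch.C] ch.Y1 ∧
            Function.Bijective fun i => Ciani.Twist.mk (Y i)) := by
  have hF := ch.isRigid_Y1 hdisc hns
  obtain ⟨u, hu⟩ := Ciani.exists_isUniformizer K
  rcases ch.degL_cases hp hdisc hns with hdeg | hdeg | hdeg
  · have hfix := ch.map_Y1_of_degL_eq_one hdisc hns hdeg
    have hphi := ch.phi_eq_one hdisc hns hdeg
    obtain ⟨Y₀, hY₀⟩ := Ciani.exists_smoothQuartic (k := K) hF (D := ch.phi) (by simp [hphi])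
      fun m => Ciani.mem_range_of_mem (Ciani.mem_of_fixed fun σ => by
        have := congrArg (MvPolynomial.coeff m) (hfix σ)
        rw [MvPolynomial.coeff_map] at this
        rw [hphi, Ciani.subst_one]
        exact this)
    have hY₀' : Y₀.baseChange = ch.Y1 := by rw [hY₀, hphi, Ciani.subst_one]
    -- The cardinality does not mention a choice of root, so a square root of some uniformizer is
    -- supplied here; the explicit list is then proved for an arbitrary one.
    obtain ⟨ϖ₀, hϖ₀K, hϖ₀⟩ := Ciani.exists_sqrt_uniformizer hu
    obtain ⟨Y', -, hY'⟩ := Ciani.twists_split hp hF hfix hY₀' hϖ₀K hϖ₀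
    refine ⟨by simp [hdeg], Y₀, hY₀, fun _ => Ciani.natCard_twist hY', by omega, by omega,
      fun _ ϖ hϖK hϖ => ?_, by omega⟩
    obtain ⟨Y, hY, hbij⟩ := Ciani.twists_split hp hF hfix hY₀' hϖK hϖ
    refine ⟨Y, ?_, ?_, ?_, ?_, hbij⟩ <;>
    · rw [hY, hY₀']
      congr 1
      ext i j
      fin_cases i <;> fin_cases j <;> simp [Ciani.splitTwist]
  · obtain ⟨τ, h⟩ := ch.exists_swapAction hdisc hns hdeg
    have hphi : ch.phi = !![1, 0, 0; 0, 1, ch.B; 0, 1, ch.C] := by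
      rw [Ciani.Choice.phi, if_neg (by omega), if_pos hdeg]
    obtain ⟨ϖ₀, ζ₀, hq₀⟩ := Ciani.exists_quarticRoot hu
    obtain ⟨Y₀, hY₀⟩ := Ciani.exists_smoothQuartic (k := K) hF (D := ch.phi)
      (by rw [hphi]; exact Ciani.det_swapTwist h.roots.hBC hq₀.ne_zero hq₀.ne_zero' 0)
      fun m => Ciani.mem_range_of_mem (by
        rw [hphi]; exact Ciani.coeff_subst_swapTwist_mem hF h hp hq₀ 0 m)
    have hY₀' := hphi ▸ hY₀
    obtain ⟨Y', -, hY'⟩ := Ciani.twists_swap hp hF h hq₀ hY₀'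
    refine ⟨by simp [hdeg], Y₀, hY₀, by omega, fun _ => Ciani.natCard_twist hY', by omega,
      by omega, fun _ ϖ ζ hϖK ⟨v, hv, hϖ⟩ hζ => ?_⟩
    obtain ⟨Y, hY, hbij⟩ := Ciani.twists_swap hp hF h
      ⟨hv, hϖK, hϖ, Ciani.sq_eq_neg_one_of_isPrimitiveRoot hζ⟩ hY₀'
    exact ⟨Y, hY 0, hY 1, hbij⟩
  · obtain ⟨τ, h⟩ := ch.exists_cycleAction hp hdisc hns hdeg
    have hphi : ch.phi = !![1, ch.A, ch.A ^ 2; 1, ch.B, ch.B ^ 2; 1, ch.C, ch.C ^ 2] := by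
      rw [Ciani.Choice.phi, if_neg (by omega), if_neg (by omega)]
    obtain ⟨Y₀, hY₀⟩ := Ciani.exists_smoothQuartic (k := K) hF (D := ch.phi)
      (by rw [hphi]; exact Ciani.vandermonde_det_ne_zero h.roots)
      fun m => Ciani.mem_range_of_mem (by
        rw [hphi]; exact Ciani.coeff_subst_vandermonde_mem hF h hp m)
    exact ⟨by simp [hdeg], Y₀, hY₀, by omega, by omega,
      fun _ => Ciani.natCard_twist_cycle hp hF h hu (hphi ▸ hY₀), by omega, by omega⟩
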